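/- **Setting.** For $k,n\in\mathbb N$ let $\widetilde G\in(\mathbb R^n)^{\otimes k}$ have i.i.d. $\mathcal N(0,1)$ entries. A symmetrized Gaussian $k$-tensor is a random tensor with the law of $\frac{1}{\sqrt{k!}}\sum_{\pi\in S_k}\widetilde G^{\pi}$, where $\widetilde G^\pi_{i_1,\dots,i_k}=\widetilde G_{i_{\pi(1)},\dots,i_{\pi(k)}}$. For a tensor $T$ symmetric under permutations of its indices and a $k$-element set $S=\{i_1,\dots,i_k\}\subseteq[n]$ write $T_S=T_{i_1,\dots,i_k}$. For a set $V$ let $\mathrm{Part}_k(V)$ be the collection of partitions of $V$ into sets of size $k$, and let $\mathrm{Part}_k(\ell)=|\mathrm{Part}_k(V)|$ for $|V|=\ell$. For $\ell=ck$ with $c\in\mathbb N^+$ define: * the Kikuchi matrix $\mathcal K_\ell(T)=\sum_{S\in\binom{[n]}{k}}T_S\,\mathcal K_\ell(S)$, indexed by $\binom{[n]}{\ell}\times\binom{[n]}{\ell}$, where $\mathcal K_\ell(S)_{V,U}=1$ if $V\,\triangle\,U=S$ and $0$ otherwise; and $d_\ell=\binom{n-\ell}{k/2}\binom{\ell}{k/2}$;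 * the guiding vector $\Gamma^\ell(T)\in\mathbb R^{\binom{[n]}{\ell}}$ with coordinates $\Gamma^\ell(T)_V=\big(\binom n\ell\,\mathrm{Part}_k(\ell)\big)^{-1/2}\sum_{\{S_1,\dots,S_c\}\in\mathrm{Part}_k(V)}\prod_{j=1}^cT_{S_j}$. **Theorem.** Let $k\ge4$ be even and let $\gamma>0$ be a constant, $\gamma\neq1$. There is a function $\mathrm{err}(n)$, depending only on $k$ and $\gamma$, with $\mathrm{err}(n)\to0$ as $n\to\infty$, such that the following holds for all $n$, all $\ell=ck$ with $c\in\mathbb N^+$, all $z\in\{\pm1\}^n$, all $\varepsilon>0$ and all $0<\beta\le 0.1/\ell^{k/2}$ that satisfy $$\ell^{(k-2)/2}\ \ge\ C\cdot\frac{n^{k/2}}{\beta^2\binom nk}\cdot\ln n,\qquad C=\frac{2(1+\varepsilon)}{(1-\gamma)^2\binom{k}{k/2}} .$$ Let $G,H$ be independent symmetrized Gaussian $k$-tensors in dimension $n$, let $T=\beta z^{\otimes k}+G$, $\zeta=1/\ln n$, and $$T^+=T+\zeta H,\qquad T^-=T-\tfrac1\zeta H .$$ Let $\Gamma$ be the unit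 vector in the direction of $\Gamma^\ell(T^-)$. Then, with probability at least $1-\mathrm{err}(n)$, there is a unit vector $v$ in the span of the eigenspaces of $\mathcal K_\ell(T^+)$ for eigenvalues at least $(1-\gamma)\,d_\ell\,\beta$ such that $$\langle v,\Gamma\rangle^2\ \ge\ \beta^{2c}\,\xi,\qquad \xi=\mathrm{Part}_k(\ell)\cdot\frac{\gamma}{10}\cdot\Big(\frac1{1+\ln^2n}\Big)^{c}\cdot\frac1{\ln n}.$$ -/

import Mathlib

open MeasureTheory ProbabilityTheory

namespace TensorPCA

/-- Real tensors of order `k` in dimension `n`. -/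
abbrev Tensor (n k : ℕ) : Type := (Fin k → Fin n) → ℝ

/-- `(k!)^{-1/2} ∑_{π ∈ S_k} A^π`, where `A^π_{i₁,…,i_k} = A_{i_{π(1)},…,i_{π(k)}}`. -/
noncomputable def symmetrize {n k : ℕ} (A : Tensor n k) : Tensor n k :=
  fun i => (1 / Real.sqrt (k.factorial : ℝ)) * ∑ π : Equiv.Perm (Fin k), A (i ∘ π)

/-- The law of a symmetrized Gaussian `k`-tensor: the symmetrization of a tensor whose `n^k` entries
are i.i.d. standard Gaussian. -/
noncomputable def symmGaussianLaw (n k : ℕ) : Measure (Tensor n k) :=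
  (Measure.pi fun _ : Fin k → Fin n => gaussianReal 0 1).map symmetrize

/-- The spiked tensor `β z^{⊗k} + G`. -/
noncomputable def spiked {n k : ℕ} (β : ℝ) (z : Fin n → ℝ) (G : Tensor n k) : Tensor n k :=
  fun i => β * ∏ j, z (i j) + G i

/-- `T⁺ = T + ζ H`. -/
noncomputable def splitPlus {n k : ℕ} (ζ : ℝ) (T H : Tensor n k) : Tensor n k := T + ζ • H

/-- `T⁻ = T - ζ⁻¹ H`. -/
noncomputable def splitMinus {n k : ℕ} (ζ : ℝ) (T H : Tensor n k) : Tensor n k := T - (1 / ζ) • H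

/-- The entry `T_S` of a (symmetric) tensor at a `k`-element set `S = {i₁ < ⋯ < i_k}` of indices.
It is only used for sets of cardinality `k`. -/
noncomputable def entry {n k : ℕ} (T : Tensor n k) (S : Finset (Fin n)) : ℝ :=
  if h : S.card = k then T (S.orderEmbOfFin h) else 0

/-- The `ℓ`-element subsets of `[n]`. -/
abbrev Sub (n ℓ : ℕ) : Type := {V : Finset (Fin n) // V.card = ℓ}

/-- The adjacency matrix of the Kikuchi matching of `S`: the sets `V`, `U` are matched iff
`V ∆ U = S`. -/
def kikuchiMatching (n ℓ : ℕ) (S : Finset (Fin n)) : Matrix (Sub n ℓ) (Sub n ℓ) ℝ :=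
  Matrix.of fun V U => if symmDiff V.1 U.1 = S then 1 else 0

/-- The Kikuchi matrix `𝒦_ℓ(T) = ∑_{|S| = k} T_S 𝒦_ℓ(S)`. -/
noncomputable def kikuchi {n k : ℕ} (ℓ : ℕ) (T : Tensor n k) : Matrix (Sub n ℓ) (Sub n ℓ) ℝ :=
  ∑ S ∈ (Finset.univ : Finset (Fin n)).powersetCard k, entry T S • kikuchiMatching n ℓ S

/-- The degree `d_ℓ = C(n - ℓ, k/2) C(ℓ, k/2)` of the Kikuchi graph. -/
def kikuchiDegree (n k ℓ : ℕ) : ℕ := (n - ℓ).choose (k / 2) * ℓ.choose (k / 2)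

/-- `Part_k(V)`: the partitions of the set `V` into sets of cardinality `k`. -/
def parts {α : Type*} [DecidableEq α] (k : ℕ) (V : Finset α) : Finset (Finset (Finset α)) :=
  {P ∈ (V.powersetCard k).powerset |
    (∀ S ∈ P, ∀ S' ∈ P, S ≠ S' → Disjoint S S') ∧ P.biUnion id = V}

/-- `Part_k(ℓ)`: the number of partitions of an `ℓ`-element set into sets of cardinality `k`. -/
def numParts (k ℓ : ℕ) : ℕ := (parts k (Finset.univ : Finset (Fin ℓ))).card

/-- The guiding vector `Γ^ℓ(T)`, with `V`-coordinate
`(C(n,ℓ) Part_k(ℓ))^{-1/2} ∑_{{S₁,…,S_c} ∈ Part_k(V)} ∏_j T_{S_j}`. -/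
noncomputable def guidingVector {n k : ℕ} (ℓ : ℕ) (T : Tensor n k) :
    EuclideanSpace ℝ (Sub n ℓ) :=
  WithLp.toLp 2 fun V =>
    (1 / Real.sqrt ((n.choose ℓ : ℝ) * (numParts k ℓ : ℝ))) *
      ∑ P ∈ parts k V.1, ∏ S ∈ P, entry T S

/-- The guiding state: the unit vector in the direction of the guiding vector. -/
noncomputable def guidingState {n k : ℕ} (ℓ : ℕ) (T : Tensor n k) :
    EuclideanSpace ℝ (Sub n ℓ) :=
  ‖guidingVector ℓ T‖⁻¹ • guidingVector ℓ T

/-- The span of the eigenspaces of the matrix `K` for the eigenvalues that are at least `θ`. -/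
noncomputable def cutoffEigenspace {ι : Type*} [Fintype ι] [DecidableEq ι]
    (K : Matrix ι ι ℝ) (θ : ℝ) : Submodule ℝ (EuclideanSpace ℝ ι) :=
  ⨆ μ : ℝ, ⨆ _ : θ ≤ μ, Module.End.eigenspace (Matrix.toEuclideanLin K) μ

end TensorPCA

/-!
A rotation of `(G, H)` by the angle `arctan ζ` makes the noise of `T⁺` independent of that of `T⁻`:
up to scaling, their entries over the `k`-sets form two independent standard Gaussian vectors.

The planted vector `u` with coordinates proportional to `∏_{i ∈ V} z i` is an eigenvector of the
Kikuchi matrix of `β z^{⊗k}` for `d_ℓ β`, and the Kikuchi matrix of the noise maps `u` to a vector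
whose squared norm has expectation `O(d_ℓ)`. Above the threshold this is far below `(γ d_ℓ β)²`, so
the component `v` of `u` near the eigenvalue `d_ℓ β` of `𝒦(T⁺)` satisfies `⟨u, v⟩ ≥ 1 / 2`.

By independence `v` may be fixed while `T⁻` varies. The overlap `⟨v, Γ^ℓ(T⁻)⟩` is a polynomial in
the Gaussian noise of `T⁻`, and it is close in mean square to `⟨u, v⟩` times a log-normal variable:
the Gaussian density that shifts the noise in the direction of `z^{⊗k}`. The distance is controlled
because the second moment of the overlap and its mean under the shift are explicit sums over the
Johnson scheme of the `ℓ`-sets. The log-normal variable is rarely small, which bounds the overlap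
from below, and Markov's inequality bounds the norm of `Γ^ℓ(T⁻)` from above.
-/

namespace TensorPCA

/-- The standard Gaussian measure on `ι → ℝ`. -/
noncomputable abbrev gaussPi (ι : Type*) [Fintype ι] : Measure (ι → ℝ) :=
  Measure.pi fun _ : ι => gaussianReal 0 1

section StandardGaussianVector

variable {ι : Type*} [Fintype ι]

theorem map_ofLp_stdGaussian :
    (stdGaussian (EuclideanSpace ℝ ι)).map (EuclideanSpace.equiv ι ℝ) = gaussPi ι := by
  classical
  rw [← map_pi_eq_stdGaussian, Measure.map_map (by fun_prop) (by fun_prop)]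
  exact Measure.map_id

instance isGaussian_gaussPi : IsGaussian (gaussPi ι) :=
  map_ofLp_stdGaussian (ι := ι) ▸ inferInstance

theorem integral_id_gaussPi : ∫ x, x ∂gaussPi ι = 0 := by
  rw [← map_ofLp_stdGaussian, integral_map (by fun_prop) (by fun_prop),
    ContinuousLinearEquiv.integral_comp_comm, integral_id_stdGaussian, map_zero]

theorem charFunDual_gaussianReal_std (L : StrongDual ℝ ℝ) :
    charFunDual (gaussianReal 0 1) L = Complex.exp (-((L 1 ^ 2 : ℝ) : ℂ) / 2) := by
  rw [IsGaussian.charFunDual_eq]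
  simp [integral_complex_ofReal, max_eq_left (sq_nonneg (L 1)), neg_div]

theorem charFunDual_gaussPi [DecidableEq ι] (L : StrongDual ℝ (ι → ℝ)) :
    charFunDual (gaussPi ι) L
      = Complex.exp (-((∑ i, L (Pi.single i 1) ^ 2 : ℝ) : ℂ) / 2) := by
  simp_rw [gaussPi, charFunDual_pi, charFunDual_gaussianReal_std, ← Complex.exp_sum]
  simp [Finset.sum_div, Finset.sum_neg_distrib, neg_div]

theorem sq_dual_apply [DecidableEq ι] (L : StrongDual ℝ (ι → ℝ)) (v : ι → ℝ) :
    L v ^ 2 = ∑ s, ∑ t, L (Pi.single s 1) * L (Pi.single t 1) * (v s * v t) := by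
  have expand : L v = ∑ s, v s * L (Pi.single s 1) := by
    conv_lhs => rw [pi_eq_sum_univ' v]
    simp only [map_sum, map_smul, smul_eq_mul]
  rw [expand, pow_two, Finset.sum_mul_sum]
  exact Finset.sum_congr rfl fun s _ => Finset.sum_congr rfl fun t _ => by ring

theorem gaussPi_map_eq_of_gram_eq {α β ι : Type*} [Fintype α] [Fintype β] [Finite ι]
    [DecidableEq α] [DecidableEq β] {f : (α → ℝ) → ι → ℝ} {g : (β → ℝ) → ι → ℝ}
    (hf : IsLinearMap ℝ f) (hg : IsLinearMap ℝ g)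
    (hgram : ∀ s t, ∑ i, f (Pi.single i 1) s * f (Pi.single i 1) t
      = ∑ i, g (Pi.single i 1) s * g (Pi.single i 1) t) :
    (gaussPi α).map f = (gaussPi β).map g := by
  classical
  have : Fintype ι := Fintype.ofFinite ι
  let F : (α → ℝ) →L[ℝ] ι → ℝ := LinearMap.toContinuousLinearMap (hf.mk' f)
  let G : (β → ℝ) →L[ℝ] ι → ℝ := LinearMap.toContinuousLinearMap (hg.mk' g)
  change (gaussPi α).map F = (gaussPi β).map G
  refine Measure.ext_of_charFunDual (funext fun L => ?_)
  have variance_eq : ∑ i, L (F (Pi.single i 1)) ^ 2 = ∑ i, L (G (Pi.single i 1)) ^ 2 := by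
    simp only [sq_dual_apply]
    rw [Finset.sum_comm, Finset.sum_comm (s := (Finset.univ : Finset β))]
    refine Finset.sum_congr rfl fun s _ => ?_
    rw [Finset.sum_comm, Finset.sum_comm (s := (Finset.univ : Finset β))]
    refine Finset.sum_congr rfl fun t _ => ?_
    rw [← Finset.mul_sum, ← Finset.mul_sum]
    exact congrArg _ (hgram s t)
  simp only [charFunDual_map, charFunDual_gaussPi, ContinuousLinearMap.comp_apply, variance_eq]

end StandardGaussianVector

section EntryLaw

variable {n k : ℕ}

/-- The projection of `ℝ^(2^[n])` onto the coordinates at the sets of cardinality `k`. The entries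
of tensors of different orders thus live in one space, indexed by all subsets of `[n]`. -/
noncomputable def levelProj (k : ℕ) : (Finset (Fin n) → ℝ) →L[ℝ] Finset (Fin n) → ℝ :=
  ContinuousLinearMap.pi fun S => if S.card = k then ContinuousLinearMap.proj S else 0

theorem levelProj_apply (x : Finset (Fin n) → ℝ) (S : Finset (Fin n)) :
    levelProj k x S = if S.card = k then x S else 0 := by
  simp only [levelProj, ContinuousLinearMap.coe_pi']
  split_ifs <;> rfl

theorem isLinearMap_symmetrize : IsLinearMap ℝ (symmetrize : Tensor n k → Tensor n k) where
  map_add A B := by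
    ext i
    simp [symmetrize, Finset.sum_add_distrib, mul_add]
  map_smul r A := by
    ext i
    simp [symmetrize, ← Finset.mul_sum, mul_left_comm]

theorem isLinearMap_entry :
    IsLinearMap ℝ (entry : Tensor n k → Finset (Fin n) → ℝ) where
  map_add A B := by
    ext S
    by_cases h : S.card = k <;> simp [entry, h]
  map_smul r A := by
    ext S
    by_cases h : S.card = k <;> simp [entry, h]

theorem measurable_symmetrize : Measurable (symmetrize : Tensor n k → Tensor n k) :=
  (isLinearMap_symmetrize.mk' _).continuous_of_finiteDimensional.measurable

theorem measurable_entry : Measurable (entry : Tensor n k → Finset (Fin n) → ℝ) :=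
  (isLinearMap_entry.mk' _).continuous_of_finiteDimensional.measurable

theorem orderEmbOfFin_comp_perm_eq_iff {S S' : Finset (Fin n)} (h : S.card = k)
    (h' : S'.card = k) (π π' : Equiv.Perm (Fin k)) :
    S.orderEmbOfFin h ∘ π = S'.orderEmbOfFin h' ∘ π' ↔ S = S' ∧ π = π' := by
  refine ⟨fun heq => ?_, by rintro ⟨rfl, rfl⟩; rfl⟩
  have hrange := congrArg Set.range heq
  simp only [EquivLike.range_comp, Finset.range_orderEmbOfFin, Finset.coe_inj] at hrange
  subst hrange
  exact ⟨rfl, Equiv.ext fun i => (S.orderEmbOfFin h).injective (congrFun heq i)⟩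

theorem entry_symmetrize_single {S : Finset (Fin n)} (h : S.card = k) (i : Fin k → Fin n) :
    entry (symmetrize (Pi.single i 1)) S = 1 / √(k.factorial : ℝ) *
      ∑ π : Equiv.Perm (Fin k), if S.orderEmbOfFin h ∘ π = i then 1 else 0 := by
  simp [entry, h, symmetrize, Pi.single_apply]

theorem sum_entry_symmetrize_single_mul (S S' : Finset (Fin n)) :
    ∑ i : Fin k → Fin n, entry (symmetrize (Pi.single i 1)) S *
        entry (symmetrize (Pi.single i 1)) S'
      = if S.card = k ∧ S = S' then 1 else 0 := by
  by_cases h : S.card = k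
  swap
  · simp [entry, h]
  by_cases h' : S'.card = k
  swap
  · rw [if_neg (by rintro ⟨-, rfl⟩; exact h' h)]
    simp [entry, h']
  have hperm : ∀ π π' : Equiv.Perm (Fin k), (∑ i : Fin k → Fin n,
      (if S.orderEmbOfFin h ∘ π = i then (1 : ℝ) else 0) *
        (if S'.orderEmbOfFin h' ∘ π' = i then 1 else 0)) = if S = S' ∧ π = π' then 1 else 0 := by
    intro π π'
    simp [← orderEmbOfFin_comp_perm_eq_iff h h', eq_comm]
  simp_rw [entry_symmetrize_single h, entry_symmetrize_single h', mul_mul_mul_comm,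
    Finset.sum_mul_sum, one_div_mul_one_div, Real.mul_self_sqrt (Nat.cast_nonneg _)]
  rw [← Finset.mul_sum, Finset.sum_comm]
  simp_rw [Finset.sum_comm (s := (Finset.univ : Finset (Fin k → Fin n))), hperm]
  by_cases hSS' : S = S'
  · simp [hSS', h', Fintype.card_perm, Nat.factorial_ne_zero]
  · simp [hSS']

theorem sum_levelProj_single_mul (S S' : Finset (Fin n)) :
    ∑ U, levelProj k (Pi.single U 1) S * levelProj k (Pi.single U 1) S'
      = if S.card = k ∧ S = S' then 1 else 0 := by
  simp only [levelProj_apply, Pi.single_apply]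
  by_cases h : S.card = k
  · rcases eq_or_ne S S' with rfl | hne
    · simp [h]
    · simp [h, hne]
  · simp [h]

/-- The law of the vector of entries of a symmetrized Gaussian `k`-tensor: independent standard
Gaussians at the sets of cardinality `k`, and `0` elsewhere. -/
noncomputable def entryLaw (n k : ℕ) : Measure (Finset (Fin n) → ℝ) :=
  (gaussPi (Finset (Fin n))).map (levelProj k)

instance isGaussian_entryLaw : IsGaussian (entryLaw n k) :=
  inferInstanceAs (IsGaussian ((gaussPi (Finset (Fin n))).map (levelProj k)))

theorem integral_dual_entryLaw (L : StrongDual ℝ (Finset (Fin n) → ℝ)) :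
    ∫ x, L x ∂entryLaw n k = 0 := by
  rw [entryLaw, integral_map (by fun_prop) (by fun_prop)]
  calc ∫ x, L (levelProj k x) ∂gaussPi _ = L (levelProj k (∫ x, x ∂gaussPi _)) :=
        (L.comp (levelProj k)).integral_comp_comm IsGaussian.integrable_id
    _ = 0 := by rw [integral_id_gaussPi, map_zero, map_zero]

theorem symmGaussianLaw_map_entry : (symmGaussianLaw n k).map entry = entryLaw n k := by
  rw [symmGaussianLaw, Measure.map_map measurable_entry measurable_symmetrize]
  refine gaussPi_map_eq_of_gram_eq
    ((isLinearMap_entry.mk' _).comp (isLinearMap_symmetrize.mk' _)).isLinear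
    (levelProj k).toLinearMap.isLinear fun S S' => ?_
  exact (sum_entry_symmetrize_single_mul S S').trans (sum_levelProj_single_mul S S').symm

theorem hasLaw_rotation_entry {Ω : Type*} [MeasurableSpace Ω] {P : Measure Ω}
    [IsProbabilityMeasure P] {G H : Ω → Tensor n k} (hG : HasLaw G (symmGaussianLaw n k) P)
    (hH : HasLaw H (symmGaussianLaw n k) P) (hGH : IndepFun G H P) (θ : ℝ) :
    HasLaw (fun ω => ContinuousLinearMap.rotation θ (entry (G ω), entry (H ω)))
      ((entryLaw n k).prod (entryLaw n k)) P := by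
  have hentry : HasLaw (entry : Tensor n k → _) (entryLaw n k) (symmGaussianLaw n k) :=
    ⟨measurable_entry.aemeasurable, symmGaussianLaw_map_entry⟩
  have hrot : HasLaw (ContinuousLinearMap.rotation θ)
      ((entryLaw n k).prod (entryLaw n k)) ((entryLaw n k).prod (entryLaw n k)) :=
    ⟨by fun_prop, IsGaussian.map_rotation_eq_self_of_forall_strongDual_eq_zero
      integral_dual_entryLaw θ⟩
  exact hrot.fun_comp ((hGH.comp measurable_entry measurable_entry).hasLaw_prod
    (hentry.comp hG) (hentry.comp hH))

end EntryLaw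

section ScalarGaussianMoments

theorem integrable_id_gaussianReal_std : Integrable (fun x : ℝ => x) (gaussianReal 0 1) :=
  (memLp_id_gaussianReal 1).integrable le_rfl

theorem integrable_sq_gaussianReal_std : Integrable (fun x : ℝ => x ^ 2) (gaussianReal 0 1) :=
  (memLp_id_gaussianReal 2).integrable_sq

theorem integrable_exp_gaussianReal_std (s r : ℝ) :
    Integrable (fun x => Real.exp (s * x - r)) (gaussianReal 0 1) := by
  simp_rw [Real.exp_sub]
  exact (integrable_exp_mul_gaussianReal s).div_const _

theorem mem_interior_integrableExpSet_gaussianReal_std (s : ℝ) :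
    s ∈ interior (integrableExpSet (fun x : ℝ => x) (gaussianReal 0 1)) := by
  simp [integrableExpSet_fun_id_gaussianReal]

theorem integrable_mul_exp_gaussianReal_std (s r : ℝ) :
    Integrable (fun x => x * Real.exp (s * x - r)) (gaussianReal 0 1) := by
  simp_rw [Real.exp_sub, ← mul_div_assoc]
  refine Integrable.div_const ?_ _
  simpa using integrable_pow_mul_exp_of_mem_interior_integrableExpSet
    (mem_interior_integrableExpSet_gaussianReal_std s) 1

theorem integral_sq_gaussianReal_std : ∫ x, x ^ 2 ∂gaussianReal 0 1 = 1 := by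
  have h := variance_fun_id_gaussianReal (μ := 0) (v := 1)
  rw [variance_eq_integral aemeasurable_id'] at h
  simpa using h

theorem integral_exp_gaussianReal_std (s : ℝ) :
    ∫ x, Real.exp (s * x - s ^ 2 / 2) ∂gaussianReal 0 1 = 1 := by
  have hmgf := congrFun (mgf_fun_id_gaussianReal (μ := 0) (v := 1)) s
  simp only [mgf] at hmgf
  simp_rw [Real.exp_sub]
  rw [integral_div, hmgf]
  simp

theorem integral_mul_exp_gaussianReal_std (s : ℝ) :
    ∫ x, x * Real.exp (s * x - s ^ 2 / 2) ∂gaussianReal 0 1 = s := by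
  have hmgf := hasDerivAt_mgf (mem_interior_integrableExpSet_gaussianReal_std s)
  have hexp : HasDerivAt (fun t : ℝ => Real.exp (0 * t + (1 : NNReal) * t ^ 2 / 2))
      (Real.exp (s ^ 2 / 2) * s) s := by
    simpa using ((hasDerivAt_pow 2 s).div_const 2).exp
  rw [mgf_fun_id_gaussianReal] at hmgf
  simp_rw [Real.exp_sub, ← mul_div_assoc]
  rw [integral_div, hmgf.unique hexp, mul_div_cancel_left₀ _ (Real.exp_ne_zero _)]

end ScalarGaussianMoments

section Partitions

variable {α : Type*} [DecidableEq α] {k c : ℕ} {V W S : Finset α} {P B : Finset (Finset α)}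

theorem mem_parts_iff : P ∈ parts k V ↔
    (∀ S ∈ P, S.card = k) ∧ (P : Set (Finset α)).PairwiseDisjoint id ∧ P.biUnion id = V := by
  have hdisj : (P : Set (Finset α)).PairwiseDisjoint id ↔
      ∀ S ∈ P, ∀ S' ∈ P, S ≠ S' → Disjoint S S' := by
    rfl
  rw [hdisj]
  simp only [parts, Finset.mem_filter, Finset.mem_powerset, Finset.subset_iff,
    Finset.mem_powersetCard]
  refine ⟨fun ⟨hP, h⟩ => ⟨fun S hS => (hP hS).2, h⟩, fun ⟨hP, h⟩ => ⟨fun S hS => ⟨?_, hP S hS⟩, h⟩⟩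
  rw [← h.2]
  exact fun x hx => Finset.subset_biUnion_of_mem id hS hx

theorem card_of_mem_parts (hP : P ∈ parts k V) (hS : S ∈ P) : S.card = k :=
  (mem_parts_iff.1 hP).1 S hS

theorem pairwiseDisjoint_of_mem_parts (hP : P ∈ parts k V) :
    (P : Set (Finset α)).PairwiseDisjoint id :=
  (mem_parts_iff.1 hP).2.1

theorem biUnion_of_mem_parts (hP : P ∈ parts k V) : P.biUnion id = V :=
  (mem_parts_iff.1 hP).2.2

theorem subset_of_mem_parts (hP : P ∈ parts k V) (hS : S ∈ P) : S ⊆ V :=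
  biUnion_of_mem_parts hP ▸ Finset.subset_biUnion_of_mem id hS

theorem card_eq_card_mul_of_mem_parts (hP : P ∈ parts k V) : V.card = P.card * k := by
  rw [← biUnion_of_mem_parts hP, Finset.card_biUnion (pairwiseDisjoint_of_mem_parts hP)]
  exact Finset.sum_const_nat fun S hS => card_of_mem_parts hP hS

theorem card_eq_of_mem_parts (hk : 0 < k) (hV : V.card = c * k) (hP : P ∈ parts k V) :
    P.card = c :=
  Nat.eq_of_mul_eq_mul_right hk (hV ▸ card_eq_card_mul_of_mem_parts hP).symm

theorem prod_prod_of_mem_parts {M : Type*} [CommMonoid M] (hP : P ∈ parts k V) (z : α → M) :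
    ∏ S ∈ P, ∏ i ∈ S, z i = ∏ i ∈ V, z i := by
  rw [← biUnion_of_mem_parts hP, Finset.prod_biUnion (pairwiseDisjoint_of_mem_parts hP)]
  rfl

theorem mem_parts_biUnion_of_subset (hP : P ∈ parts k V) (hB : B ⊆ P) :
    B ∈ parts k (B.biUnion id) :=
  mem_parts_iff.2 ⟨fun _ hS => card_of_mem_parts hP (hB hS),
    (pairwiseDisjoint_of_mem_parts hP).subset (by exact_mod_cast hB), rfl⟩

theorem biUnion_subset_of_subset (hP : P ∈ parts k V) (hB : B ⊆ P) : B.biUnion id ⊆ V :=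
  biUnion_of_mem_parts hP ▸ Finset.biUnion_subset_biUnion_of_subset_left id hB

theorem singleton_mem_parts (hS : S.card = k) : {S} ∈ parts k S := by
  simp [mem_parts_iff, hS]

theorem parts_empty (hk : 0 < k) : parts k (∅ : Finset α) = {∅} := by
  ext P
  rw [Finset.mem_singleton]
  constructor
  · refine fun hP => Finset.eq_empty_of_forall_notMem fun S hS => hk.ne ?_
    simpa [Finset.subset_empty.1 (subset_of_mem_parts hP hS)] using card_of_mem_parts hP hS
  · rintro rfl
    simp [mem_parts_iff]

theorem biUnion_id_sdiff (hP : (P : Set (Finset α)).PairwiseDisjoint id) (hB : B ⊆ P) :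
    (P \ B).biUnion id = P.biUnion id \ B.biUnion id := by
  have hdisj : Disjoint ((P \ B).biUnion id) (B.biUnion id) := by
    simp only [Finset.disjoint_biUnion_left, Finset.disjoint_biUnion_right, Finset.mem_sdiff]
    exact fun S' hS' S hS => hP hS.1 (hB hS') (ne_of_mem_of_not_mem hS' hS.2).symm
  have hunion : (P \ B).biUnion id ∪ B.biUnion id = P.biUnion id := by
    rw [← Finset.union_biUnion, Finset.sdiff_union_of_subset hB]
  rw [← hunion, Finset.union_sdiff_cancel_right hdisj]

theorem sdiff_mem_parts (hP : P ∈ parts k V) (hB : B ∈ parts k W) (hBP : B ⊆ P) :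
    P \ B ∈ parts k (V \ W) := by
  refine mem_parts_iff.2 ⟨fun S hS => card_of_mem_parts hP (Finset.sdiff_subset hS),
    (pairwiseDisjoint_of_mem_parts hP).subset (by simp), ?_⟩
  rw [biUnion_id_sdiff (pairwiseDisjoint_of_mem_parts hP) hBP, biUnion_of_mem_parts hP,
    biUnion_of_mem_parts hB]

theorem union_mem_parts (hP : P ∈ parts k V) (hB : B ∈ parts k W) (hVW : Disjoint V W) :
    P ∪ B ∈ parts k (V ∪ W) := by
  refine mem_parts_iff.2 ⟨fun S hS => ?_, ?_, ?_⟩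
  · exact (Finset.mem_union.1 hS).elim (card_of_mem_parts hP) (card_of_mem_parts hB)
  · rw [Finset.coe_union, Set.pairwiseDisjoint_union]
    exact ⟨pairwiseDisjoint_of_mem_parts hP, pairwiseDisjoint_of_mem_parts hB,
      fun S hS S' hS' _ => Finset.disjoint_of_subset_left (subset_of_mem_parts hP hS)
        (Finset.disjoint_of_subset_right (subset_of_mem_parts hB hS') hVW)⟩
  · rw [Finset.union_biUnion, biUnion_of_mem_parts hP, biUnion_of_mem_parts hB]

theorem disjoint_of_mem_parts (hk : 0 < k) (hP : P ∈ parts k V) (hB : B ∈ parts k W)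
    (hVW : Disjoint V W) : Disjoint P B := by
  refine Finset.disjoint_left.2 fun S hSP hSB => hk.ne ?_
  have hempty : S = ∅ := Finset.disjoint_self_iff_empty S |>.1 <|
    Finset.disjoint_of_subset_left (subset_of_mem_parts hP hSP)
      (Finset.disjoint_of_subset_right (subset_of_mem_parts hB hSB) hVW)
  simpa [hempty] using card_of_mem_parts hP hSP

theorem card_parts_filter_superset (hk : 0 < k) (hB : B ∈ parts k W) (hW : W ⊆ V) :
    ((parts k V).filter (B ⊆ ·)).card = (parts k (V \ W)).card := by
  refine Finset.card_bij' (fun P _ => P \ B) (fun Q _ => Q ∪ B)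
    (fun P hP => ?_) (fun Q hQ => ?_) (fun P hP => ?_) (fun Q hQ => ?_)
  · exact sdiff_mem_parts (Finset.mem_filter.1 hP).1 hB (Finset.mem_filter.1 hP).2
  · refine Finset.mem_filter.2 ⟨?_, Finset.subset_union_right⟩
    simpa only [Finset.sdiff_union_of_subset hW] using
      union_mem_parts hQ hB Finset.sdiff_disjoint
  · exact Finset.sdiff_union_of_subset (Finset.mem_filter.1 hP).2
  · exact Finset.union_sdiff_cancel_right (disjoint_of_mem_parts hk hQ hB Finset.sdiff_disjoint)

theorem sum_card_parts_filter_mem (hk : 0 < k) (hV : V.card = c * k) :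
    ∑ S ∈ V.powersetCard k, ((parts k V).filter (S ∈ ·)).card = (parts k V).card * c := by
  have hcount : ∀ P ∈ parts k V, ((V.powersetCard k).filter (· ∈ P)).card = c := by
    intro P hP
    rw [← card_eq_of_mem_parts hk hV hP]
    congr 1
    ext S
    simp only [Finset.mem_filter, and_iff_right_iff_imp, Finset.mem_powersetCard]
    exact fun hS => ⟨subset_of_mem_parts hP hS, card_of_mem_parts hP hS⟩
  rw [← Finset.sum_const_nat hcount]
  exact Finset.sum_card_bipartiteAbove_eq_sum_card_bipartiteBelow
    fun (S : Finset α) (P : Finset (Finset α)) => S ∈ P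

theorem card_parts_mul (hk : 0 < k) (hV : V.card = c * k) :
    (parts k V).card * (k.factorial ^ c * c.factorial) = (c * k).factorial := by
  induction c generalizing V with
  | zero =>
    obtain rfl : V = ∅ := Finset.card_eq_zero.1 (by simpa using hV)
    simp [parts_empty hk]
  | succ c ih =>
    have hfiber : ∀ S ∈ V.powersetCard k,
        ((parts k V).filter (S ∈ ·)).card * (k.factorial ^ c * c.factorial)
          = (c * k).factorial := by
      intro S hS
      obtain ⟨hSV, hSc⟩ := Finset.mem_powersetCard.1 hS
      simp_rw [← Finset.singleton_subset_iff (a := S)]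
      rw [card_parts_filter_superset hk (singleton_mem_parts hSc) hSV]
      apply ih
      rw [Finset.card_sdiff_of_subset hSV, hV, hSc, Nat.succ_mul, Nat.add_sub_cancel]
    have hsum : (parts k V).card * (c + 1) * (k.factorial ^ c * c.factorial)
        = ((c + 1) * k).choose k * (c * k).factorial := by
      rw [← sum_card_parts_filter_mem hk hV, Finset.sum_mul, Finset.sum_congr rfl hfiber,
        Finset.sum_const, Finset.card_powersetCard, hV, smul_eq_mul]
    have hchoose := Nat.choose_mul_factorial_mul_factorial (n := (c + 1) * k) (k := k)
      (Nat.le_mul_of_pos_left _ (Nat.succ_pos c))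
    rw [Nat.succ_mul, Nat.add_sub_cancel, ← Nat.succ_mul] at hchoose
    rw [← hchoose, pow_succ, Nat.factorial_succ]
    linear_combination k.factorial * hsum

theorem card_parts_eq_numParts (hk : 0 < k) (hV : V.card = c * k) :
    (parts k V).card = numParts k (c * k) := by
  have h := card_parts_mul hk (c := c) (V := (Finset.univ : Finset (Fin (c * k)))) (by simp)
  exact Nat.eq_of_mul_eq_mul_right (by positivity) ((card_parts_mul hk hV).trans h.symm)

theorem numParts_eq_div (hk : 0 < k) (c : ℕ) :
    (numParts k (c * k) : ℝ) = (c * k).factorial / (k.factorial ^ c * c.factorial) := by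
  rw [eq_div_iff (by positivity)]
  exact_mod_cast card_parts_mul hk (V := (Finset.univ : Finset (Fin (c * k)))) (by simp)

theorem numParts_pos (hk : 0 < k) (c : ℕ) : (0 : ℝ) < numParts k (c * k) := by
  rw [numParts_eq_div hk]
  positivity

theorem choose_mul_numParts_mul_numParts (hk : 0 < k) {j : ℕ} (hj : j ≤ c) :
    ((c * k).choose (j * k) : ℝ) * numParts k (j * k) * numParts k ((c - j) * k)
      = c.choose j * numParts k (c * k) := by
  have hpow : (k.factorial : ℝ) ^ c = (k.factorial : ℝ) ^ j * (k.factorial : ℝ) ^ (c - j) := by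
    rw [← pow_add, Nat.add_sub_cancel' hj]
  have hfact := fun m : ℕ => (Nat.cast_ne_zero (R := ℝ)).2 (Nat.factorial_ne_zero m)
  simp only [numParts_eq_div hk, Nat.cast_choose ℝ (Nat.mul_le_mul_right k hj),
    Nat.cast_choose ℝ hj, ← Nat.sub_mul, hpow]
  field_simp [hfact]

end Partitions

section JohnsonScheme

variable {α : Type*} [Fintype α] [DecidableEq α]

/-- The `m`-element subsets of a finite type. -/
abbrev level (α : Type*) [Fintype α] (m : ℕ) : Finset (Finset α) :=
  (Finset.univ : Finset α).powersetCard m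

/-- The down operator of the Boolean lattice: the sum of `f` over the sets that cover `W`. -/
def levelDown (f : Finset α → ℝ) (W : Finset α) : ℝ := ∑ x ∈ Wᶜ, f (insert x W)

/-- The up operator of the Boolean lattice: the sum of `f` over the sets that `V` covers. It is
adjoint to `levelDown`. -/
def levelUp {α : Type*} [DecidableEq α] (f : Finset α → ℝ) (V : Finset α) : ℝ :=
  ∑ x ∈ V, f (V.erase x)

theorem sum_levelUp_mul (m : ℕ) (g h : Finset α → ℝ) :
    ∑ V ∈ level α (m + 1), g V * levelUp h V = ∑ W ∈ level α m, levelDown g W * h W := by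
  simp_rw [levelUp, levelDown, Finset.mul_sum, Finset.sum_mul]
  rw [Finset.sum_sigma', Finset.sum_sigma']
  refine Finset.sum_bij' (fun p _ => ⟨p.1.erase p.2, p.2⟩) (fun p _ => ⟨insert p.2 p.1, p.2⟩)
    ?_ ?_ ?_ ?_ ?_ <;> rintro ⟨V, x⟩ hp <;>
    simp only [Finset.mem_sigma, Finset.mem_powersetCard_univ, Finset.mem_compl] at hp ⊢
  · simp [Finset.card_erase_of_mem hp.2, hp.1]
  · simp [Finset.card_insert_of_notMem hp.2, hp.1]
  · rw [Finset.insert_erase hp.2]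
  · rw [Finset.erase_insert hp.2]
  · rw [Finset.insert_erase hp.2]

theorem levelDown_levelUp_eq_card_mul_add (h : Finset α → ℝ) (W : Finset α) :
    levelDown (levelUp h) W
      = (Wᶜ.card : ℝ) * h W + ∑ x ∈ Wᶜ, ∑ y ∈ W, h (insert x (W.erase y)) := by
  have hinsert : ∀ x ∈ Wᶜ, levelUp h (insert x W) = h W + ∑ y ∈ W, h (insert x (W.erase y)) := by
    intro x hx
    rw [Finset.mem_compl] at hx
    rw [levelUp, Finset.sum_insert hx, Finset.erase_insert hx]
    congr 1
    refine Finset.sum_congr rfl fun y hy => ?_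
    rw [Finset.erase_insert_of_ne (ne_of_mem_of_not_mem hy hx).symm]
  rw [levelDown, Finset.sum_congr rfl hinsert, Finset.sum_add_distrib, Finset.sum_const,
    nsmul_eq_mul]

theorem levelUp_levelDown_eq_card_mul_add (h : Finset α → ℝ) (W : Finset α) :
    levelUp (levelDown h) W
      = (W.card : ℝ) * h W + ∑ x ∈ Wᶜ, ∑ y ∈ W, h (insert x (W.erase y)) := by
  have herase : ∀ y ∈ W, levelDown h (W.erase y) = h W + ∑ x ∈ Wᶜ, h (insert x (W.erase y)) := by
    intro y hy
    rw [levelDown, Finset.compl_erase, Finset.sum_insert (by simpa using hy),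
      Finset.insert_erase hy]
  rw [levelUp, Finset.sum_congr rfl herase, Finset.sum_add_distrib, Finset.sum_const,
    nsmul_eq_mul, Finset.sum_comm]

theorem levelDown_levelUp (h : Finset α → ℝ) (W : Finset α) :
    levelDown (levelUp h) W
      = levelUp (levelDown h) W + ((Fintype.card α : ℝ) - 2 * W.card) * h W := by
  have hcompl : (Wᶜ.card : ℝ) = Fintype.card α - W.card := by
    rw [Finset.card_compl, Nat.cast_sub (Finset.card_le_univ W)]
  rw [levelDown_levelUp_eq_card_mul_add, levelUp_levelDown_eq_card_mul_add, hcompl]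
  ring

theorem sum_levelDown (m : ℕ) (g : Finset α → ℝ) :
    ∑ W ∈ level α m, levelDown g W = (m + 1) * ∑ V ∈ level α (m + 1), g V := by
  have hadj := sum_levelUp_mul m g (fun _ => 1)
  simp only [mul_one] at hadj
  rw [← hadj, Finset.mul_sum]
  refine Finset.sum_congr rfl fun V hV => ?_
  simp [levelUp, Finset.mem_powersetCard_univ.1 hV, mul_comm]

theorem sum_levelDown_sq (m : ℕ) (g : Finset α → ℝ) :
    ∑ W ∈ level α m, levelDown g W ^ 2
      = ∑ V ∈ level α (m + 1), g V * levelUp (levelDown g) V := by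
  rw [sum_levelUp_mul]
  exact Finset.sum_congr rfl fun W _ => pow_two _

theorem sum_levelUp_sq (m : ℕ) (h : Finset α → ℝ) :
    ∑ V ∈ level α (m + 2), levelUp h V ^ 2
      = ∑ W ∈ level α m, levelDown h W ^ 2
        + ((Fintype.card α : ℝ) - 2 * (m + 1)) * ∑ W ∈ level α (m + 1), h W ^ 2 := by
  simp_rw [pow_two (levelUp h _)]
  rw [sum_levelUp_mul, sum_levelDown_sq, Finset.mul_sum, ← Finset.sum_add_distrib]
  refine Finset.sum_congr rfl fun W hW => ?_
  rw [levelDown_levelUp, Finset.mem_powersetCard_univ.1 hW]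
  push_cast
  ring

theorem sum_levelDown_sq_le (m : ℕ) (hm : m + 1 ≤ Fintype.card α) (g : Finset α → ℝ)
    (hg : ∑ V ∈ level α (m + 1), g V = 0) :
    ∑ W ∈ level α m, levelDown g W ^ 2
      ≤ (m * ((Fintype.card α : ℝ) - m - 1)) * ∑ V ∈ level α (m + 1), g V ^ 2 := by
  induction m generalizing g with
  | zero =>
    have hsum := sum_levelDown 0 g
    rw [hg, mul_zero] at hsum
    simp only [level, Finset.powersetCard_zero, Finset.sum_singleton] at hsum ⊢
    simp [hsum]
  | succ m ih =>
    set h := levelDown g with hdef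
    have hdown := ih (by omega) h (by rw [hdef, sum_levelDown, hg, mul_zero])
    have cauchy_schwarz := Finset.sum_mul_sq_le_sq_mul_sq (level α (m + 2)) g (levelUp h)
    rw [← sum_levelDown_sq, sum_levelUp_sq, ← hdef] at cauchy_schwarz
    have ha : 0 ≤ ∑ W ∈ level α (m + 1), h W ^ 2 := Finset.sum_nonneg fun _ _ => sq_nonneg _
    have hb : 0 ≤ ∑ V ∈ level α (m + 2), g V ^ 2 := Finset.sum_nonneg fun _ _ => sq_nonneg _
    set a := ∑ W ∈ level α (m + 1), h W ^ 2
    set b := ∑ V ∈ level α (m + 2), g V ^ 2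
    have hm' : ((m + 2 : ℕ) : ℝ) ≤ Fintype.card α := by exact_mod_cast hm
    push_cast at hm' ⊢
    rcases ha.eq_or_lt with h0 | hpos
    · rw [← h0]
      exact mul_nonneg (mul_nonneg (by positivity) (by linarith)) hb
    · refine le_of_mul_le_mul_right ?_ hpos
      calc a * a = a ^ 2 := (pow_two a).symm
        _ ≤ b * (((m + 1) * ((Fintype.card α : ℝ) - (m + 1) - 1)) * a) :=
            cauchy_schwarz.trans (mul_le_mul_of_nonneg_left (by linarith) hb)
        _ = _ := by ring

/-- The sum of `f` over the `ℓ`-element supersets of `W`. -/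
def supersetSum (ℓ : ℕ) (f : Finset α → ℝ) (W : Finset α) : ℝ :=
  ∑ V ∈ (level α ℓ).filter (W ⊆ ·), f V

theorem supersetSum_of_card_eq {W : Finset α} (f : Finset α → ℝ) :
    supersetSum W.card f W = f W := by
  have hfilter : (level α W.card).filter (W ⊆ ·) = {W} := by
    ext V
    simp only [Finset.mem_filter, Finset.mem_powersetCard_univ, Finset.mem_singleton]
    refine ⟨fun ⟨hcard, hsub⟩ => (Finset.eq_of_subset_of_card_le hsub hcard.le).symm, ?_⟩
    rintro rfl
    exact ⟨rfl, subset_rfl⟩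
  rw [supersetSum, hfilter, Finset.sum_singleton]

theorem levelDown_supersetSum (ℓ : ℕ) (f : Finset α → ℝ) (W : Finset α) :
    levelDown (supersetSum ℓ f) W = ((ℓ : ℝ) - W.card) * supersetSum ℓ f W := by
  simp_rw [levelDown, supersetSum, Finset.sum_filter]
  rw [Finset.sum_comm, Finset.mul_sum]
  refine Finset.sum_congr rfl fun V hV => ?_
  rw [← Finset.mem_powersetCard_univ.1 hV]
  by_cases hWV : W ⊆ V
  · have hfilter : Wᶜ.filter (fun x => insert x W ⊆ V) = V \ W := by
      ext x
      simp [Finset.insert_subset_iff, hWV, and_comm]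
    rw [if_pos hWV, ← Finset.sum_filter, Finset.sum_const, nsmul_eq_mul, hfilter,
      Finset.card_sdiff_of_subset hWV, Nat.cast_sub (Finset.card_le_card hWV)]
  · rw [if_neg hWV, mul_zero]
    exact Finset.sum_eq_zero fun x _ => if_neg fun h => hWV ((Finset.subset_insert x W).trans h)

theorem card_filter_subset_level {W : Finset α} {ℓ : ℕ} (hℓ : W.card ≤ ℓ) :
    ((level α ℓ).filter (W ⊆ ·)).card = (Fintype.card α - W.card).choose (ℓ - W.card) := by
  rw [← Finset.card_compl, ← Finset.card_powersetCard]
  refine Finset.card_bij' (fun V _ => V \ W) (fun U _ => U ∪ W)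
    (fun V hV => ?_) (fun U hU => ?_) (fun V hV => ?_) (fun U hU => ?_)
  · simp only [Finset.mem_filter, Finset.mem_powersetCard] at hV ⊢
    rw [Finset.card_sdiff_of_subset hV.2, hV.1.2]
    exact ⟨fun x hx => by simpa using (Finset.mem_sdiff.1 hx).2, rfl⟩
  · simp only [Finset.mem_filter, Finset.mem_powersetCard] at hU ⊢
    have hdisj : Disjoint U W := Finset.subset_compl_iff_disjoint_right.1 hU.1
    rw [Finset.card_union_of_disjoint hdisj, hU.2, Nat.sub_add_cancel hℓ]
    exact ⟨⟨Finset.subset_univ _, rfl⟩, Finset.subset_union_right⟩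
  · exact Finset.sdiff_union_of_subset (Finset.mem_filter.1 hV).2
  · exact Finset.union_sdiff_cancel_right
      (Finset.subset_compl_iff_disjoint_right.1 (Finset.mem_powersetCard.1 hU).1)

theorem sum_supersetSum (ℓ m : ℕ) (f : Finset α → ℝ) :
    ∑ W ∈ level α m, supersetSum ℓ f W = ℓ.choose m * ∑ V ∈ level α ℓ, f V := by
  simp_rw [supersetSum, Finset.sum_filter]
  rw [Finset.sum_comm, Finset.mul_sum]
  refine Finset.sum_congr rfl fun V hV => ?_
  have hfilter : (level α m).filter (· ⊆ V) = V.powersetCard m := by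
    ext W
    simp [Finset.mem_powersetCard, and_comm]
  rw [← Finset.sum_filter, Finset.sum_const, nsmul_eq_mul, hfilter, Finset.card_powersetCard,
    Finset.mem_powersetCard_univ.1 hV]

theorem supersetSum_add_const {W : Finset α} {ℓ : ℕ} (hℓ : W.card ≤ ℓ) (f : Finset α → ℝ)
    (r : ℝ) : supersetSum ℓ (fun V => f V + r) W
      = supersetSum ℓ f W + (Fintype.card α - W.card).choose (ℓ - W.card) * r := by
  rw [supersetSum, Finset.sum_add_distrib, Finset.sum_const, nsmul_eq_mul,
    card_filter_subset_level hℓ, supersetSum]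

theorem sum_add_const_sq {ι : Type*} (s : Finset ι) {f : ι → ℝ} (r : ℝ)
    (hf : ∑ i ∈ s, f i = 0) : ∑ i ∈ s, (f i + r) ^ 2 = ∑ i ∈ s, f i ^ 2 + s.card * r ^ 2 := by
  simp only [add_sq, Finset.sum_add_distrib, ← Finset.sum_mul, ← Finset.mul_sum, hf,
    Finset.sum_const, nsmul_eq_mul]
  ring

theorem cast_choose_mul_choose {n ℓ m : ℕ} (hm : m ≤ ℓ) :
    (n.choose m : ℝ) * (n - m).choose (ℓ - m) = n.choose ℓ * ℓ.choose m := by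
  exact_mod_cast (Nat.choose_mul hm).symm

theorem sub_mul_choose_sub {n ℓ m : ℕ} (hm : m < ℓ) (hℓ : ℓ ≤ n) :
    ((ℓ : ℝ) - m) * (n - m).choose (ℓ - m)
      = ((n : ℝ) - m) * (n - (m + 1)).choose (ℓ - (m + 1)) := by
  have hrec := Nat.add_one_mul_choose_eq (n - (m + 1)) (ℓ - (m + 1))
  rw [show n - (m + 1) + 1 = n - m by omega, show ℓ - (m + 1) + 1 = ℓ - m by omega] at hrec
  rw [← Nat.cast_sub hm.le, ← Nat.cast_sub (hm.le.trans hℓ)]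
  exact_mod_cast (by rw [hrec, mul_comm])

theorem sub_mul_choose {ℓ m : ℕ} (hm : m ≤ ℓ) :
    ((ℓ : ℝ) - m) * ℓ.choose m = ((m : ℝ) + 1) * ℓ.choose (m + 1) := by
  rw [← Nat.cast_sub hm]
  exact_mod_cast (by rw [mul_comm, ← Nat.choose_succ_right_eq, mul_comm])

theorem sub_sq_mul_sum_supersetSum_sq_le (ℓ m : ℕ) (hm : m + 1 ≤ Fintype.card α)
    (f : Finset α → ℝ) (hf : ∑ V ∈ level α ℓ, f V = 0) :
    ((ℓ : ℝ) - m) ^ 2 * ∑ W ∈ level α m, supersetSum ℓ f W ^ 2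
      ≤ (m * ((Fintype.card α : ℝ) - m - 1)) *
        ∑ W ∈ level α (m + 1), supersetSum ℓ f W ^ 2 := by
  refine le_of_eq_of_le ?_ (sum_levelDown_sq_le m hm (supersetSum ℓ f)
    (by rw [sum_supersetSum, hf, mul_zero]))
  rw [Finset.mul_sum]
  refine Finset.sum_congr rfl fun W hW => ?_
  rw [levelDown_supersetSum, Finset.mem_powersetCard_univ.1 hW, mul_pow]

theorem sum_supersetSum_sq_le_of_sum_eq_zero {ℓ m : ℕ} (hm : m ≤ ℓ) (hℓ : ℓ ≤ Fintype.card α)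
    (f : Finset α → ℝ) (hf : ∑ V ∈ level α ℓ, f V = 0) :
    (ℓ : ℝ) * ∑ W ∈ level α m, supersetSum ℓ f W ^ 2
      ≤ m * ((Fintype.card α - m).choose (ℓ - m) * ℓ.choose m) *
        ∑ V ∈ level α ℓ, f V ^ 2 := by
  induction hm using Nat.decreasingInduction with
  | self =>
    refine le_of_eq ?_
    simp only [Nat.sub_self, Nat.choose_zero_right, Nat.choose_self, Nat.cast_one, mul_one]
    congr 1
    refine Finset.sum_congr rfl fun W hW => ?_
    rw [← Finset.mem_powersetCard_univ.1 hW, supersetSum_of_card_eq]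
  | of_succ m hm ih =>
    have hstep := sub_sq_mul_sum_supersetSum_sq_le ℓ m (by omega) f hf
    have hsub := sub_mul_choose_sub hm hℓ
    have hchoose := sub_mul_choose hm.le
    have hmℓ : (0 : ℝ) < (ℓ : ℝ) - m := sub_pos.2 (Nat.cast_lt.2 hm)
    have hmn : (0 : ℝ) ≤ (Fintype.card α : ℝ) - m - 1 := by
      rw [sub_sub, sub_nonneg]
      exact_mod_cast hm.trans_le hℓ
    have hF : 0 ≤ ∑ V ∈ level α ℓ, f V ^ 2 := Finset.sum_nonneg fun _ _ => sq_nonneg _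
    set n := Fintype.card α
    set X := ∑ W ∈ level α m, supersetSum ℓ f W ^ 2
    set X' := ∑ W ∈ level α (m + 1), supersetSum ℓ f W ^ 2
    set F := ∑ V ∈ level α ℓ, f V ^ 2
    push_cast at ih
    refine le_of_mul_le_mul_left ?_ (pow_pos hmℓ 2)
    calc ((ℓ : ℝ) - m) ^ 2 * (ℓ * X) = ℓ * (((ℓ : ℝ) - m) ^ 2 * X) := by ring
      _ ≤ ℓ * (m * ((n : ℝ) - m - 1) * X') := by gcongr
      _ = m * ((n : ℝ) - m - 1) * (ℓ * X') := by ring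
      _ ≤ m * ((n : ℝ) - m - 1) *
          ((m + 1) * ((n - (m + 1)).choose (ℓ - (m + 1)) * ℓ.choose (m + 1)) * F) := by gcongr
      _ ≤ m * ((n : ℝ) - m) *
          ((m + 1) * ((n - (m + 1)).choose (ℓ - (m + 1)) * ℓ.choose (m + 1)) * F) := by
          gcongr m * ?_ * _
          exact sub_le_self _ zero_le_one
      _ = m * (((n : ℝ) - m) * (n - (m + 1)).choose (ℓ - (m + 1))) *
          (((m : ℝ) + 1) * ℓ.choose (m + 1)) * F := by ring
      _ = _ := by rw [← hsub, ← hchoose]; ring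

theorem sum_supersetSum_add_const_sq {ℓ m : ℕ} (hm : m ≤ ℓ) {g : Finset α → ℝ} (r : ℝ)
    (hg : ∑ V ∈ level α ℓ, g V = 0) :
    ∑ W ∈ level α m, supersetSum ℓ (fun V => g V + r) W ^ 2
      = ∑ W ∈ level α m, supersetSum ℓ g W ^ 2
        + (Fintype.card α - m).choose (ℓ - m) * ℓ.choose m
          * ((Fintype.card α).choose ℓ * r ^ 2) := by
  have hshift : ∀ W ∈ level α m, supersetSum ℓ (fun V => g V + r) W ^ 2
      = (supersetSum ℓ g W + (Fintype.card α - m).choose (ℓ - m) * r) ^ 2 := by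
    intro W hW
    rw [Finset.mem_powersetCard_univ] at hW
    rw [supersetSum_add_const (hW.trans_le hm), hW]
  have hcount := cast_choose_mul_choose (n := Fintype.card α) hm
  rw [Finset.sum_congr rfl hshift,
    sum_add_const_sq _ _ (by rw [sum_supersetSum, hg, mul_zero]), Finset.card_powersetCard,
    Finset.card_univ]
  linear_combination ((Fintype.card α - m).choose (ℓ - m) : ℝ) * r ^ 2 * hcount

theorem sum_supersetSum_sq_le {ℓ m : ℕ} (hm : m ≤ ℓ) (hℓ : ℓ ≤ Fintype.card α) (h0 : 0 < ℓ)
    (f : Finset α → ℝ) :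
    ∑ W ∈ level α m, supersetSum ℓ f W ^ 2
      ≤ ((Fintype.card α - m).choose (ℓ - m) * ℓ.choose m) *
        ((∑ V ∈ level α ℓ, f V) ^ 2 / (Fintype.card α).choose ℓ
          + m / ℓ * ∑ V ∈ level α ℓ, f V ^ 2) := by
  set B : ℝ := (Fintype.card α - m).choose (ℓ - m) * ℓ.choose m
  set N : ℝ := (((Fintype.card α).choose ℓ : ℕ) : ℝ)
  have hN : 0 < N := Nat.cast_pos.2 (Nat.choose_pos hℓ)
  have hl : (0 : ℝ) < ℓ := by exact_mod_cast h0
  have hcard : ((level α ℓ).card : ℝ) = N := by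
    rw [Finset.card_powersetCard, Finset.card_univ]
  set mean := (∑ V ∈ level α ℓ, f V) / N with hmean
  -- On constants the inequality is an equality; mean-zero functions are contracted by `m / ℓ`.
  set g : Finset α → ℝ := fun V => f V - mean with hg
  have sum_g : ∑ V ∈ level α ℓ, g V = 0 := by
    rw [hg, Finset.sum_sub_distrib, Finset.sum_const, nsmul_eq_mul, hcard, hmean]
    field_simp
    ring
  have sum_g_sq : ∑ V ∈ level α ℓ, g V ^ 2 ≤ ∑ V ∈ level α ℓ, f V ^ 2 := by
    have h := sum_add_const_sq (level α ℓ) mean sum_g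
    simp only [hg, sub_add_cancel] at h
    rw [h]
    exact le_add_of_nonneg_right (by positivity)
  have hsplit := sum_supersetSum_add_const_sq hm mean sum_g
  simp only [hg, sub_add_cancel] at hsplit
  rw [hsplit]
  calc _ ≤ m * B * (∑ V ∈ level α ℓ, g V ^ 2) / ℓ + B * (N * mean ^ 2) := by
        gcongr
        rw [le_div_iff₀ hl, mul_comm]
        exact sum_supersetSum_sq_le_of_sum_eq_zero hm hℓ g sum_g
    _ ≤ m * B * (∑ V ∈ level α ℓ, f V ^ 2) / ℓ + B * (N * mean ^ 2) := by gcongr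
    _ = _ := by
        rw [hmean]
        field_simp
        ring

end JohnsonScheme

section SpectralCutoff

variable {ι : Type*} [Fintype ι] [DecidableEq ι] {K : Matrix ι ι ℝ}

theorem toEuclideanLin_cfc_eigenvectorBasis (hK : K.IsHermitian) (f : ℝ → ℝ) (i : ι) :
    Matrix.toEuclideanLin (cfc f K) (hK.eigenvectorBasis i)
      = f (hK.eigenvalues i) • hK.eigenvectorBasis i := by
  rw [hK.cfc_eq, Matrix.IsHermitian.cfc, Unitary.conjStarAlgAut_apply, Matrix.toLpLin_apply,
    ← Matrix.mulVec_mulVec, hK.star_eigenvectorUnitary_mulVec, ← Matrix.mulVec_mulVec,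
    Matrix.diagonal_mulVec_single, ← smul_eq_mul, Pi.single_smul (f := fun _ => ℝ),
    Matrix.mulVec_smul, hK.eigenvectorUnitary_mulVec]
  rfl

theorem inner_eigenvectorBasis_toEuclideanLin_cfc (hK : K.IsHermitian) (f : ℝ → ℝ)
    (u : EuclideanSpace ℝ ι) (i : ι) :
    inner ℝ (hK.eigenvectorBasis i) (Matrix.toEuclideanLin (cfc f K) u)
      = f (hK.eigenvalues i) * inner ℝ (hK.eigenvectorBasis i) u := by
  have hsymm := Matrix.isSymmetric_toEuclideanLin_iff.2
    (cfc_predicate f K : IsSelfAdjoint (cfc f K)).isHermitian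
  rw [← hsymm, toEuclideanLin_cfc_eigenvectorBasis, real_inner_smul_left]

/-- A continuous cutoff of the real line to the window `[a - b, a + b]`. Its continuity makes the
spectral truncation of a matrix depend measurably on the matrix. -/
noncomputable def windowCutoff (a b t : ℝ) : ℝ := max 0 (1 - ((t - a) / b) ^ 2)

theorem continuous_windowCutoff (a b : ℝ) : Continuous (windowCutoff a b) := by
  unfold windowCutoff
  fun_prop

theorem windowCutoff_nonneg (a b t : ℝ) : 0 ≤ windowCutoff a b t := le_max_left _ _

theorem windowCutoff_le_one (a b t : ℝ) : windowCutoff a b t ≤ 1 :=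
  max_le zero_le_one (sub_le_self _ (sq_nonneg _))

theorem one_sub_sq_le_windowCutoff (a b t : ℝ) : 1 - ((t - a) / b) ^ 2 ≤ windowCutoff a b t :=
  le_max_right _ _

theorem sub_le_of_windowCutoff_ne_zero {a b t : ℝ} (hb : 0 < b) (h : windowCutoff a b t ≠ 0) :
    a - b ≤ t := by
  contrapose! h
  refine max_eq_left (sub_nonpos.2 ?_)
  rw [one_le_sq_iff_one_le_abs, abs_div, abs_of_pos hb, one_le_div hb]
  exact le_abs.2 (Or.inr (by linarith))

/-- The component of `u` in the eigenspaces of `K` for eigenvalues in the window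
`[a - b, a + b]`, damped towards the ends of the window. -/
noncomputable def windowVec (K : Matrix ι ι ℝ) (a b : ℝ) (u : EuclideanSpace ℝ ι) :
    EuclideanSpace ℝ ι :=
  Matrix.toEuclideanLin (cfc (windowCutoff a b) K) u

open scoped Matrix.Norms.L2Operator in
theorem continuous_windowVec {X : Type*} [TopologicalSpace X] {F : X → Matrix ι ι ℝ}
    (hF : Continuous F) (hH : ∀ x, (F x).IsHermitian) (a b : ℝ) (u : EuclideanSpace ℝ ι) :
    Continuous fun x => windowVec (F x) a b u := by
  have hcfc : Continuous fun x => cfc (windowCutoff a b) (F x) :=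
    Continuous.cfc_of_mem_nhdsSet _ Filter.univ_mem hF hH (continuous_windowCutoff a b).continuousOn
  exact (PiLp.continuous_toLp 2 _).comp (hcfc.matrix_mulVec continuous_const)

theorem windowVec_mem_cutoffEigenspace (hK : K.IsHermitian) (a : ℝ) {b : ℝ} (hb : 0 < b)
    (u : EuclideanSpace ℝ ι) : windowVec K a b u ∈ cutoffEigenspace K (a - b) := by
  rw [← hK.eigenvectorBasis.sum_repr' (windowVec K a b u)]
  refine Submodule.sum_mem _ fun i _ => ?_
  rw [windowVec, inner_eigenvectorBasis_toEuclideanLin_cfc]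
  obtain h0 | h0 := eq_or_ne (windowCutoff a b (hK.eigenvalues i)) 0
  · rw [h0, zero_mul, zero_smul]
    exact Submodule.zero_mem _
  · have hi : Matrix.toEuclideanLin K (hK.eigenvectorBasis i)
        = hK.eigenvalues i • hK.eigenvectorBasis i :=
      congrArg (WithLp.toLp 2) (hK.mulVec_eigenvectorBasis i)
    exact Submodule.smul_mem _ _ (Submodule.mem_iSup_of_mem (hK.eigenvalues i)
      (Submodule.mem_iSup_of_mem (sub_le_of_windowCutoff_ne_zero hb h0)
        (Module.End.mem_eigenspace_iff.2 hi)))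

theorem norm_windowVec_le (hK : K.IsHermitian) (a b : ℝ) (u : EuclideanSpace ℝ ι) :
    ‖windowVec K a b u‖ ≤ ‖u‖ := by
  refine le_of_sq_le_sq ?_ (norm_nonneg _)
  rw [← hK.eigenvectorBasis.sum_sq_inner_right, ← hK.eigenvectorBasis.sum_sq_inner_right u]
  refine Finset.sum_le_sum fun i _ => ?_
  rw [windowVec, inner_eigenvectorBasis_toEuclideanLin_cfc, mul_pow]
  exact mul_le_of_le_one_left (sq_nonneg _)
    (pow_le_one₀ (windowCutoff_nonneg a b _) (windowCutoff_le_one a b _))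

theorem norm_sq_sub_le_inner_windowVec (hK : K.IsHermitian) (a b : ℝ) (u : EuclideanSpace ℝ ι) :
    ‖u‖ ^ 2 - ‖Matrix.toEuclideanLin K u - a • u‖ ^ 2 / b ^ 2 ≤ inner ℝ u (windowVec K a b u) := by
  set e := hK.eigenvectorBasis
  have inner_residual (i : ι) : inner ℝ (e i) (Matrix.toEuclideanLin K u - a • u)
      = (hK.eigenvalues i - a) * inner ℝ (e i) u := by
    have h := inner_eigenvectorBasis_toEuclideanLin_cfc hK id u i
    rw [show cfc id K = K from cfc_id ℝ K hK] at h
    rw [inner_sub_right, h, real_inner_smul_right, id, sub_mul]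
  rw [← e.sum_sq_inner_right u, ← e.sum_sq_inner_right (_ - _), ← e.sum_inner_mul_inner u,
    Finset.sum_div, ← Finset.sum_sub_distrib]
  refine Finset.sum_le_sum fun i _ => ?_
  rw [inner_residual, windowVec, inner_eigenvectorBasis_toEuclideanLin_cfc, real_inner_comm (e i) u]
  calc (inner ℝ (e i) u) ^ 2 - ((hK.eigenvalues i - a) * inner ℝ (e i) u) ^ 2 / b ^ 2
      = (1 - ((hK.eigenvalues i - a) / b) ^ 2) * (inner ℝ (e i) u) ^ 2 := by ring
    _ ≤ windowCutoff a b (hK.eigenvalues i) * (inner ℝ (e i) u) ^ 2 := by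
        gcongr
        exact one_sub_sq_le_windowCutoff a b _
    _ = _ := by ring

end SpectralCutoff

section ProductIntegrals

variable {ι : Type*} [Fintype ι] {E : ι → Type*} [∀ i, MeasurableSpace (E i)]
  {μ : ∀ i, Measure (E i)} [∀ i, IsProbabilityMeasure (μ i)] {f : ∀ i, E i → ℝ}

theorem integrable_finset_prod_pi {A : Finset ι} (hf : ∀ i ∈ A, Integrable (f i) (μ i)) :
    Integrable (fun x => ∏ i ∈ A, f i (x i)) (Measure.pi μ) := by
  classical
  have hite : Integrable (fun x => ∏ i, if i ∈ A then f i (x i) else 1) (Measure.pi μ) := by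
    refine Integrable.fintype_prod_dep (f := fun i x => if i ∈ A then f i x else 1) fun i => ?_
    by_cases hi : i ∈ A
    · simpa only [hi, if_true] using hf i hi
    · simp only [hi, if_false, integrable_const]
  simpa only [Fintype.prod_ite_mem] using hite

theorem integral_finset_prod_pi (A : Finset ι) :
    ∫ x, ∏ i ∈ A, f i (x i) ∂Measure.pi μ = ∏ i ∈ A, ∫ x, f i x ∂μ i := by
  classical
  have hite := integral_fintype_prod_eq_prod (μ := μ) fun i x => if i ∈ A then f i x else 1
  simp_rw [Fintype.prod_ite_mem] at hite
  rw [hite, ← Fintype.prod_ite_mem A fun i => ∫ x, f i x ∂μ i]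
  refine Finset.prod_congr rfl fun i _ => ?_
  split_ifs
  · rfl
  · rw [integral_const, probReal_univ, one_smul]

end ProductIntegrals

section GaussianProducts

theorem integrable_affine_gaussianReal_std (p s : ℝ) :
    Integrable (fun x => p + s * x) (gaussianReal 0 1) :=
  (integrable_const p).add (integrable_id_gaussianReal_std.const_mul s)

theorem integral_affine_gaussianReal_std (p s : ℝ) :
    ∫ x, (p + s * x) ∂gaussianReal 0 1 = p := by
  rw [integral_add (integrable_const p) (integrable_id_gaussianReal_std.const_mul s),
    integral_const_mul, integral_id_gaussianReal, integral_const, probReal_univ, one_smul, mul_zero,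
    add_zero]

theorem affine_sq (p s x : ℝ) :
    (p + s * x) ^ 2 = p ^ 2 + 2 * p * s * x + s ^ 2 * x ^ 2 := by ring

theorem integrable_affine_sq_gaussianReal_std (p s : ℝ) :
    Integrable (fun x => (p + s * x) ^ 2) (gaussianReal 0 1) := by
  simp_rw [affine_sq]
  exact (integrable_affine_gaussianReal_std _ _).add (integrable_sq_gaussianReal_std.const_mul _)

theorem integral_affine_sq_gaussianReal_std (p s : ℝ) :
    ∫ x, (p + s * x) ^ 2 ∂gaussianReal 0 1 = p ^ 2 + s ^ 2 := by
  simp_rw [affine_sq]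
  rw [integral_add (integrable_affine_gaussianReal_std _ _)
    (integrable_sq_gaussianReal_std.const_mul _), integral_affine_gaussianReal_std,
    integral_const_mul, integral_sq_gaussianReal_std, mul_one]

theorem prod_mul_prod_eq_prod_union {ι : Type*} [DecidableEq ι] (P P' : Finset ι) (f : ι → ℝ) :
    (∏ i ∈ P, f i) * ∏ i ∈ P', f i
      = ∏ i ∈ P ∪ P', if i ∈ P ∩ P' then f i ^ 2 else f i := by
  rw [← Finset.prod_union_inter, ← Finset.inter_eq_right.2 (Finset.inter_subset_union (s := P)),
    ← Finset.prod_ite_mem, ← Finset.prod_mul_distrib]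
  refine Finset.prod_congr rfl fun i hi => ?_
  simp only [Finset.mem_inter, hi, true_and]
  split_ifs <;> ring

theorem exp_mul_affine (t r p s x : ℝ) :
    Real.exp (t * x - r) * (p + s * x)
      = p * Real.exp (t * x - r) + s * (x * Real.exp (t * x - r)) := by ring

theorem integrable_exp_mul_affine_gaussianReal_std (t r p s : ℝ) :
    Integrable (fun x => Real.exp (t * x - r) * (p + s * x)) (gaussianReal 0 1) := by
  simp_rw [exp_mul_affine]
  exact ((integrable_exp_gaussianReal_std _ _).const_mul _).add
    ((integrable_mul_exp_gaussianReal_std _ _).const_mul _)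

theorem integral_exp_mul_affine_gaussianReal_std (t p s : ℝ) :
    ∫ x, Real.exp (t * x - t ^ 2 / 2) * (p + s * x) ∂gaussianReal 0 1 = p + s * t := by
  simp_rw [exp_mul_affine]
  rw [integral_add ((integrable_exp_gaussianReal_std _ _).const_mul _)
    ((integrable_mul_exp_gaussianReal_std _ _).const_mul _), integral_const_mul,
    integral_const_mul, integral_exp_gaussianReal_std, integral_mul_exp_gaussianReal_std, mul_one]

variable {ι : Type*} [Fintype ι]

theorem integrable_sum_mul_sq_gaussPi (A : Finset ι) (c : ι → ℝ) :
    Integrable (fun y : ι → ℝ => (∑ i ∈ A, c i * y i) ^ 2) (gaussPi ι) :=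
  (memLp_finsetSum _ fun i _ => ((IsGaussian.memLp_two_id
    (μ := gaussianReal 0 1)).comp_measurePreserving
    (measurePreserving_eval _ i)).const_mul (c i)).integrable_sq

theorem integral_sum_mul_sq_gaussPi (A : Finset ι) (c : ι → ℝ) :
    ∫ y : ι → ℝ, (∑ i ∈ A, c i * y i) ^ 2 ∂gaussPi ι = ∑ i ∈ A, c i ^ 2 := by
  classical
  have hlin (a : ℝ) : Var[fun x => a * x; gaussianReal 0 1] = a ^ 2 := by
    rw [variance_const_mul a fun x => x, variance_fun_id_gaussianReal, NNReal.coe_one, mul_one]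
  have hvar := variance_sum_pi (μ := fun _ : ι => gaussianReal 0 1)
    (X := fun i x => (if i ∈ A then c i else 0) * x)
    fun i => (IsGaussian.memLp_two_id (μ := gaussianReal 0 1)).const_mul _
  have hsum : (∑ i, fun y : ι → ℝ => (if i ∈ A then c i else 0) * y i)
      = fun y => ∑ i ∈ A, c i * y i := by
    ext y
    simp only [Finset.sum_apply, ite_mul, zero_mul, Finset.sum_ite_mem, Finset.univ_inter]
  have hint (i : ι) : Integrable (fun y : ι → ℝ => y i) (gaussPi ι) :=
    integrable_comp_eval (μ := fun _ => gaussianReal 0 1) integrable_id_gaussianReal_std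
  have hmean : ∫ y : ι → ℝ, ∑ i ∈ A, c i * y i ∂gaussPi ι = 0 := by
    rw [integral_finsetSum _ fun i _ => (hint i).const_mul (c i)]
    refine Finset.sum_eq_zero fun i _ => ?_
    rw [integral_const_mul, integral_comp_eval (μ := fun _ => gaussianReal 0 1)
      (f := fun x : ℝ => x) (by fun_prop), integral_id_gaussianReal, mul_zero]
  have hmeas : Measurable fun y : ι → ℝ => ∑ i ∈ A, c i * y i :=
    Finset.measurable_fun_sum _ fun i _ => (measurable_pi_apply i).const_mul _
  rw [hsum, variance_of_integral_eq_zero hmeas.aemeasurable hmean] at hvar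
  simp only [hlin, ite_pow, ne_eq, OfNat.ofNat_ne_zero, not_false_eq_true, zero_pow,
    Finset.sum_ite_mem, Finset.univ_inter] at hvar
  exact hvar

variable (P P' : Finset ι) (p : ι → ℝ) (s : ℝ)

theorem integrable_prod_affine_mul_prod_affine :
    Integrable (fun y : ι → ℝ => (∏ i ∈ P, (p i + s * y i)) * ∏ i ∈ P', (p i + s * y i))
      (gaussPi ι) := by
  classical
  simp_rw [prod_mul_prod_eq_prod_union]
  refine integrable_finset_prod_pi
    (f := fun i y => if i ∈ P ∩ P' then (p i + s * y) ^ 2 else p i + s * y) fun i _ => ?_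
  by_cases hi : i ∈ P ∩ P' <;> simp only [hi, if_true, if_false]
  · exact integrable_affine_sq_gaussianReal_std _ _
  · exact integrable_affine_gaussianReal_std _ _

theorem integral_prod_affine_mul_prod_affine [DecidableEq ι] (hp : ∀ i ∈ P ∩ P', p i ≠ 0) :
    ∫ y : ι → ℝ, (∏ i ∈ P, (p i + s * y i)) * ∏ i ∈ P', (p i + s * y i) ∂gaussPi ι
      = (∏ i ∈ P, p i) * (∏ i ∈ P', p i) * ∏ i ∈ P ∩ P', (1 + s ^ 2 / p i ^ 2) := by
  simp_rw [prod_mul_prod_eq_prod_union]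
  rw [integral_finset_prod_pi
    (f := fun i y => if i ∈ P ∩ P' then (p i + s * y) ^ 2 else p i + s * y),
    ← Finset.inter_eq_right.2 (Finset.inter_subset_union (s := P) (t := P')),
    ← Finset.prod_ite_mem, ← Finset.prod_mul_distrib]
  refine Finset.prod_congr rfl fun i hi => ?_
  by_cases hi' : i ∈ P ∩ P'
  · have := hp i hi'
    simp only [hi', Finset.mem_inter.2 ⟨hi, hi'⟩, if_true, integral_affine_sq_gaussianReal_std]
    field_simp
  · simp only [hi', Finset.mem_inter.not.2 fun h => hi' h.2, if_false, mul_one,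
      integral_affine_gaussianReal_std]

end GaussianProducts

section CameronMartin

variable {ι : Type*}

/-- The density of the Gaussian vector with mean `θ` on `A` and `0` off `A` with respect to the
standard one. -/
noncomputable def tiltWeight (A : Finset ι) (θ y : ι → ℝ) : ℝ :=
  ∏ i ∈ A, Real.exp (θ i * y i - θ i ^ 2 / 2)

theorem tiltWeight_pos (A : Finset ι) (θ y : ι → ℝ) : 0 < tiltWeight A θ y :=
  Finset.prod_pos fun _ _ => Real.exp_pos _

theorem continuous_tiltWeight (A : Finset ι) (θ : ι → ℝ) : Continuous (tiltWeight A θ) := by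
  unfold tiltWeight
  fun_prop

theorem tiltWeight_sq (A : Finset ι) (θ y : ι → ℝ) :
    tiltWeight A θ y ^ 2 = Real.exp (∑ i ∈ A, θ i ^ 2) * tiltWeight A (fun i => 2 * θ i) y := by
  simp_rw [tiltWeight, Real.exp_sum, ← Finset.prod_pow, ← Finset.prod_mul_distrib,
    ← Real.exp_nat_mul, ← Real.exp_add]
  refine Finset.prod_congr rfl fun i _ => congrArg Real.exp ?_
  push_cast
  ring

theorem tiltWeight_inv (A : Finset ι) (θ y : ι → ℝ) :
    (tiltWeight A θ y)⁻¹ = Real.exp (∑ i ∈ A, θ i ^ 2) * tiltWeight A (fun i => -θ i) y := by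
  simp_rw [tiltWeight, Real.exp_sum, ← Finset.prod_inv_distrib, ← Finset.prod_mul_distrib,
    ← Real.exp_neg, ← Real.exp_add]
  exact Finset.prod_congr rfl fun i _ => congrArg Real.exp (by ring)

theorem tiltWeight_mul_prod_affine [DecidableEq ι] {A P : Finset ι} (θ p : ι → ℝ) (s : ℝ)
    (hP : P ⊆ A) (y : ι → ℝ) :
    tiltWeight A θ y * ∏ i ∈ P, (p i + s * y i)
      = ∏ i ∈ A, Real.exp (θ i * y i - θ i ^ 2 / 2) * if i ∈ P then p i + s * y i else 1 := by
  rw [Finset.prod_mul_distrib, Finset.prod_ite_mem, Finset.inter_eq_right.2 hP, tiltWeight]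

variable [Fintype ι] (A : Finset ι) (θ : ι → ℝ)

theorem integrable_tiltWeight : Integrable (tiltWeight A θ) (gaussPi ι) :=
  integrable_finset_prod_pi (f := fun i x => Real.exp (θ i * x - θ i ^ 2 / 2)) fun _ _ =>
    integrable_exp_gaussianReal_std _ _

theorem integral_tiltWeight : ∫ y, tiltWeight A θ y ∂gaussPi ι = 1 := by
  unfold tiltWeight
  rw [integral_finset_prod_pi (f := fun i x => Real.exp (θ i * x - θ i ^ 2 / 2))]
  exact Finset.prod_eq_one fun i _ => integral_exp_gaussianReal_std _

theorem integrable_tiltWeight_sq : Integrable (fun y => tiltWeight A θ y ^ 2) (gaussPi ι) := by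
  simp_rw [tiltWeight_sq]
  exact (integrable_tiltWeight _ _).const_mul _

theorem integral_tiltWeight_sq :
    ∫ y, tiltWeight A θ y ^ 2 ∂gaussPi ι = Real.exp (∑ i ∈ A, θ i ^ 2) := by
  simp_rw [tiltWeight_sq]
  rw [integral_const_mul, integral_tiltWeight, mul_one]

theorem integrable_tiltWeight_inv : Integrable (fun y => (tiltWeight A θ y)⁻¹) (gaussPi ι) := by
  simp_rw [tiltWeight_inv]
  exact (integrable_tiltWeight _ _).const_mul _

theorem integral_tiltWeight_inv :
    ∫ y, (tiltWeight A θ y)⁻¹ ∂gaussPi ι = Real.exp (∑ i ∈ A, θ i ^ 2) := by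
  simp_rw [tiltWeight_inv]
  rw [integral_const_mul, integral_tiltWeight, mul_one]

variable {A} {P : Finset ι} (p : ι → ℝ) (s : ℝ)

theorem integrable_tiltWeight_mul_prod_affine (hP : P ⊆ A) :
    Integrable (fun y => tiltWeight A θ y * ∏ i ∈ P, (p i + s * y i)) (gaussPi ι) := by
  classical
  simp_rw [tiltWeight_mul_prod_affine θ p s hP]
  refine integrable_finset_prod_pi (f := fun i x => Real.exp (θ i * x - θ i ^ 2 / 2) *
    if i ∈ P then p i + s * x else 1) fun i _ => ?_
  by_cases hi : i ∈ P <;> simp only [hi, if_true, if_false, mul_one]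
  · exact integrable_exp_mul_affine_gaussianReal_std _ _ _ _
  · exact integrable_exp_gaussianReal_std _ _

theorem integral_tiltWeight_mul_prod_affine (hP : P ⊆ A) :
    ∫ y, tiltWeight A θ y * ∏ i ∈ P, (p i + s * y i) ∂gaussPi ι = ∏ i ∈ P, (p i + s * θ i) := by
  classical
  simp_rw [tiltWeight_mul_prod_affine θ p s hP]
  rw [integral_finset_prod_pi (f := fun i x => Real.exp (θ i * x - θ i ^ 2 / 2) *
    if i ∈ P then p i + s * x else 1), ← Finset.inter_eq_right.2 hP, ← Finset.prod_ite_mem]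
  refine Finset.prod_congr rfl fun i hi => ?_
  by_cases hi' : i ∈ P
  · simp only [hi', Finset.mem_inter.2 ⟨hi, hi'⟩, if_true, integral_exp_mul_affine_gaussianReal_std]
  · simp only [hi', Finset.mem_inter.not.2 fun h => hi' h.2, if_false, mul_one,
      integral_exp_gaussianReal_std]

end CameronMartin

section KikuchiMatrix

variable {n k ℓ : ℕ}

/-- The Kikuchi matrix of a family of reals indexed by sets, of which only the values at `k`-sets
matter; it lets the entries of a tensor be replaced by a Gaussian vector. -/
noncomputable def kikuchiOf (k ℓ : ℕ) (t : Finset (Fin n) → ℝ) :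
    Matrix (Sub n ℓ) (Sub n ℓ) ℝ :=
  ∑ S ∈ level (Fin n) k, t S • kikuchiMatching n ℓ S

theorem kikuchi_eq_kikuchiOf (T : Tensor n k) : kikuchi ℓ T = kikuchiOf k ℓ (entry T) := rfl

theorem kikuchiOf_congr {t t' : Finset (Fin n) → ℝ} (h : ∀ S ∈ level (Fin n) k, t S = t' S) :
    kikuchiOf k ℓ t = kikuchiOf k ℓ t' :=
  Finset.sum_congr rfl fun S hS => by rw [h S hS]

theorem kikuchiOf_isHermitian (t : Finset (Fin n) → ℝ) : (kikuchiOf k ℓ t).IsHermitian := by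
  refine Matrix.IsHermitian.ext fun V U => ?_
  simp only [kikuchiOf, Matrix.sum_apply, Matrix.smul_apply, kikuchiMatching, Matrix.of_apply,
    star_trivial, symmDiff_comm U.1]

theorem continuous_kikuchiOf : Continuous (kikuchiOf k ℓ : (Finset (Fin n) → ℝ) → _) := by
  unfold kikuchiOf
  fun_prop

theorem kikuchiOf_add_smul (t t' : Finset (Fin n) → ℝ) (a b : ℝ) :
    kikuchiOf k ℓ (a • t + b • t') = a • kikuchiOf k ℓ t + b • kikuchiOf k ℓ t' := by
  simp only [kikuchiOf, Finset.smul_sum, ← Finset.sum_add_distrib, Pi.add_apply, Pi.smul_apply,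
    smul_eq_mul, add_smul, mul_smul]

/-- `z_S = ∏_{i ∈ S} z_i`, the entry at `S` of the signal `z^{⊗k}`. -/
def signProd (z : Fin n → ℝ) (S : Finset (Fin n)) : ℝ := ∏ i ∈ S, z i

/-- The planted unit vector, with coordinates `z_V / √C(n,ℓ)`. -/
noncomputable def plantedVec (ℓ : ℕ) (z : Fin n → ℝ) : EuclideanSpace ℝ (Sub n ℓ) :=
  WithLp.toLp 2 fun V => signProd z V.1 / Real.sqrt (n.choose ℓ)

/-- The coefficient of `t_S` in the `V`-coordinate of `𝒦_ℓ(t)` applied to the planted vector. -/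
noncomputable def matchingCoeff (ℓ : ℕ) (z : Fin n → ℝ) (V S : Finset (Fin n)) : ℝ :=
  if (symmDiff V S).card = ℓ then signProd z V * signProd z S / Real.sqrt (n.choose ℓ) else 0

theorem sum_sub_eq (f : Finset (Fin n) → ℝ) :
    ∑ V : Sub n ℓ, f V.1 = ∑ V ∈ level (Fin n) ℓ, f V :=
  (Finset.sum_subtype _ (fun _ => Finset.mem_powersetCard_univ) f).symm

theorem card_symmDiff_add_two_mul_card_inter {α : Type*} [DecidableEq α] (V S : Finset α) :
    (symmDiff V S).card + 2 * (S ∩ V).card = V.card + S.card := by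
  have hV := Finset.card_sdiff_add_card_inter V S
  have hS := Finset.card_sdiff_add_card_inter S V
  have hVS : (symmDiff V S).card = (V \ S).card + (S \ V).card :=
    Finset.card_union_of_disjoint disjoint_sdiff_sdiff
  rw [Finset.inter_comm V S] at hV
  omega

theorem card_filter_card_inter {α : Type*} [Fintype α] [DecidableEq α] (V : Finset α) (i j : ℕ) :
    {S ∈ level α (i + j) | (S ∩ V).card = j}.card
      = (Fintype.card α - V.card).choose i * V.card.choose j := by
  rw [← Finset.card_compl, ← Finset.card_powersetCard, ← Finset.card_powersetCard j,
    ← Finset.card_product]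
  have union_split {A B : Finset α} (hA : A ⊆ Vᶜ) (hB : B ⊆ V) :
      (A ∪ B) \ V = A ∧ (A ∪ B) ∩ V = B := by
    have hAV : Disjoint A V := Finset.disjoint_left.2 fun x hx => Finset.mem_compl.1 (hA hx)
    rw [Finset.union_sdiff_distrib, Finset.sdiff_eq_empty_iff_subset.2 hB, Finset.union_empty,
      Finset.sdiff_eq_self_of_disjoint hAV, Finset.union_inter_distrib_right,
      Finset.disjoint_iff_inter_eq_empty.1 hAV, Finset.empty_union, Finset.inter_eq_left.2 hB]
    exact ⟨rfl, rfl⟩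
  refine Finset.card_bij' (fun S _ => (S \ V, S ∩ V)) (fun p _ => p.1 ∪ p.2) ?_ ?_ ?_ ?_
  · intro S hS
    simp only [Finset.mem_filter, Finset.mem_powersetCard_univ] at hS
    have hcard := Finset.card_sdiff_add_card_inter S V
    simp only [Finset.mem_product, Finset.mem_powersetCard, Finset.inter_subset_right, true_and]
    exact ⟨⟨fun x hx => Finset.mem_compl.2 (Finset.mem_sdiff.1 hx).2, by omega⟩, hS.2⟩
  · rintro ⟨A, B⟩ hAB
    simp only [Finset.mem_product, Finset.mem_powersetCard] at hAB
    obtain ⟨⟨hA, hAi⟩, hB, hBj⟩ := hAB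
    have hcard := Finset.card_sdiff_add_card_inter (A ∪ B) V
    rw [(union_split hA hB).1, (union_split hA hB).2] at hcard
    simp only [Finset.mem_filter, Finset.mem_powersetCard_univ, (union_split hA hB).2]
    omega
  · exact fun S _ => Finset.sdiff_union_inter S V
  · rintro ⟨A, B⟩ hAB
    simp only [Finset.mem_product, Finset.mem_powersetCard] at hAB
    exact Prod.ext (union_split hAB.1.1 hAB.2.1).1 (union_split hAB.1.1 hAB.2.1).2

theorem card_filter_card_symmDiff (hk : Even k) {V : Finset (Fin n)} (hV : V.card = ℓ) :
    {S ∈ level (Fin n) k | (symmDiff V S).card = ℓ}.card = kikuchiDegree n k ℓ := by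
  have hk2 : k / 2 + k / 2 = k := by have := Nat.even_iff.1 hk; omega
  have hcount := card_filter_card_inter V (k / 2) (k / 2)
  rw [hk2, Fintype.card_fin, hV] at hcount
  rw [kikuchiDegree, ← hcount]
  refine congrArg Finset.card (Finset.filter_congr fun S hS => ?_)
  have hS := Finset.mem_powersetCard_univ.1 hS
  have hcard := card_symmDiff_add_two_mul_card_inter V S
  omega

variable {z : Fin n → ℝ} (hz : ∀ i, z i = 1 ∨ z i = -1)

include hz

theorem signProd_sq (S : Finset (Fin n)) : signProd z S ^ 2 = 1 := by
  rw [signProd, ← Finset.prod_pow]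
  exact Finset.prod_eq_one fun i _ => sq_eq_one_iff.2 (hz i)

theorem signProd_symmDiff (V S : Finset (Fin n)) :
    signProd z (symmDiff V S) = signProd z V * signProd z S := by
  have hV : signProd z (V \ S) * signProd z (V ∩ S) = signProd z V := by
    simp only [signProd]
    rw [← Finset.prod_union (Finset.disjoint_sdiff_inter V S), Finset.sdiff_union_inter]
  have hS : signProd z (S \ V) * signProd z (V ∩ S) = signProd z S := by
    simp only [signProd]
    rw [Finset.inter_comm, ← Finset.prod_union (Finset.disjoint_sdiff_inter S V),
      Finset.sdiff_union_inter]
  have hVS : signProd z (symmDiff V S) = signProd z (V \ S) * signProd z (S \ V) :=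
    Finset.prod_union disjoint_sdiff_sdiff
  rw [← hV, ← hS, hVS]
  linear_combination -(signProd z (V \ S) * signProd z (S \ V)) * signProd_sq hz (V ∩ S)

theorem norm_plantedVec (hℓ : ℓ ≤ n) : ‖plantedVec ℓ z‖ = 1 := by
  have hN : (0 : ℝ) < n.choose ℓ := mod_cast Nat.choose_pos hℓ
  have hcoord (V : Sub n ℓ) : ‖plantedVec ℓ z V‖ ^ 2 = 1 / (n.choose ℓ : ℝ) := by
    rw [Real.norm_eq_abs, sq_abs, plantedVec, div_pow, signProd_sq hz, Real.sq_sqrt hN.le]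
  rw [← pow_eq_one_iff_of_nonneg (norm_nonneg _) two_ne_zero, EuclideanSpace.norm_sq_eq]
  simp only [hcoord, Finset.sum_const, Finset.card_univ, Fintype.card_finset_len, Fintype.card_fin,
    nsmul_eq_mul]
  exact mul_one_div_cancel hN.ne'

theorem kikuchiMatching_mulVec_plantedVec (V : Sub n ℓ) (S : Finset (Fin n)) :
    (kikuchiMatching n ℓ S).mulVec (plantedVec ℓ z).ofLp V = matchingCoeff ℓ z V.1 S := by
  have hiff (U : Finset (Fin n)) : symmDiff V.1 U = S ↔ U = symmDiff V.1 S := by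
    constructor <;> rintro rfl <;> rw [symmDiff_symmDiff_cancel_left]
  simp only [Matrix.mulVec, dotProduct, kikuchiMatching, Matrix.of_apply, ite_mul, one_mul,
    zero_mul, hiff, plantedVec]
  rw [sum_sub_eq fun U => if U = symmDiff V.1 S then signProd z U / √(n.choose ℓ) else 0,
    Finset.sum_ite_eq', signProd_symmDiff hz, matchingCoeff]
  simp only [Finset.mem_powersetCard_univ]

theorem toEuclideanLin_kikuchiOf_plantedVec_apply (t : Finset (Fin n) → ℝ) (V : Sub n ℓ) :
    Matrix.toEuclideanLin (kikuchiOf k ℓ t) (plantedVec ℓ z) V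
      = ∑ S ∈ level (Fin n) k, matchingCoeff ℓ z V.1 S * t S := by
  rw [Matrix.toLpLin_apply, kikuchiOf, Matrix.sum_mulVec, PiLp.toLp_apply, Finset.sum_apply]
  refine Finset.sum_congr rfl fun S _ => ?_
  rw [Matrix.smul_mulVec, Pi.smul_apply, kikuchiMatching_mulVec_plantedVec hz, smul_eq_mul,
    mul_comm]

theorem toEuclideanLin_kikuchiOf_signProd (hk : Even k) :
    Matrix.toEuclideanLin (kikuchiOf k ℓ (signProd z)) (plantedVec ℓ z)
      = (kikuchiDegree n k ℓ : ℝ) • plantedVec ℓ z := by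
  ext V
  have hcoeff (S : Finset (Fin n)) : matchingCoeff ℓ z V.1 S * signProd z S
      = if (symmDiff V.1 S).card = ℓ then signProd z V.1 / Real.sqrt (n.choose ℓ) else 0 := by
    unfold matchingCoeff
    split_ifs
    · linear_combination signProd z V.1 / Real.sqrt (n.choose ℓ) * signProd_sq hz S
    · rw [zero_mul]
  rw [toEuclideanLin_kikuchiOf_plantedVec_apply hz]
  simp_rw [hcoeff]
  rw [← Finset.sum_filter, Finset.sum_const, card_filter_card_symmDiff hk V.2, nsmul_eq_mul,
    PiLp.smul_apply, smul_eq_mul, plantedVec]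

theorem sum_matchingCoeff_sq (hk : Even k) {V : Finset (Fin n)} (hV : V.card = ℓ) :
    ∑ S ∈ level (Fin n) k, matchingCoeff ℓ z V S ^ 2 = kikuchiDegree n k ℓ / n.choose ℓ := by
  have hcoeff (S : Finset (Fin n)) : matchingCoeff ℓ z V S ^ 2
      = if (symmDiff V S).card = ℓ then 1 / (n.choose ℓ : ℝ) else 0 := by
    unfold matchingCoeff
    split_ifs
    · rw [div_pow, mul_pow, signProd_sq hz, signProd_sq hz, Real.sq_sqrt (Nat.cast_nonneg _),
        mul_one]
    · rw [zero_pow two_ne_zero]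
  simp_rw [hcoeff]
  rw [← Finset.sum_filter, Finset.sum_const, card_filter_card_symmDiff hk hV, nsmul_eq_mul,
    mul_one_div]

theorem norm_sq_toEuclideanLin_kikuchiOf_plantedVec (x : Finset (Fin n) → ℝ) :
    ‖Matrix.toEuclideanLin (kikuchiOf k ℓ x) (plantedVec ℓ z)‖ ^ 2
      = ∑ V : Sub n ℓ, (∑ S ∈ level (Fin n) k, matchingCoeff ℓ z V.1 S * x S) ^ 2 := by
  simp_rw [EuclideanSpace.norm_sq_eq, Real.norm_eq_abs, sq_abs,
    toEuclideanLin_kikuchiOf_plantedVec_apply hz]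

theorem integrable_norm_sq_toEuclideanLin_kikuchiOf_plantedVec :
    Integrable (fun x => ‖Matrix.toEuclideanLin (kikuchiOf k ℓ x) (plantedVec ℓ z)‖ ^ 2)
      (gaussPi (Finset (Fin n))) := by
  simp_rw [norm_sq_toEuclideanLin_kikuchiOf_plantedVec hz]
  exact integrable_finsetSum _ fun V _ => integrable_sum_mul_sq_gaussPi _ _

theorem integral_norm_sq_toEuclideanLin_kikuchiOf_plantedVec (hk : Even k) (hℓ : ℓ ≤ n) :
    ∫ x, ‖Matrix.toEuclideanLin (kikuchiOf k ℓ x) (plantedVec ℓ z)‖ ^ 2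
      ∂gaussPi (Finset (Fin n)) = kikuchiDegree n k ℓ := by
  have hN : (n.choose ℓ : ℝ) ≠ 0 := mod_cast (Nat.choose_pos hℓ).ne'
  simp_rw [norm_sq_toEuclideanLin_kikuchiOf_plantedVec hz]
  rw [integral_finsetSum _ fun V _ => integrable_sum_mul_sq_gaussPi _ _,
    Finset.sum_congr rfl fun V _ => (integral_sum_mul_sq_gaussPi _ _).trans
      (sum_matchingCoeff_sq hz hk V.2), Finset.sum_const, Finset.card_univ,
    Fintype.card_finset_len, Fintype.card_fin, nsmul_eq_mul, mul_div_cancel₀ _ hN]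

end KikuchiMatrix

section PartitionSums

variable {α : Type*} [Fintype α] [DecidableEq α] {k c : ℕ}

/-- The pairs of an `ℓ`-element set and a partition of it into `k`-element sets. -/
def levelParts (α : Type*) [Fintype α] [DecidableEq α] (k ℓ : ℕ) :
    Finset ((_ : Finset α) × Finset (Finset α)) :=
  (level α ℓ).sigma (parts k)

theorem mem_levelParts {ℓ : ℕ} {q : (_ : Finset α) × Finset (Finset α)} :
    q ∈ levelParts α k ℓ ↔ q.1.card = ℓ ∧ q.2 ∈ parts k q.1 := by
  rw [levelParts, Finset.mem_sigma, Finset.mem_powersetCard_univ]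

theorem sum_sum_mul_sum_powerset_inter {ι : Type*} (I : Finset ι) (P : ι → Finset α)
    (w : ι → ℝ) (r : ℝ) :
    ∑ q ∈ I, ∑ q' ∈ I, w q * w q' * ∑ B ∈ (P q ∩ P q').powerset, r ^ B.card
      = ∑ B, r ^ B.card * (∑ q ∈ I with B ⊆ P q, w q) ^ 2 := by
  have hpowerset (q q' : ι) :
      (P q ∩ P q').powerset = Finset.univ.filter fun B => B ⊆ P q ∧ B ⊆ P q' := by
    ext B
    simp only [Finset.mem_powerset, Finset.subset_inter_iff, Finset.mem_filter, Finset.mem_univ,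
      true_and]
  simp_rw [hpowerset, Finset.sum_filter, Finset.mul_sum, pow_two, Finset.sum_mul_sum,
    Finset.mul_sum, Finset.sum_comm (s := I) (t := Finset.univ)]
  refine Finset.sum_congr rfl fun B _ => Finset.sum_congr rfl fun q _ =>
    Finset.sum_congr rfl fun q' _ => ?_
  rw [ite_and]
  split_ifs <;> ring

theorem sum_filter_subset_levelParts (hk : 0 < k) {j : ℕ} {W : Finset α}
    {B : Finset (Finset α)} (hB : B ∈ parts k W) (hW : W.card = j * k) (f : Finset α → ℝ) :
    ∑ q ∈ levelParts α k (c * k) with B ⊆ q.2, f q.1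
      = numParts k ((c - j) * k) * supersetSum (c * k) f W := by
  simp_rw [levelParts, Finset.sum_filter]
  rw [Finset.sum_sigma, supersetSum, Finset.sum_filter, Finset.mul_sum]
  refine Finset.sum_congr rfl fun V hV => ?_
  simp only [← Finset.sum_filter, Finset.sum_const, nsmul_eq_mul]
  split_ifs with hWV
  · rw [card_parts_filter_superset hk hB hWV, card_parts_eq_numParts hk]
    rw [Finset.card_sdiff_of_subset hWV, hW, Finset.mem_powersetCard_univ.1 hV, Nat.sub_mul]
  · rw [Finset.card_eq_zero.2, Nat.cast_zero, zero_mul, mul_zero]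
    exact Finset.filter_eq_empty_iff.2 fun P hP hBP =>
      hWV (biUnion_of_mem_parts hB ▸ biUnion_subset_of_subset hP hBP)

theorem sum_eq_sum_parts (hk : 0 < k) {F : Finset (Finset α) → ℝ}
    (hF : ∀ B, F B ≠ 0 → ∃ q ∈ levelParts α k (c * k), B ⊆ q.2) :
    ∑ B, F B = ∑ j ∈ Finset.range (c + 1), ∑ W ∈ level α (j * k), ∑ B ∈ parts k W, F B := by
  simp_rw [Finset.sum_sigma']
  symm
  refine Finset.sum_of_injOn (fun x => x.2.2) ?_ (fun _ _ => Finset.mem_univ _) ?_ fun _ _ => rfl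
  · rintro ⟨j, W, B⟩ hx ⟨j', W', B'⟩ hx' (rfl : B = B')
    simp only [Finset.coe_sigma, Set.mem_sigma_iff, Finset.mem_coe,
      Finset.mem_powersetCard_univ] at hx hx'
    obtain rfl : W = W' := (biUnion_of_mem_parts hx.2.2).symm.trans (biUnion_of_mem_parts hx'.2.2)
    obtain rfl : j = j' := Nat.eq_of_mul_eq_mul_right hk (hx.2.1.symm.trans hx'.2.1)
    rfl
  · intro B _ hB
    by_contra hne
    obtain ⟨q, hq, hBq⟩ := hF B hne
    obtain ⟨hq1, hq2⟩ := mem_levelParts.1 hq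
    have hBparts := mem_parts_biUnion_of_subset hq2 hBq
    have hBc : B.card ≤ c := card_eq_of_mem_parts hk hq1 hq2 ▸ Finset.card_le_card hBq
    refine hB ⟨⟨B.card, B.biUnion id, B⟩, ?_, rfl⟩
    simp only [Finset.coe_sigma, Set.mem_sigma_iff, Finset.mem_coe, Finset.mem_powersetCard_univ,
      Finset.mem_range]
    exact ⟨by omega, card_eq_card_mul_of_mem_parts hBparts, hBparts⟩

theorem sum_pow_card_mul_sum_filter_subset_sq (hk : 0 < k) (f : Finset α → ℝ) (r : ℝ) :
    ∑ B, r ^ B.card * (∑ q ∈ levelParts α k (c * k) with B ⊆ q.2, f q.1) ^ 2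
      = ∑ j ∈ Finset.range (c + 1), r ^ j * numParts k (j * k) *
          (numParts k ((c - j) * k) : ℝ) ^ 2 *
          ∑ W ∈ level α (j * k), supersetSum (c * k) f W ^ 2 := by
  rw [sum_eq_sum_parts (c := c) hk]
  · refine Finset.sum_congr rfl fun j _ => ?_
    rw [Finset.mul_sum]
    refine Finset.sum_congr rfl fun W hW => ?_
    have hWc := Finset.mem_powersetCard_univ.1 hW
    rw [Finset.sum_congr rfl fun B hB => by
      rw [sum_filter_subset_levelParts hk hB hWc, card_eq_of_mem_parts hk hWc hB],
      Finset.sum_const, card_parts_eq_numParts hk hWc, nsmul_eq_mul]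
    ring
  · intro B hB
    by_contra! hempty
    refine hB ?_
    rw [Finset.filter_false_of_mem hempty, Finset.sum_empty, zero_pow two_ne_zero, mul_zero]

theorem sum_supersetSum_single_sq {V : Finset α} (m : ℕ) (r : ℝ) :
    ∑ W ∈ level α m, supersetSum V.card (Pi.single V r) W ^ 2 = V.card.choose m * r ^ 2 := by
  have hsum (W : Finset α) : supersetSum V.card (Pi.single V r) W ^ 2
      = if W ⊆ V then r ^ 2 else 0 := by
    rw [supersetSum, Finset.sum_pi_single']
    simp only [Finset.mem_filter, Finset.mem_powersetCard_univ, true_and, ite_pow, ne_eq,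
      OfNat.ofNat_ne_zero, not_false_eq_true, zero_pow]
  have hfilter : (level α m).filter (· ⊆ V) = V.powersetCard m := by
    ext W
    simp only [Finset.mem_filter, Finset.mem_powersetCard, Finset.subset_univ, true_and, and_comm]
  simp_rw [hsum]
  rw [← Finset.sum_filter, hfilter, Finset.sum_const, Finset.card_powersetCard, nsmul_eq_mul]

end PartitionSums

section PartitionPolynomial

variable {n k ℓ c : ℕ}

/-- The polynomial `∑_V g_V ∑_{P ∈ Part_k(V)} ∏_{S ∈ P} t_S` over the `ℓ`-element sets `V`: up to
normalization, the inner product of `g` with the guiding vector. -/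
noncomputable def partitionPoly (k ℓ : ℕ) (g t : Finset (Fin n) → ℝ) : ℝ :=
  ∑ V ∈ level (Fin n) ℓ, g V * ∑ P ∈ parts k V, ∏ S ∈ P, t S

theorem partitionPoly_eq_sum_levelParts (g t : Finset (Fin n) → ℝ) :
    partitionPoly k ℓ g t = ∑ q ∈ levelParts (Fin n) k ℓ, g q.1 * ∏ S ∈ q.2, t S := by
  simp_rw [partitionPoly, Finset.mul_sum]
  rw [levelParts, Finset.sum_sigma]

/-- The spiked family `β z_S + s y_S`. -/
noncomputable def noisy (β : ℝ) (z : Fin n → ℝ) (s : ℝ) (y : Finset (Fin n) → ℝ) :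
    Finset (Fin n) → ℝ := fun S => β * signProd z S + s * y S

theorem continuous_noisy (β : ℝ) (z : Fin n → ℝ) (s : ℝ) : Continuous (noisy β z s) := by
  unfold noisy
  fun_prop

theorem prod_mul_signProd_of_mem_levelParts (hk : 0 < k)
    {q : (_ : Finset (Fin n)) × Finset (Finset (Fin n))} (hq : q ∈ levelParts (Fin n) k (c * k))
    (r : ℝ) (z : Fin n → ℝ) : ∏ S ∈ q.2, r * signProd z S = r ^ c * signProd z q.1 := by
  obtain ⟨hq1, hq2⟩ := mem_levelParts.1 hq
  rw [Finset.prod_mul_distrib, Finset.prod_const, card_eq_of_mem_parts hk hq1 hq2]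
  exact congrArg _ (prod_prod_of_mem_parts hq2 z)

theorem partitionPoly_noisy_sq (β s : ℝ) (z : Fin n → ℝ) (g y : Finset (Fin n) → ℝ) :
    partitionPoly k ℓ g (noisy β z s y) ^ 2
      = ∑ q ∈ levelParts (Fin n) k ℓ, ∑ q' ∈ levelParts (Fin n) k ℓ, (g q.1 * g q'.1) *
        ((∏ S ∈ q.2, (β * signProd z S + s * y S)) *
          ∏ S ∈ q'.2, (β * signProd z S + s * y S)) := by
  rw [partitionPoly_eq_sum_levelParts, pow_two, Finset.sum_mul_sum]
  exact Finset.sum_congr rfl fun q _ => Finset.sum_congr rfl fun q' _ => mul_mul_mul_comm _ _ _ _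

theorem integrable_partitionPoly_noisy_sq (β s : ℝ) (z : Fin n → ℝ) (g : Finset (Fin n) → ℝ) :
    Integrable (fun y => partitionPoly k ℓ g (noisy β z s y) ^ 2)
      (gaussPi (Finset (Fin n))) := by
  simp_rw [partitionPoly_noisy_sq]
  exact integrable_finsetSum _ fun q _ => integrable_finsetSum _ fun q' _ =>
    (integrable_prod_affine_mul_prod_affine _ _ _ _).const_mul _

theorem tiltWeight_mul_partitionPoly_noisy (β s : ℝ) (z : Fin n → ℝ)
    (g θ y : Finset (Fin n) → ℝ) :
    tiltWeight (level (Fin n) k) θ y * partitionPoly k ℓ g (noisy β z s y)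
      = ∑ q ∈ levelParts (Fin n) k ℓ, g q.1 * (tiltWeight (level (Fin n) k) θ y *
          ∏ S ∈ q.2, (β * signProd z S + s * y S)) := by
  rw [partitionPoly_eq_sum_levelParts, Finset.mul_sum]
  exact Finset.sum_congr rfl fun q _ => mul_left_comm _ _ _

theorem subset_level_of_mem_levelParts {q : (_ : Finset (Fin n)) × Finset (Finset (Fin n))}
    (hq : q ∈ levelParts (Fin n) k ℓ) : q.2 ⊆ level (Fin n) k := fun _ hS =>
  Finset.mem_powersetCard_univ.2 (card_of_mem_parts (mem_levelParts.1 hq).2 hS)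

theorem integrable_tiltWeight_mul_partitionPoly_noisy (β s : ℝ) (z : Fin n → ℝ)
    (g θ : Finset (Fin n) → ℝ) :
    Integrable (fun y => tiltWeight (level (Fin n) k) θ y * partitionPoly k ℓ g (noisy β z s y))
      (gaussPi (Finset (Fin n))) := by
  simp_rw [tiltWeight_mul_partitionPoly_noisy]
  exact integrable_finsetSum _ fun q hq => (integrable_tiltWeight_mul_prod_affine _ _ _
    (subset_level_of_mem_levelParts hq)).const_mul _

theorem integral_tiltWeight_mul_partitionPoly_noisy (hk : 0 < k) (β s τ : ℝ) (z : Fin n → ℝ)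
    (g : Finset (Fin n) → ℝ) :
    ∫ y, tiltWeight (level (Fin n) k) (fun S => τ * signProd z S) y *
        partitionPoly k (c * k) g (noisy β z s y) ∂gaussPi (Finset (Fin n))
      = (β + s * τ) ^ c * numParts k (c * k) *
        ∑ V ∈ level (Fin n) (c * k), g V * signProd z V := by
  have hterm : ∀ q ∈ levelParts (Fin n) k (c * k),
      ∫ y, g q.1 * (tiltWeight (level (Fin n) k) (fun S => τ * signProd z S) y *
          ∏ S ∈ q.2, (β * signProd z S + s * y S)) ∂gaussPi (Finset (Fin n))
        = (β + s * τ) ^ c * (g q.1 * signProd z q.1) := by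
    intro q hq
    rw [integral_const_mul, integral_tiltWeight_mul_prod_affine _ _ _
      (subset_level_of_mem_levelParts hq)]
    simp_rw [← mul_assoc s, ← add_mul]
    rw [prod_mul_signProd_of_mem_levelParts hk hq, mul_left_comm]
  simp_rw [tiltWeight_mul_partitionPoly_noisy]
  rw [integral_finsetSum _ fun q hq => (integrable_tiltWeight_mul_prod_affine _ _ _
    (subset_level_of_mem_levelParts hq)).const_mul _, Finset.sum_congr rfl hterm, levelParts,
    Finset.sum_sigma, Finset.mul_sum]
  refine Finset.sum_congr rfl fun V hV => ?_
  simp only [Finset.sum_const, nsmul_eq_mul,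
    card_parts_eq_numParts hk (Finset.mem_powersetCard_univ.1 hV)]
  ring

theorem integral_partitionPoly_noisy_sq (hk : 0 < k) {z : Fin n → ℝ}
    (hz : ∀ i, z i = 1 ∨ z i = -1) {β : ℝ} (hβ : β ≠ 0) (s : ℝ) (g : Finset (Fin n) → ℝ) :
    ∫ y, partitionPoly k (c * k) g (noisy β z s y) ^ 2 ∂gaussPi (Finset (Fin n))
      = β ^ (2 * c) * ∑ j ∈ Finset.range (c + 1), (s ^ 2 / β ^ 2) ^ j * numParts k (j * k) *
          (numParts k ((c - j) * k) : ℝ) ^ 2 *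
          ∑ W ∈ level (Fin n) (j * k),
            supersetSum (c * k) (fun V => g V * signProd z V) W ^ 2 := by
  have hsign (S : Finset (Fin n)) : signProd z S ≠ 0 := fun h => by
    simpa [h] using signProd_sq hz S
  have hterm : ∀ q ∈ levelParts (Fin n) k (c * k), ∀ q' ∈ levelParts (Fin n) k (c * k),
      ∫ y, (g q.1 * g q'.1) * ((∏ S ∈ q.2, (β * signProd z S + s * y S)) *
          ∏ S ∈ q'.2, (β * signProd z S + s * y S)) ∂gaussPi (Finset (Fin n))
        = β ^ (2 * c) * ((g q.1 * signProd z q.1) * (g q'.1 * signProd z q'.1) *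
          ∑ B ∈ (q.2 ∩ q'.2).powerset, (s ^ 2 / β ^ 2) ^ B.card) := by
    intro q hq q' hq'
    rw [integral_const_mul, integral_prod_affine_mul_prod_affine _ _ _ _
      fun S _ => mul_ne_zero hβ (hsign S), prod_mul_signProd_of_mem_levelParts hk hq,
      prod_mul_signProd_of_mem_levelParts hk hq']
    simp_rw [mul_pow, signProd_sq hz, mul_one, Finset.prod_one_add, Finset.prod_const]
    ring
  simp_rw [partitionPoly_noisy_sq]
  rw [integral_finsetSum _ fun q _ => integrable_finsetSum _ fun _ _ =>
    (integrable_prod_affine_mul_prod_affine _ _ _ _).const_mul _]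
  simp_rw [integral_finsetSum _ fun _ _ =>
    (integrable_prod_affine_mul_prod_affine _ _ _ _).const_mul _]
  rw [Finset.sum_congr rfl fun q hq => Finset.sum_congr rfl (hterm q hq)]
  simp_rw [← Finset.mul_sum]
  rw [sum_sum_mul_sum_powerset_inter,
    sum_pow_card_mul_sum_filter_subset_sq hk fun V => g V * signProd z V]

end PartitionPolynomial

section GuidingVector

variable {n k ℓ c : ℕ}

/-- The density with respect to the standard Gaussian measure of its translate by `τ z_S` in the
coordinates `S` of cardinality `k`. -/
noncomputable def plantedTilt (k : ℕ) (z : Fin n → ℝ) (τ : ℝ) (y : Finset (Fin n) → ℝ) : ℝ :=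
  tiltWeight (level (Fin n) k) (fun S => τ * signProd z S) y

theorem plantedTilt_pos (z : Fin n → ℝ) (τ : ℝ) (y : Finset (Fin n) → ℝ) :
    0 < plantedTilt k z τ y :=
  tiltWeight_pos _ _ y

theorem continuous_plantedTilt (z : Fin n → ℝ) (τ : ℝ) : Continuous (plantedTilt k z τ) :=
  continuous_tiltWeight _ _

theorem plantedTilt_congr {z : Fin n → ℝ} {τ : ℝ} {y y' : Finset (Fin n) → ℝ}
    (h : ∀ S ∈ level (Fin n) k, y S = y' S) : plantedTilt k z τ y = plantedTilt k z τ y' := by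
  unfold plantedTilt tiltWeight
  exact Finset.prod_congr rfl fun S hS => by rw [h S hS]

theorem sum_level_mul_signProd_sq {z : Fin n → ℝ} (hz : ∀ i, z i = 1 ∨ z i = -1) (τ : ℝ) :
    ∑ S ∈ level (Fin n) k, (τ * signProd z S) ^ 2 = n.choose k * τ ^ 2 := by
  simp_rw [mul_pow, signProd_sq hz, mul_one]
  rw [Finset.sum_const, Finset.card_powersetCard, Finset.card_univ, Fintype.card_fin, nsmul_eq_mul]

theorem integrable_plantedTilt_sq (z : Fin n → ℝ) (τ : ℝ) :
    Integrable (fun y => plantedTilt k z τ y ^ 2) (gaussPi (Finset (Fin n))) :=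
  integrable_tiltWeight_sq _ _

theorem integral_plantedTilt_sq {z : Fin n → ℝ} (hz : ∀ i, z i = 1 ∨ z i = -1) (τ : ℝ) :
    ∫ y, plantedTilt k z τ y ^ 2 ∂gaussPi (Finset (Fin n)) = Real.exp (n.choose k * τ ^ 2) := by
  rw [← sum_level_mul_signProd_sq hz]
  exact integral_tiltWeight_sq _ _

theorem integrable_plantedTilt_inv (z : Fin n → ℝ) (τ : ℝ) :
    Integrable (fun y => (plantedTilt k z τ y)⁻¹) (gaussPi (Finset (Fin n))) :=
  integrable_tiltWeight_inv _ _

theorem integral_plantedTilt_inv {z : Fin n → ℝ} (hz : ∀ i, z i = 1 ∨ z i = -1) (τ : ℝ) :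
    ∫ y, (plantedTilt k z τ y)⁻¹ ∂gaussPi (Finset (Fin n)) = Real.exp (n.choose k * τ ^ 2) := by
  rw [← sum_level_mul_signProd_sq hz]
  exact integral_tiltWeight_inv _ _

/-- The guiding vector of a family `t` of entries indexed by the `k`-element sets. -/
noncomputable def guidingOf (k ℓ : ℕ) (t : Finset (Fin n) → ℝ) : EuclideanSpace ℝ (Sub n ℓ) :=
  WithLp.toLp 2 fun V =>
    (1 / √((n.choose ℓ : ℝ) * (numParts k ℓ : ℝ))) * ∑ P ∈ parts k V.1, ∏ S ∈ P, t S

theorem guidingVector_eq_guidingOf (T : Tensor n k) :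
    guidingVector ℓ T = guidingOf k ℓ (entry T) := rfl

theorem guidingOf_congr {t t' : Finset (Fin n) → ℝ} (h : ∀ S ∈ level (Fin n) k, t S = t' S) :
    guidingOf k ℓ t = guidingOf k ℓ t' := by
  ext V
  exact congrArg _ <| Finset.sum_congr rfl fun P hP => Finset.prod_congr rfl fun S hS =>
    h S (Finset.mem_powersetCard_univ.2 (card_of_mem_parts hP hS))

theorem continuous_guidingOf : Continuous (guidingOf (n := n) k ℓ) := by
  unfold guidingOf
  refine (PiLp.continuous_toLp 2 _).comp ?_
  fun_prop

/-- The extension by zero to all sets of a vector indexed by the `ℓ`-element sets. -/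
noncomputable def extendZero (v : EuclideanSpace ℝ (Sub n ℓ)) (V : Finset (Fin n)) : ℝ :=
  if h : V.card = ℓ then v ⟨V, h⟩ else 0

theorem extendZero_coe (v : EuclideanSpace ℝ (Sub n ℓ)) (V : Sub n ℓ) :
    extendZero v V.1 = v V :=
  dif_pos V.2

theorem inner_guidingOf (v : EuclideanSpace ℝ (Sub n ℓ)) (t : Finset (Fin n) → ℝ) :
    inner ℝ v (guidingOf k ℓ t)
      = (1 / √((n.choose ℓ : ℝ) * (numParts k ℓ : ℝ))) * partitionPoly k ℓ (extendZero v) t := by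
  rw [PiLp.inner_apply, partitionPoly, ← sum_sub_eq, Finset.mul_sum]
  refine Finset.sum_congr rfl fun V _ => ?_
  rw [extendZero_coe]
  simp only [guidingOf, RCLike.inner_apply, conj_trivial]
  ring

theorem inner_plantedVec (v : EuclideanSpace ℝ (Sub n ℓ)) (z : Fin n → ℝ) :
    inner ℝ (plantedVec ℓ z) v
      = (∑ V ∈ level (Fin n) ℓ, extendZero v V * signProd z V) / √(n.choose ℓ) := by
  rw [PiLp.inner_apply, ← sum_sub_eq, Finset.sum_div]
  refine Finset.sum_congr rfl fun V _ => ?_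
  rw [extendZero_coe]
  simp only [plantedVec, RCLike.inner_apply, conj_trivial]
  ring

theorem norm_sq_eq_sum_level (v : EuclideanSpace ℝ (Sub n ℓ)) {z : Fin n → ℝ}
    (hz : ∀ i, z i = 1 ∨ z i = -1) :
    ‖v‖ ^ 2 = ∑ V ∈ level (Fin n) ℓ, (extendZero v V * signProd z V) ^ 2 := by
  rw [EuclideanSpace.norm_sq_eq, ← sum_sub_eq]
  refine Finset.sum_congr rfl fun V _ => ?_
  rw [extendZero_coe, mul_pow, signProd_sq hz, mul_one, Real.norm_eq_abs, sq_abs]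

theorem sum_supersetSum_extendZero_sq_le (hk : 0 < k) (hc : 0 < c) (hn : c * k ≤ n)
    {z : Fin n → ℝ} (hz : ∀ i, z i = 1 ∨ z i = -1) {v : EuclideanSpace ℝ (Sub n (c * k))}
    (hv : ‖v‖ ≤ 1) {j : ℕ} (hj : j ≤ c) :
    ∑ W ∈ level (Fin n) (j * k),
        supersetSum (c * k) (fun V => extendZero v V * signProd z V) W ^ 2
      ≤ ((n - j * k).choose (c * k - j * k) * (c * k).choose (j * k)) *
        ((inner ℝ (plantedVec (c * k) z) v : ℝ) ^ 2 + j / c) := by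
  have hJ := sum_supersetSum_sq_le (Nat.mul_le_mul_right k hj)
    (by rwa [Fintype.card_fin]) (Nat.mul_pos hc hk) fun V => extendZero v V * signProd z V
  rw [← norm_sq_eq_sum_level v hz, Fintype.card_fin] at hJ
  refine hJ.trans (mul_le_mul_of_nonneg_left ?_ (by positivity))
  rw [inner_plantedVec, div_pow, Real.sq_sqrt (Nat.cast_nonneg _), Nat.cast_mul, Nat.cast_mul,
    mul_div_mul_right _ _ (Nat.cast_ne_zero.2 hk.ne')]
  gcongr
  exact mul_le_of_le_one_right (by positivity) (pow_le_one₀ (norm_nonneg _) hv)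

/-- The contribution of the degree-`j` part of the noise to the second moment of the overlap with
the guiding vector, relative to that of the signal; `ρ` is the noise-to-signal ratio. -/
noncomputable def chaosWeight (n k c : ℕ) (ρ : ℝ) (j : ℕ) : ℝ :=
  ρ ^ j * (c.choose j : ℝ) ^ 2 / (numParts k (j * k) * n.choose (j * k))

theorem choose_mul_numParts_sq_mul_chaosWeight (hk : 0 < k) (hn : c * k ≤ n) (ρ : ℝ) {j : ℕ}
    (hj : j ≤ c) :
    (n.choose (c * k) * (numParts k (c * k) : ℝ) ^ 2) * chaosWeight n k c ρ j
      = ρ ^ j * numParts k (j * k) * (numParts k ((c - j) * k) : ℝ) ^ 2 *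
        ((n - j * k).choose (c * k - j * k) * (c * k).choose (j * k)) := by
  have hjk := Nat.mul_le_mul_right k hj
  have hnj : (0 : ℝ) < n.choose (j * k) := mod_cast Nat.choose_pos (hjk.trans hn)
  have hpj := numParts_pos hk j
  have hparts := choose_mul_numParts_mul_numParts hk hj
  rw [chaosWeight, mul_div_assoc', div_eq_iff (by positivity)]
  calc n.choose (c * k) * (numParts k (c * k) : ℝ) ^ 2 * (ρ ^ j * (c.choose j : ℝ) ^ 2)
      = ρ ^ j * n.choose (c * k) * (c.choose j * numParts k (c * k)) ^ 2 := by ring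
    _ = ρ ^ j * numParts k (j * k) ^ 2 * (numParts k ((c - j) * k) : ℝ) ^ 2 *
          (c * k).choose (j * k) * (n.choose (c * k) * (c * k).choose (j * k)) := by
        rw [← hparts]
        ring
    _ = _ := by
        rw [← cast_choose_mul_choose hjk]
        ring

theorem integrable_inner_guidingOf_sq (β s : ℝ) (z : Fin n → ℝ)
    (v : EuclideanSpace ℝ (Sub n ℓ)) :
    Integrable (fun y => (inner ℝ v (guidingOf k ℓ (noisy β z s y)) : ℝ) ^ 2)
      (gaussPi (Finset (Fin n))) := by
  simp_rw [inner_guidingOf, mul_pow]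
  exact (integrable_partitionPoly_noisy_sq β s z _).const_mul _

theorem integral_inner_guidingOf_sq_le (hk : 0 < k) (hc : 0 < c) (hn : c * k ≤ n)
    {z : Fin n → ℝ} (hz : ∀ i, z i = 1 ∨ z i = -1) {β : ℝ} (hβ : β ≠ 0) (s : ℝ)
    {v : EuclideanSpace ℝ (Sub n (c * k))} (hv : ‖v‖ ≤ 1) :
    ∫ y, (inner ℝ v (guidingOf k (c * k) (noisy β z s y)) : ℝ) ^ 2 ∂gaussPi (Finset (Fin n))
      ≤ β ^ (2 * c) * numParts k (c * k) * ∑ j ∈ Finset.range (c + 1),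
          chaosWeight n k c (s ^ 2 / β ^ 2) j *
            ((inner ℝ (plantedVec (c * k) z) v : ℝ) ^ 2 + j / c) := by
  have hN : (0 : ℝ) < n.choose (c * k) := mod_cast Nat.choose_pos hn
  have hp := numParts_pos hk c
  have hβc : 0 ≤ β ^ (2 * c) := (even_two_mul c).pow_nonneg β
  simp_rw [inner_guidingOf, mul_pow]
  rw [integral_const_mul, integral_partitionPoly_noisy_sq hk hz hβ, div_pow, one_pow,
    Real.sq_sqrt (by positivity), one_div, inv_mul_le_iff₀ (by positivity), ← mul_assoc,
    mul_left_comm, mul_assoc (β ^ (2 * c))]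
  refine mul_le_mul_of_nonneg_left ?_ hβc
  rw [mul_assoc (n.choose (c * k) : ℝ), ← pow_two, Finset.mul_sum]
  refine Finset.sum_le_sum fun j hj => ?_
  have hjc := Finset.mem_range_succ_iff.1 hj
  rw [← mul_assoc, choose_mul_numParts_sq_mul_chaosWeight hk hn _ hjc, mul_assoc _ (_ * _)]
  exact mul_le_mul_of_nonneg_left (sum_supersetSum_extendZero_sq_le hk hc hn hz hv hjc)
    (by positivity)

theorem integrable_plantedTilt_mul_inner_guidingOf (β s τ : ℝ) (z : Fin n → ℝ)
    (v : EuclideanSpace ℝ (Sub n ℓ)) :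
    Integrable (fun y => plantedTilt k z τ y * inner ℝ v (guidingOf k ℓ (noisy β z s y)))
      (gaussPi (Finset (Fin n))) := by
  simp_rw [inner_guidingOf, mul_left_comm]
  exact (integrable_tiltWeight_mul_partitionPoly_noisy β s z _ _).const_mul _

theorem integral_plantedTilt_mul_inner_guidingOf (hk : 0 < k) (hn : c * k ≤ n) (β s τ : ℝ)
    (z : Fin n → ℝ) (v : EuclideanSpace ℝ (Sub n (c * k))) :
    ∫ y, plantedTilt k z τ y * inner ℝ v (guidingOf k (c * k) (noisy β z s y))
        ∂gaussPi (Finset (Fin n))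
      = (β + s * τ) ^ c * √(numParts k (c * k)) * inner ℝ (plantedVec (c * k) z) v := by
  have hN : (0 : ℝ) < n.choose (c * k) := mod_cast Nat.choose_pos hn
  have hp := numParts_pos hk c
  simp_rw [inner_guidingOf, mul_left_comm, plantedTilt]
  rw [integral_const_mul, integral_tiltWeight_mul_partitionPoly_noisy hk, inner_plantedVec,
    Real.sqrt_mul hN.le]
  field_simp
  rw [Real.sq_sqrt hp.le]
  ring

theorem inner_guidingOf_sub_sq (L β s τ : ℝ) (z : Fin n → ℝ) (v : EuclideanSpace ℝ (Sub n ℓ))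
    (y : Finset (Fin n) → ℝ) :
    (inner ℝ v (guidingOf k ℓ (noisy β z s y)) - L * plantedTilt k z τ y) ^ 2
      = inner ℝ v (guidingOf k ℓ (noisy β z s y)) ^ 2
        - 2 * L * (plantedTilt k z τ y * inner ℝ v (guidingOf k ℓ (noisy β z s y)))
        + L ^ 2 * plantedTilt k z τ y ^ 2 := by
  ring

theorem integrable_inner_guidingOf_sub_sq (L β s τ : ℝ) (z : Fin n → ℝ)
    (v : EuclideanSpace ℝ (Sub n ℓ)) :
    Integrable (fun y =>
      (inner ℝ v (guidingOf k ℓ (noisy β z s y)) - L * plantedTilt k z τ y) ^ 2)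
      (gaussPi (Finset (Fin n))) := by
  simp_rw [inner_guidingOf_sub_sq]
  exact ((integrable_inner_guidingOf_sq β s z v).sub
    ((integrable_plantedTilt_mul_inner_guidingOf β s τ z v).const_mul _)).add
    ((integrable_plantedTilt_sq z τ).const_mul _)

theorem integral_inner_guidingOf_sub_sq_le (hk : 0 < k) (hc : 0 < c) (hn : c * k ≤ n)
    {z : Fin n → ℝ} (hz : ∀ i, z i = 1 ∨ z i = -1) {β : ℝ} (hβ : β ≠ 0) (s τ : ℝ)
    {v : EuclideanSpace ℝ (Sub n (c * k))} (hv : ‖v‖ ≤ 1) :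
    ∫ y, (inner ℝ v (guidingOf k (c * k) (noisy β z s y))
        - β ^ c * √(numParts k (c * k)) * inner ℝ (plantedVec (c * k) z) v *
          plantedTilt k z τ y) ^ 2 ∂gaussPi (Finset (Fin n))
      ≤ β ^ (2 * c) * numParts k (c * k) * ((∑ j ∈ Finset.range (c + 1),
          chaosWeight n k c (s ^ 2 / β ^ 2) j *
            ((inner ℝ (plantedVec (c * k) z) v : ℝ) ^ 2 + j / c))
          - 2 * (inner ℝ (plantedVec (c * k) z) v : ℝ) ^ 2 * (1 + s * τ / β) ^ c
          + (inner ℝ (plantedVec (c * k) z) v : ℝ) ^ 2 * Real.exp (n.choose k * τ ^ 2)) := by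
  have hshift : (β + s * τ) ^ c = β ^ c * (1 + s * τ / β) ^ c := by
    rw [← mul_pow, mul_add, mul_one, mul_div_cancel₀ _ hβ]
  have hp := Real.sq_sqrt (numParts_pos hk c).le
  have hsq := integrable_inner_guidingOf_sq (k := k) β s z v
  have hcross := (integrable_plantedTilt_mul_inner_guidingOf (k := k) β s τ z v).const_mul
    (2 * (β ^ c * √(numParts k (c * k)) * inner ℝ (plantedVec (c * k) z) v))
  have hsecond := integral_inner_guidingOf_sq_le hk hc hn hz hβ s hv
  simp_rw [inner_guidingOf_sub_sq]
  refine (integral_add (hsq.sub hcross)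
    ((integrable_plantedTilt_sq z τ).const_mul _)).trans_le ?_
  rw [integral_sub' hsq hcross, integral_const_mul, integral_const_mul,
    integral_plantedTilt_mul_inner_guidingOf hk hn, integral_plantedTilt_sq hz, hshift]
  linear_combination hsecond + (β ^ (2 * c) * (inner ℝ (plantedVec (c * k) z) v : ℝ) ^ 2 *
    (Real.exp (n.choose k * τ ^ 2) - 2 * (1 + s * τ / β) ^ c)) * hp

theorem norm_guidingOf_sq (t : Finset (Fin n) → ℝ) :
    ‖guidingOf k ℓ t‖ ^ 2 = ∑ V : Sub n ℓ, (1 / ((n.choose ℓ : ℝ) * numParts k ℓ)) *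
      partitionPoly k ℓ (Pi.single V.1 1) t ^ 2 := by
  rw [EuclideanSpace.norm_sq_eq]
  refine Finset.sum_congr rfl fun V _ => ?_
  rw [partitionPoly, Finset.sum_eq_single_of_mem V.1 (Finset.mem_powersetCard_univ.2 V.2)
    fun U _ hU => by rw [Pi.single_eq_of_ne hU, zero_mul], Pi.single_eq_same, one_mul,
    Real.norm_eq_abs, sq_abs, guidingOf, mul_pow, div_pow, one_pow, Real.sq_sqrt (by positivity)]

theorem integral_partitionPoly_single_noisy_sq (hk : 0 < k) {z : Fin n → ℝ}
    (hz : ∀ i, z i = 1 ∨ z i = -1) {β : ℝ} (hβ : β ≠ 0) (s : ℝ) {V : Finset (Fin n)}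
    (hV : V.card = c * k) :
    ∫ y, partitionPoly k (c * k) (Pi.single V 1) (noisy β z s y) ^ 2 ∂gaussPi (Finset (Fin n))
      = numParts k (c * k) * (β ^ (2 * c) * ∑ j ∈ Finset.range (c + 1),
          (s ^ 2 / β ^ 2) ^ j * c.choose j * numParts k ((c - j) * k)) := by
  have hsingle : (fun U => (Pi.single V 1 : Finset (Fin n) → ℝ) U * signProd z U)
      = Pi.single V (signProd z V) := by
    rw [← one_mul (signProd z V), Pi.single_mul_left]
    rfl
  rw [integral_partitionPoly_noisy_sq hk hz hβ, hsingle, mul_left_comm]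
  refine congrArg (β ^ (2 * c) * ·) ?_
  rw [Finset.mul_sum]
  refine Finset.sum_congr rfl fun j hj => ?_
  rw [← hV, sum_supersetSum_single_sq, signProd_sq hz, hV]
  linear_combination ((s ^ 2 / β ^ 2) ^ j * numParts k ((c - j) * k)) *
    choose_mul_numParts_mul_numParts hk (Finset.mem_range_succ_iff.1 hj)

theorem integrable_norm_guidingOf_sq (β s : ℝ) (z : Fin n → ℝ) :
    Integrable (fun y => ‖guidingOf k ℓ (noisy β z s y)‖ ^ 2) (gaussPi (Finset (Fin n))) := by
  simp_rw [norm_guidingOf_sq]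
  exact integrable_finsetSum _ fun V _ => (integrable_partitionPoly_noisy_sq β s z _).const_mul _

theorem integral_norm_guidingOf_sq (hk : 0 < k) (hn : c * k ≤ n) {z : Fin n → ℝ}
    (hz : ∀ i, z i = 1 ∨ z i = -1) {β : ℝ} (hβ : β ≠ 0) (s : ℝ) :
    ∫ y, ‖guidingOf k (c * k) (noisy β z s y)‖ ^ 2 ∂gaussPi (Finset (Fin n))
      = β ^ (2 * c) * ∑ j ∈ Finset.range (c + 1),
          (s ^ 2 / β ^ 2) ^ j * c.choose j * numParts k ((c - j) * k) := by
  have hN : (0 : ℝ) < n.choose (c * k) := mod_cast Nat.choose_pos hn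
  have hp := numParts_pos hk c
  simp_rw [norm_guidingOf_sq]
  rw [integral_finsetSum _ fun V _ => (integrable_partitionPoly_noisy_sq β s z _).const_mul _]
  simp_rw [integral_const_mul]
  rw [Finset.sum_congr rfl fun V _ => by
      rw [integral_partitionPoly_single_noisy_sq hk hz hβ s V.2],
    Finset.sum_const, Finset.card_univ, Fintype.card_finset_len, Fintype.card_fin, nsmul_eq_mul]
  field_simp

end GuidingVector

section Estimates

variable {n k c : ℕ}

theorem descFactorial_pow_le_descFactorial_mul {m j : ℕ} (hj : j * k + m ≤ n + k) :
    m.descFactorial k ^ j ≤ n.descFactorial (j * k) := by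
  induction j with
  | zero => simp only [pow_zero, zero_mul, Nat.descFactorial_zero, le_refl]
  | succ j ih =>
    rw [Nat.succ_mul] at hj
    rw [← Nat.descFactorial_mul_descFactorial (n := n) (k := j * k) (m := (j + 1) * k)
      (Nat.mul_le_mul_right k (Nat.le_succ j)), pow_succ, mul_comm, Nat.succ_mul,
      Nat.add_sub_cancel_left]
    exact Nat.mul_le_mul (Nat.descFactorial_le k (by omega)) (ih (by omega))

theorem chaosWeight_le (hk : 0 < k) {ρ : ℝ} (hρ : 0 ≤ ρ) {m : ℕ} (hm : k ≤ m)
    (hn : c * k + m ≤ n) {j : ℕ} (hj : j ≤ c) :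
    chaosWeight n k c ρ j ≤ (c ^ 2 * ρ / m.choose k) ^ j / j.factorial := by
  have hjk := Nat.mul_le_mul_right k hj
  have hm0 : (0 : ℝ) < m.choose k := mod_cast Nat.choose_pos hm
  have hden : (numParts k (j * k) : ℝ) * n.choose (j * k)
      = n.descFactorial (j * k) / (k.factorial ^ j * j.factorial) := by
    rw [numParts_eq_div hk, Nat.descFactorial_eq_factorial_mul_choose, Nat.cast_mul]
    ring
  have hdesc : ((k.factorial : ℝ) * m.choose k) ^ j ≤ n.descFactorial (j * k) := by
    have h := descFactorial_pow_le_descFactorial_mul (n := n) (k := k) (m := m) (j := j) (by omega)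
    rw [Nat.descFactorial_eq_factorial_mul_choose] at h
    exact_mod_cast h
  rw [chaosWeight, hden]
  calc ρ ^ j * (c.choose j : ℝ) ^ 2 / (n.descFactorial (j * k) / (k.factorial ^ j * j.factorial))
      ≤ ρ ^ j * ((c : ℝ) ^ j / j.factorial) ^ 2 /
        (((k.factorial : ℝ) * m.choose k) ^ j / (k.factorial ^ j * j.factorial)) := by
        gcongr
        exact Nat.choose_le_pow_div j c
    _ = (c ^ 2 * ρ / m.choose k) ^ j / j.factorial := by
        simp only [div_pow, mul_pow]
        field_simp
        ring

theorem sum_range_mul_pow_div_factorial_le {x : ℝ} (hx : 0 ≤ x) (c : ℕ) :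
    ∑ j ∈ Finset.range (c + 1), (j : ℝ) * (x ^ j / j.factorial) ≤ x * Real.exp x := by
  have hterm (j : ℕ) : ((j + 1 : ℕ) : ℝ) * (x ^ (j + 1) / (j + 1).factorial)
      = x * (x ^ j / j.factorial) := by
    rw [Nat.factorial_succ, Nat.cast_mul]
    field_simp
    ring
  rw [Finset.sum_range_succ', Nat.cast_zero, zero_mul, add_zero]
  simp_rw [hterm, ← Finset.mul_sum]
  exact mul_le_mul_of_nonneg_left (Real.sum_le_exp_of_nonneg hx _) hx

theorem sum_chaosWeight_le (hk : 0 < k) {ρ : ℝ} (hρ : 0 ≤ ρ) {m : ℕ} (hm : k ≤ m)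
    (hn : c * k + m ≤ n) (a : ℝ) :
    ∑ j ∈ Finset.range (c + 1), chaosWeight n k c ρ j * (a ^ 2 + j / c)
      ≤ a ^ 2 * Real.exp (c ^ 2 * ρ / m.choose k)
        + (c ^ 2 * ρ / m.choose k) * Real.exp (c ^ 2 * ρ / m.choose k) / c := by
  set x : ℝ := c ^ 2 * ρ / m.choose k
  have hx : 0 ≤ x := by positivity
  calc ∑ j ∈ Finset.range (c + 1), chaosWeight n k c ρ j * (a ^ 2 + j / c)
      ≤ ∑ j ∈ Finset.range (c + 1), x ^ j / j.factorial * (a ^ 2 + j / c) :=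
        Finset.sum_le_sum fun j hj => mul_le_mul_of_nonneg_right
          (chaosWeight_le hk hρ hm hn (Finset.mem_range_succ_iff.1 hj)) (by positivity)
    _ = a ^ 2 * ∑ j ∈ Finset.range (c + 1), x ^ j / j.factorial
        + (∑ j ∈ Finset.range (c + 1), (j : ℝ) * (x ^ j / j.factorial)) / c := by
        rw [Finset.mul_sum, Finset.sum_div, ← Finset.sum_add_distrib]
        exact Finset.sum_congr rfl fun j _ => by ring
    _ ≤ a ^ 2 * Real.exp x + x * Real.exp x / c := by
        gcongr
        · exact Real.sum_le_exp_of_nonneg hx _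
        · exact sum_range_mul_pow_div_factorial_le hx c

theorem exp_sub_sq_div_two_le_one_add {y : ℝ} (hy : 0 ≤ y) :
    Real.exp (y - y ^ 2 / 2) ≤ 1 + y := by
  rw [← Real.le_log_iff_exp_le (by positivity)]
  refine le_trans ?_ (Real.le_log_one_add_of_nonneg hy)
  rw [le_div_iff₀ (by positivity)]
  nlinarith [pow_nonneg hy 3]

theorem exp_mul_le_one_add_pow {y : ℝ} (hy : 0 ≤ y) (c : ℕ) :
    Real.exp (c * y) * (1 - c * y * y / 2) ≤ (1 + y) ^ c := by
  calc Real.exp (c * y) * (1 - c * y * y / 2)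
      ≤ Real.exp (c * y) * Real.exp (-(c * y * y / 2)) := by
        gcongr
        exact Real.one_sub_le_exp_neg _
    _ = Real.exp (y - y ^ 2 / 2) ^ c := by
        rw [← Real.exp_add, ← Real.exp_nat_mul]
        ring_nf
    _ ≤ (1 + y) ^ c := pow_le_pow_left₀ (Real.exp_pos _).le (exp_sub_sq_div_two_le_one_add hy) c

/-- The bound on the relative mean-square distance of the overlap with the guiding vector to its
log-normal approximation: `x` is the log-variance of the latter, `x'` that of an upper bound on the
second moment of the former. -/
noncomputable def deviationBound (c : ℕ) (x x' : ℝ) : ℝ :=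
  (Real.exp x' - Real.exp x) + x * (x / c) * Real.exp x + x' * Real.exp x' / c

theorem deviationBound_mono {x x' x'' : ℝ} (hx' : 0 ≤ x') (h : x' ≤ x'') :
    deviationBound c x x' ≤ deviationBound c x x'' := by
  have hx'' : 0 ≤ x'' := hx'.trans h
  unfold deviationBound
  gcongr

theorem deviation_le_deviationBound (hc : 0 < c) {a x x' : ℝ} (ha : a ^ 2 ≤ 1) (hx : 0 ≤ x)
    (hxx : x ≤ x') :
    a ^ 2 * Real.exp x' + x' * Real.exp x' / c - 2 * a ^ 2 * (1 + x / c) ^ c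
        + a ^ 2 * Real.exp x ≤ deviationBound c x x' := by
  have hpow := exp_mul_le_one_add_pow (div_nonneg hx (Nat.cast_nonneg c)) c
  rw [mul_div_cancel₀ x (Nat.cast_ne_zero.2 hc.ne')] at hpow
  have hexp := Real.exp_le_exp.2 hxx
  have hpos : 0 ≤ (Real.exp x' - Real.exp x) + x * (x / c) * Real.exp x :=
    add_nonneg (sub_nonneg.2 hexp) (by positivity)
  have hbracket : Real.exp x' + Real.exp x - 2 * (1 + x / c) ^ c
      ≤ (Real.exp x' - Real.exp x) + x * (x / c) * Real.exp x := by
    linarith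
  have hsq := (mul_le_mul_of_nonneg_left hbracket (sq_nonneg a)).trans
    (mul_le_of_le_one_left hpos ha)
  unfold deviationBound
  linarith

theorem pow_self_div_factorial_sq_le (m : ℕ) :
    (m : ℝ) ^ m / (m.factorial : ℝ) ^ 2 ≤ 3 ^ m := by
  calc (m : ℝ) ^ m / (m.factorial : ℝ) ^ 2 ≤ (m : ℝ) ^ m / m.factorial := by
        gcongr
        exact le_self_pow₀ (mod_cast Nat.factorial_pos m) two_ne_zero
    _ ≤ Real.exp m := Real.pow_div_factorial_le_exp _ (Nat.cast_nonneg m) m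
    _ = Real.exp 1 ^ m := by rw [← Real.exp_nat_mul, mul_one]
    _ ≤ 3 ^ m := by
        gcongr
        exact Real.exp_one_lt_three.le

theorem numParts_le (hk : 0 < k) (m : ℕ) :
    (numParts k (m * k) : ℝ) ≤ ((m : ℝ) * k) ^ (m * k) / m.factorial := by
  rw [numParts_eq_div hk]
  gcongr
  · exact_mod_cast Nat.factorial_le_pow (m * k)
  · exact le_mul_of_one_le_left (Nat.cast_nonneg _)
      (one_le_pow₀ (mod_cast Nat.factorial_pos k))

theorem pow_mul_choose_mul_numParts_le (hk : 0 < k) {β : ℝ}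
    (hβ : β ^ 2 * ((c * k : ℕ) : ℝ) ^ k ≤ 1 / 100) {m : ℕ} (hm : m ≤ c) (hc : 0 < c) :
    (β ^ 2) ^ m * c.choose m * numParts k (m * k) ≤ (1 / 2) ^ m := by
  have : (0 : ℝ) < k := mod_cast hk
  have hc0 : (0 : ℝ) < c := mod_cast hc
  have hβ' : β ^ 2 ≤ 1 / 100 / ((c : ℝ) * k) ^ k := by
    rw [le_div_iff₀ (by positivity)]
    exact_mod_cast hβ
  have hratio : ((m : ℝ) / c) ^ (m * k) ≤ ((m : ℝ) / c) ^ m :=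
    pow_le_pow_of_le_one (by positivity) ((div_le_one hc0).2 (mod_cast hm))
      (Nat.le_mul_of_pos_right m hk)
  calc (β ^ 2) ^ m * c.choose m * numParts k (m * k)
      ≤ (1 / 100 / ((c : ℝ) * k) ^ k) ^ m * (c ^ m / m.factorial) *
        (((m : ℝ) * k) ^ (m * k) / m.factorial) := by
        gcongr
        · exact Nat.choose_le_pow_div m c
        · exact numParts_le hk m
    _ = (1 / 100) ^ m * (c : ℝ) ^ m / (m.factorial : ℝ) ^ 2 * ((m : ℝ) / c) ^ (m * k) := by
        simp only [div_pow, mul_pow, ← pow_mul, mul_comm m k]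
        field_simp
    _ ≤ (1 / 100) ^ m * (c : ℝ) ^ m / (m.factorial : ℝ) ^ 2 * ((m : ℝ) / c) ^ m := by gcongr
    _ = (1 / 100) ^ m * ((m : ℝ) ^ m / (m.factorial : ℝ) ^ 2) := by
        rw [div_pow (m : ℝ)]
        field_simp
    _ ≤ (1 / 100) ^ m * 3 ^ m := by
        gcongr
        exact pow_self_div_factorial_sq_le m
    _ ≤ (1 / 2) ^ m := by
        rw [← mul_pow]
        gcongr
        norm_num

theorem sum_choose_mul_numParts_le (hk : 0 < k) (hc : 0 < c) {β s : ℝ} (hβ0 : β ≠ 0)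
    (hβ : β ^ 2 * ((c * k : ℕ) : ℝ) ^ k ≤ 1 / 100) (hs : 1 ≤ s ^ 2) :
    β ^ (2 * c) * ∑ j ∈ Finset.range (c + 1),
        (s ^ 2 / β ^ 2) ^ j * c.choose j * numParts k ((c - j) * k) ≤ 2 * (s ^ 2) ^ c := by
  have hterm : ∀ j ∈ Finset.range (c + 1),
      β ^ (2 * c) * ((s ^ 2 / β ^ 2) ^ j * c.choose j * numParts k ((c - j) * k))
        ≤ (s ^ 2) ^ c * (1 / 2) ^ (c - j) := by
    intro j hj
    have hjc := Finset.mem_range_succ_iff.1 hj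
    have hsplit : β ^ (2 * c) = (β ^ 2) ^ j * (β ^ 2) ^ (c - j) := by
      rw [← pow_add, Nat.add_sub_cancel' hjc, pow_mul]
    calc β ^ (2 * c) * ((s ^ 2 / β ^ 2) ^ j * c.choose j * numParts k ((c - j) * k))
        = (s ^ 2) ^ j * ((β ^ 2) ^ (c - j) * c.choose (c - j) * numParts k ((c - j) * k)) := by
          rw [hsplit, div_pow, Nat.choose_symm hjc]
          field_simp
      _ ≤ (s ^ 2) ^ c * (1 / 2) ^ (c - j) :=
          mul_le_mul (pow_le_pow_right₀ hs hjc)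
            (pow_mul_choose_mul_numParts_le hk hβ (Nat.sub_le c j) hc) (by positivity)
            (by positivity)
  rw [Finset.mul_sum]
  refine (Finset.sum_le_sum hterm).trans ?_
  rw [← Finset.mul_sum, mul_comm, Finset.sum_flip fun j => ((1 : ℝ) / 2) ^ j]
  exact mul_le_mul_of_nonneg_right (sum_geometric_two_le _) (by positivity)

end Estimates

section FixedParameters

theorem measure_ge_le_of_integral_le {Ω : Type*} [MeasurableSpace Ω] {μ : Measure Ω}
    [IsFiniteMeasure μ] {f : Ω → ℝ} (hf : Integrable f μ) (h0 : ∀ x, 0 ≤ f x) {t C : ℝ}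
    (ht : 0 < t) (hC : ∫ x, f x ∂μ ≤ C) : μ {x | t ≤ f x} ≤ ENNReal.ofReal (C / t) := by
  rw [← ofReal_measureReal]
  refine ENNReal.ofReal_le_ofReal ?_
  rw [le_div_iff₀' ht]
  exact (mul_meas_ge_le_integral_of_nonneg (Filter.Eventually.of_forall h0) hf t).trans hC

/-- Some unit vector in the span of the eigenspaces of `K` for the eigenvalues at least `θ` has
squared overlap at least `q` with `Γ`. -/
def HasGuidedVector {ι : Type*} [Fintype ι] [DecidableEq ι] (K : Matrix ι ι ℝ) (θ q : ℝ)
    (Γ : EuclideanSpace ℝ ι) : Prop :=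
  ∃ v ∈ cutoffEigenspace K θ, ‖v‖ = 1 ∧ q ≤ (inner ℝ v Γ) ^ 2

section HasGuidedVector

variable {ι : Type*} [Fintype ι] [DecidableEq ι] {K : Matrix ι ι ℝ} {θ q : ℝ}
  {Γ : EuclideanSpace ℝ ι}

theorem HasGuidedVector.mono (h : HasGuidedVector K θ q Γ) {q' : ℝ} (hq : q' ≤ q) :
    HasGuidedVector K θ q' Γ :=
  let ⟨v, hv, hv1, hle⟩ := h
  ⟨v, hv, hv1, hq.trans hle⟩

theorem hasGuidedVector_of_lt_inner {v : EuclideanSpace ℝ ι} (hv : v ∈ cutoffEigenspace K θ)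
    (hnorm : ‖v‖ ≤ 1) (hq0 : 0 < q) (hq : q < inner ℝ v Γ) {N : ℝ} (hΓ : ‖Γ‖ ^ 2 ≤ N) :
    HasGuidedVector K θ (q ^ 2 / N) (‖Γ‖⁻¹ • Γ) := by
  have hinner := hq0.trans hq
  have hv0 : v ≠ 0 := fun h => hinner.ne' (by rw [h, inner_zero_left])
  have hΓ0 : Γ ≠ 0 := fun h => hinner.ne' (by rw [h, inner_zero_right])
  have hvpos : 0 < ‖v‖ := norm_pos_iff.2 hv0
  have : 0 < ‖Γ‖ := norm_pos_iff.2 hΓ0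
  refine ⟨‖v‖⁻¹ • v, Submodule.smul_mem _ _ hv, norm_smul_inv_norm hv0, ?_⟩
  calc q ^ 2 / N ≤ (inner ℝ v Γ) ^ 2 / ‖Γ‖ ^ 2 := by gcongr
    _ ≤ (‖v‖ ^ 2)⁻¹ * ((inner ℝ v Γ) ^ 2 / ‖Γ‖ ^ 2) :=
        le_mul_of_one_le_left (by positivity)
          ((one_le_inv₀ (by positivity)).2 (pow_le_one₀ hvpos.le hnorm))
    _ = (inner ℝ (‖v‖⁻¹ • v) (‖Γ‖⁻¹ • Γ)) ^ 2 := by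
        rw [real_inner_smul_left, real_inner_smul_right]
        ring

end HasGuidedVector

variable {n k ℓ c : ℕ} {z : Fin n → ℝ} {β s : ℝ}

/-- The squared error of the planted vector as an eigenvector of the Kikuchi matrix for the
eigenvalue `d β`, with `d` the degree of the Kikuchi graph. -/
noncomputable def eigenError (k ℓ : ℕ) (z : Fin n → ℝ) (β : ℝ) (t : Finset (Fin n) → ℝ) : ℝ :=
  ‖Matrix.toEuclideanLin (kikuchiOf k ℓ t) (plantedVec ℓ z)
    - (kikuchiDegree n k ℓ * β) • plantedVec ℓ z‖ ^ 2

theorem eigenError_nonneg (t : Finset (Fin n) → ℝ) : 0 ≤ eigenError k ℓ z β t := sq_nonneg _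

theorem continuous_eigenError : Continuous (eigenError k ℓ z β) := by
  have : Continuous fun t : Finset (Fin n) → ℝ =>
      Matrix.toEuclideanLin (kikuchiOf k ℓ t) (plantedVec ℓ z) :=
    (PiLp.continuous_toLp 2 _).comp (continuous_kikuchiOf.matrix_mulVec continuous_const)
  unfold eigenError
  fun_prop

theorem eigenError_noisy (hk : Even k) (hz : ∀ i, z i = 1 ∨ z i = -1) (β s : ℝ)
    (x : Finset (Fin n) → ℝ) :
    eigenError k ℓ z β (noisy β z s x)
      = s ^ 2 * ‖Matrix.toEuclideanLin (kikuchiOf k ℓ x) (plantedVec ℓ z)‖ ^ 2 := by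
  have hK : kikuchiOf k ℓ (noisy β z s x) = β • kikuchiOf k ℓ (signProd z) + s • kikuchiOf k ℓ x :=
    kikuchiOf_add_smul (signProd z) x β s
  rw [eigenError, hK, map_add, map_smul, map_smul, LinearMap.add_apply, LinearMap.smul_apply,
    LinearMap.smul_apply, toEuclideanLin_kikuchiOf_signProd hz hk, smul_smul, mul_comm β,
    add_sub_cancel_left, norm_smul, mul_pow, Real.norm_eq_abs, sq_abs]

/-- The spectral component of the planted vector near the eigenvalue `d β` of the Kikuchi matrix,
in a window of half-width `b`. -/
noncomputable def plantedWindow (k ℓ : ℕ) (z : Fin n → ℝ) (β b : ℝ) (t : Finset (Fin n) → ℝ) :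
    EuclideanSpace ℝ (Sub n ℓ) :=
  windowVec (kikuchiOf k ℓ t) (kikuchiDegree n k ℓ * β) b (plantedVec ℓ z)

theorem continuous_plantedWindow (z : Fin n → ℝ) (β b : ℝ) :
    Continuous (plantedWindow k ℓ z β b) :=
  continuous_windowVec continuous_kikuchiOf kikuchiOf_isHermitian _ b _

theorem norm_plantedWindow_le (hz : ∀ i, z i = 1 ∨ z i = -1) (hℓ : ℓ ≤ n) (β b : ℝ)
    (t : Finset (Fin n) → ℝ) : ‖plantedWindow k ℓ z β b t‖ ≤ 1 :=
  (norm_windowVec_le (kikuchiOf_isHermitian t) _ b _).trans_eq (norm_plantedVec hz hℓ)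

theorem one_sub_le_inner_plantedWindow (hz : ∀ i, z i = 1 ∨ z i = -1) (hℓ : ℓ ≤ n) (β b : ℝ)
    (t : Finset (Fin n) → ℝ) :
    1 - eigenError k ℓ z β t / b ^ 2 ≤ inner ℝ (plantedVec ℓ z) (plantedWindow k ℓ z β b t) := by
  have h := norm_sq_sub_le_inner_windowVec (kikuchiOf_isHermitian (k := k) t)
    (kikuchiDegree n k ℓ * β) b (plantedVec ℓ z)
  rwa [norm_plantedVec hz hℓ, one_pow] at h

theorem measure_eigenError_ge_le (hk : Even k) (hℓ : ℓ ≤ n) (hz : ∀ i, z i = 1 ∨ z i = -1)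
    (β s : ℝ) {b : ℝ} (hb : 0 < b) :
    gaussPi (Finset (Fin n)) {x | b ^ 2 / 2 ≤ eigenError k ℓ z β (noisy β z s x)}
      ≤ ENNReal.ofReal (2 * s ^ 2 * kikuchiDegree n k ℓ / b ^ 2) := by
  have hint : Integrable (fun x => eigenError k ℓ z β (noisy β z s x))
      (gaussPi (Finset (Fin n))) := by
    simp_rw [eigenError_noisy hk hz]
    exact (integrable_norm_sq_toEuclideanLin_kikuchiOf_plantedVec hz).const_mul _
  have hmean : ∫ x, eigenError k ℓ z β (noisy β z s x) ∂gaussPi (Finset (Fin n))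
      = s ^ 2 * kikuchiDegree n k ℓ := by
    simp_rw [eigenError_noisy hk hz]
    rw [integral_const_mul, integral_norm_sq_toEuclideanLin_kikuchiOf_plantedVec hz hk hℓ]
  convert measure_ge_le_of_integral_le hint (fun x => eigenError_nonneg _)
    (half_pos (pow_pos hb 2)) hmean.le using 2
  field_simp

/-- The rate of the exponential tilt whose density approximates the overlap with the guiding
vector; it balances `c * (s * τ / β) = C(n, k) * τ ^ 2`. -/
noncomputable def tiltRate (n k c : ℕ) (β s : ℝ) : ℝ := c * s / (β * n.choose k)

/-- The log-variance `c² v / (β² M)` of the overlap with the guiding vector, `v` being the variance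
of the noise and `M` the number of available `k`-sets. -/
noncomputable def logVariance (c : ℕ) (β v : ℝ) (M : ℕ) : ℝ := c ^ 2 * v / (β ^ 2 * M)

theorem logVariance_nonneg (c : ℕ) (β : ℝ) {v : ℝ} (hv : 0 ≤ v) (M : ℕ) :
    0 ≤ logVariance c β v M := by
  unfold logVariance
  positivity

theorem logVariance_anti (hβ : β ≠ 0) {v : ℝ} (hv : 0 ≤ v) {M M' : ℕ} (hM : 0 < M) (h : M ≤ M') :
    logVariance c β v M' ≤ logVariance c β v M := by
  have : (0 : ℝ) < M := mod_cast hM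
  unfold logVariance
  gcongr

theorem choose_mul_tiltRate_sq (hn : k ≤ n) (c : ℕ) (β s : ℝ) :
    n.choose k * tiltRate n k c β s ^ 2 = logVariance c β (s ^ 2) (n.choose k) := by
  have : (n.choose k : ℝ) ≠ 0 := mod_cast (Nat.choose_pos hn).ne'
  unfold tiltRate logVariance
  field_simp

theorem mul_tiltRate_div (hc : 0 < c) (β s : ℝ) :
    s * tiltRate n k c β s / β = logVariance c β (s ^ 2) (n.choose k) / c := by
  have : (c : ℝ) ≠ 0 := mod_cast hc.ne'
  unfold tiltRate logVariance
  field_simp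

/-- The squared distance of the overlap of `v` with the guiding vector to the log-normal variable
approximating it, as a function of the noise `y`. -/
noncomputable def overlapDeviation (k c : ℕ) (z : Fin n → ℝ) (β s : ℝ)
    (v : EuclideanSpace ℝ (Sub n (c * k))) (y : Finset (Fin n) → ℝ) : ℝ :=
  (inner ℝ v (guidingOf k (c * k) (noisy β z s y))
    - β ^ c * √(numParts k (c * k)) * inner ℝ (plantedVec (c * k) z) v *
      plantedTilt k z (tiltRate n k c β s) y) ^ 2

theorem continuous_overlapDeviation (z : Fin n → ℝ) (β s : ℝ) :
    Continuous fun w : EuclideanSpace ℝ (Sub n (c * k)) × (Finset (Fin n) → ℝ) =>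
      overlapDeviation k c z β s w.1 w.2 := by
  have hΓ : Continuous fun y => guidingOf k (c * k) (noisy β z s y) :=
    continuous_guidingOf.comp (continuous_noisy β z s)
  have hY := continuous_plantedTilt (k := k) z (tiltRate n k c β s)
  exact ((continuous_fst.inner (hΓ.comp continuous_snd)).sub
    ((continuous_const.mul (continuous_const.inner continuous_fst)).mul
      (hY.comp continuous_snd))).pow 2

theorem integral_overlapDeviation_le (hk : 0 < k) (hc : 0 < c) (hn : c * k + k ≤ n)
    (hz : ∀ i, z i = 1 ∨ z i = -1) (hβ : β ≠ 0) (s : ℝ)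
    {v : EuclideanSpace ℝ (Sub n (c * k))} (hv : ‖v‖ ≤ 1) :
    ∫ y, overlapDeviation k c z β s v y ∂gaussPi (Finset (Fin n))
      ≤ β ^ (2 * c) * numParts k (c * k) *
        deviationBound c (logVariance c β (s ^ 2) (n.choose k))
          (logVariance c β (s ^ 2) ((n - c * k).choose k)) := by
  have hoverlap : (inner ℝ (plantedVec (c * k) z) v : ℝ) ^ 2 ≤ 1 := by
    have h := abs_real_inner_le_norm (plantedVec (c * k) z) v
    rw [norm_plantedVec hz (by lia), one_mul] at h
    exact (sq_le_one_iff_abs_le_one _).2 (h.trans hv)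
  have hmean := integral_inner_guidingOf_sub_sq_le hk hc (by lia) hz hβ s (tiltRate n k c β s) hv
  rw [choose_mul_tiltRate_sq (by lia), mul_tiltRate_div hc] at hmean
  have hchaos := sum_chaosWeight_le (n := n) (c := c) hk (ρ := s ^ 2 / β ^ 2) (by positivity)
    (m := n - c * k) (by lia) (by lia) (inner ℝ (plantedVec (c * k) z) v)
  rw [show (c : ℝ) ^ 2 * (s ^ 2 / β ^ 2) / (n - c * k).choose k
    = logVariance c β (s ^ 2) ((n - c * k).choose k) by rw [logVariance]; field_simp] at hchaos
  refine hmean.trans (mul_le_mul_of_nonneg_left ?_ (by rw [pow_mul]; positivity))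
  exact (add_le_add_left (sub_le_sub_right hchaos _) _).trans (deviation_le_deviationBound hc
    hoverlap (logVariance_nonneg _ _ (sq_nonneg s) _) (logVariance_anti hβ (sq_nonneg s)
      (Nat.choose_pos (by lia)) (Nat.choose_le_choose k (Nat.sub_le n _))))

theorem measure_overlapDeviation_ge_le (hk : 0 < k) (hc : 0 < c) (hn : c * k + k ≤ n)
    (hz : ∀ i, z i = 1 ∨ z i = -1) (hβ : β ≠ 0) (s : ℝ)
    {v : EuclideanSpace ℝ (Sub n (c * k))} (hv : ‖v‖ ≤ 1) {η : ℝ} (hη : 0 < η) :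
    gaussPi (Finset (Fin n))
        {y | β ^ (2 * c) * numParts k (c * k) * η ^ 2 ≤ overlapDeviation k c z β s v y}
      ≤ ENNReal.ofReal (deviationBound c (logVariance c β (s ^ 2) (n.choose k))
          (logVariance c β (s ^ 2) ((n - c * k).choose k)) / η ^ 2) := by
  have hp := numParts_pos hk c
  have hA : 0 < β ^ (2 * c) * (numParts k (c * k) : ℝ) := by
    rw [pow_mul]
    positivity
  refine (measure_ge_le_of_integral_le (f := overlapDeviation k c z β s v)
    (integrable_inner_guidingOf_sub_sq _ β s _ z v) (fun y => sq_nonneg _)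
    (mul_pos hA (pow_pos hη 2)) (integral_overlapDeviation_le hk hc hn hz hβ s hv)).trans_eq ?_
  rw [mul_div_mul_left _ _ hA.ne']

theorem measure_plantedTilt_le (hz : ∀ i, z i = 1 ∨ z i = -1) (τ : ℝ) {t : ℝ} (ht : 0 < t) :
    gaussPi (Finset (Fin n)) {y | plantedTilt k z τ y ≤ t}
      ≤ ENNReal.ofReal (t * Real.exp (n.choose k * τ ^ 2)) := by
  convert measure_ge_le_of_integral_le (integrable_plantedTilt_inv (k := k) z τ)
    (fun y => (inv_pos.2 (plantedTilt_pos z τ y)).le) (inv_pos.2 ht)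
    (integral_plantedTilt_inv hz τ).le using 2
  · ext y
    exact (inv_le_inv₀ ht (plantedTilt_pos z τ y)).symm
  · rw [div_inv_eq_mul, mul_comm]

theorem measure_norm_guidingOf_sq_ge_le (hk : 0 < k) (hc : 0 < c) (hn : c * k ≤ n)
    (hz : ∀ i, z i = 1 ∨ z i = -1) (hβ0 : β ≠ 0)
    (hβ : β ^ 2 * ((c * k : ℕ) : ℝ) ^ k ≤ 1 / 100) (hs : 1 ≤ s ^ 2) {r : ℝ} (hr : 0 < r) :
    gaussPi (Finset (Fin n))
        {y | 2 * r * (s ^ 2) ^ c ≤ ‖guidingOf k (c * k) (noisy β z s y)‖ ^ 2}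
      ≤ ENNReal.ofReal (1 / r) := by
  have : 0 < s ^ 2 := one_pos.trans_le hs
  convert measure_ge_le_of_integral_le (integrable_norm_guidingOf_sq β s z)
    (fun y => sq_nonneg _) (t := 2 * r * (s ^ 2) ^ c) (by positivity)
    ((integral_norm_guidingOf_sq hk hn hz hβ0 s).trans_le
      (sum_choose_mul_numParts_le hk hc hβ0 hβ hs)) using 2
  field_simp

/-- The event that one of the four estimates fails, for the noise vectors `x` of `T⁺` and `y` of
`T⁻`, with respective noise levels `s'` and `s`: the planted vector is almost an eigenvector, the
overlap with the guiding vector is almost log-normal, this log-normal variable is not small, and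
the guiding vector is not long. -/
def exceptionalSet (k c : ℕ) (z : Fin n → ℝ) (β s' s b η r : ℝ) :
    Set ((Finset (Fin n) → ℝ) × (Finset (Fin n) → ℝ)) :=
  {w | b ^ 2 / 2 ≤ eigenError k (c * k) z β (noisy β z s' w.1)} ∪
  {w | β ^ (2 * c) * numParts k (c * k) * η ^ 2
    ≤ overlapDeviation k c z β s (plantedWindow k (c * k) z β b (noisy β z s' w.1)) w.2} ∪
  {w | plantedTilt k z (tiltRate n k c β s) w.2 ≤ 4 * η} ∪
  {w | 2 * r * (s ^ 2) ^ c ≤ ‖guidingOf k (c * k) (noisy β z s w.2)‖ ^ 2}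

theorem isClosed_overlapDeviation_ge (z : Fin n → ℝ) (β s' s b t : ℝ) :
    IsClosed {w : (Finset (Fin n) → ℝ) × (Finset (Fin n) → ℝ) | t
      ≤ overlapDeviation k c z β s (plantedWindow k (c * k) z β b (noisy β z s' w.1)) w.2} := by
  have hwindow : Continuous fun w : (Finset (Fin n) → ℝ) × (Finset (Fin n) → ℝ) =>
      (plantedWindow k (c * k) z β b (noisy β z s' w.1), w.2) :=
    ((continuous_plantedWindow z β b).comp
      ((continuous_noisy β z s').comp continuous_fst)).prodMk continuous_snd
  have hdev := (continuous_overlapDeviation z β s).comp hwindow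
  exact isClosed_le continuous_const hdev

theorem isClosed_exceptionalSet (z : Fin n → ℝ) (β s' s b η r : ℝ) :
    IsClosed (exceptionalSet k c z β s' s b η r) := by
  refine ((IsClosed.union ?_ (isClosed_overlapDeviation_ge z β s' s b _)).union ?_).union ?_
  · exact isClosed_le continuous_const (continuous_eigenError.comp
      ((continuous_noisy β z s').comp continuous_fst))
  · exact isClosed_le ((continuous_plantedTilt z _).comp continuous_snd) continuous_const
  · exact isClosed_le continuous_const ((continuous_guidingOf.comp
      ((continuous_noisy β z s).comp continuous_snd)).norm.pow 2)

theorem mem_exceptionalSet_congr {β s' s b η r : ℝ} {x x' y y' : Finset (Fin n) → ℝ}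
    (hx : ∀ S ∈ level (Fin n) k, x S = x' S) (hy : ∀ S ∈ level (Fin n) k, y S = y' S) :
    (x, y) ∈ exceptionalSet k c z β s' s b η r ↔ (x', y') ∈ exceptionalSet k c z β s' s b η r := by
  have hnoisy {σ : ℝ} {u u' : Finset (Fin n) → ℝ} (h : ∀ S ∈ level (Fin n) k, u S = u' S) :
      ∀ S ∈ level (Fin n) k, noisy β z σ u S = noisy β z σ u' S :=
    fun S hS => by rw [noisy, noisy, h S hS]
  simp only [exceptionalSet, Set.mem_union, Set.mem_ofPred_eq, eigenError, plantedWindow,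
    overlapDeviation, kikuchiOf_congr (hnoisy hx), guidingOf_congr (hnoisy hy),
    plantedTilt_congr hy]

theorem hasGuidedVector_of_notMem_exceptionalSet (hk : 0 < k) (hn : c * k ≤ n)
    (hz : ∀ i, z i = 1 ∨ z i = -1) {s' b η r : ℝ} (hβ : 0 < β) (hb : 0 < b) (hη : 0 < η)
    {x y : Finset (Fin n) → ℝ} (h : (x, y) ∉ exceptionalSet k c z β s' s b η r) :
    HasGuidedVector (kikuchiOf k (c * k) (noisy β z s' x)) (kikuchiDegree n k (c * k) * β - b)
      (β ^ (2 * c) * numParts k (c * k) * η ^ 2 / (2 * r * (s ^ 2) ^ c))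
      (‖guidingOf k (c * k) (noisy β z s y)‖⁻¹ • guidingOf k (c * k) (noisy β z s y)) := by
  simp only [exceptionalSet, Set.mem_union, Set.mem_ofPred_eq, not_or, not_le] at h
  obtain ⟨⟨⟨heigen, hdev⟩, htilt⟩, hlong⟩ := h
  have hp := numParts_pos hk c
  have hA : 0 < β ^ c * √(numParts k (c * k)) := by positivity
  have hsq : β ^ (2 * c) * numParts k (c * k) * η ^ 2
      = (β ^ c * √(numParts k (c * k)) * η) ^ 2 := by
    rw [mul_pow, mul_pow, Real.sq_sqrt hp.le, mul_comm 2 c, pow_mul]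
  have hoverlap : 1 / 2 ≤ inner ℝ (plantedVec (c * k) z)
      (plantedWindow k (c * k) z β b (noisy β z s' x)) := by
    refine le_trans ?_ (one_sub_le_inner_plantedWindow hz hn β b _)
    have : eigenError k (c * k) z β (noisy β z s' x) / b ^ 2 ≤ 1 / 2 := by
      rw [div_le_iff₀ (by positivity)]
      linarith
    linarith
  rw [hsq] at hdev ⊢
  refine hasGuidedVector_of_lt_inner
    (windowVec_mem_cutoffEigenspace (kikuchiOf_isHermitian _) _ hb _)
    (norm_plantedWindow_le hz hn β b _) (by positivity) ?_ hlong.le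
  have hlower := (abs_lt.1 (abs_lt_of_sq_lt_sq hdev (by positivity))).1
  have hlog : β ^ c * √(numParts k (c * k)) * (1 / 2 * (4 * η)) ≤ β ^ c * √(numParts k (c * k)) *
      (inner ℝ (plantedVec (c * k) z) (plantedWindow k (c * k) z β b (noisy β z s' x)) *
        plantedTilt k z (tiltRate n k c β s) y) := by
    gcongr
  unfold plantedWindow at *
  linarith

theorem measure_exceptionalSet_le (hk : Even k) (hk0 : 0 < k) (hc : 0 < c) (hn : c * k + k ≤ n)
    (hz : ∀ i, z i = 1 ∨ z i = -1) {s' b η r : ℝ} (hβ0 : β ≠ 0) (hs : 1 ≤ s ^ 2) (hb : 0 < b)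
    (hη : 0 < η) (hr : 0 < r) (hβ : β ^ 2 * ((c * k : ℕ) : ℝ) ^ k ≤ 1 / 100) :
    ((gaussPi (Finset (Fin n))).prod (gaussPi (Finset (Fin n))))
        (exceptionalSet k c z β s' s b η r)
      ≤ ENNReal.ofReal (2 * s' ^ 2 * kikuchiDegree n k (c * k) / b ^ 2) +
        ENNReal.ofReal (deviationBound c (logVariance c β (s ^ 2) (n.choose k))
          (logVariance c β (s ^ 2) ((n - c * k).choose k)) / η ^ 2) +
        ENNReal.ofReal (4 * η * Real.exp (logVariance c β (s ^ 2) (n.choose k))) +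
        ENNReal.ofReal (1 / r) := by
  set μ := gaussPi (Finset (Fin n))
  have hfst {A : Set (Finset (Fin n) → ℝ)} : μ.prod μ (Prod.fst ⁻¹' A) = μ A := by
    rw [← Set.prod_univ, Measure.prod_prod, measure_univ, mul_one]
  have hsnd {A : Set (Finset (Fin n) → ℝ)} : μ.prod μ (Prod.snd ⁻¹' A) = μ A := by
    rw [← Set.univ_prod, Measure.prod_prod, measure_univ, one_mul]
  refine (measure_union_le _ _).trans (add_le_add ((measure_union_le _ _).trans
    (add_le_add ((measure_union_le _ _).trans (add_le_add ?_ ?_)) ?_)) ?_)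
  · exact hfst.trans_le (measure_eigenError_ge_le hk (by lia) hz β s' hb)
  · rw [Measure.prod_apply (isClosed_overlapDeviation_ge z β s' s b _).measurableSet]
    refine (lintegral_mono fun x => measure_overlapDeviation_ge_le hk0 hc hn hz hβ0 s
      (norm_plantedWindow_le hz (by lia) β b (noisy β z s' x)) hη).trans ?_
    rw [lintegral_const, measure_univ, mul_one]
  · rw [← choose_mul_tiltRate_sq (by lia)]
    exact hsnd.trans_le (measure_plantedTilt_le hz _ (by positivity))
  · exact hsnd.trans_le (measure_norm_guidingOf_sq_ge_le hk0 hc (by lia) hz hβ0 hβ hs hr)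

end FixedParameters

section Transfer

variable {n k : ℕ}

theorem prod_orderEmbOfFin_eq_signProd (z : Fin n → ℝ) {S : Finset (Fin n)} (h : S.card = k) :
    ∏ j, z (S.orderEmbOfFin h j) = signProd z S := by
  rw [signProd, ← Finset.prod_coe_sort S]
  exact Fintype.prod_equiv (S.orderIsoOfFin h).toEquiv _ _ fun j => rfl

theorem entry_spiked (β : ℝ) (z : Fin n → ℝ) (G : Tensor n k) {S : Finset (Fin n)}
    (hS : S ∈ level (Fin n) k) : entry (spiked β z G) S = β * signProd z S + entry G S := by
  have h := Finset.mem_powersetCard_univ.1 hS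
  simp only [entry, h, dite_true, spiked, prod_orderEmbOfFin_eq_signProd]

theorem entry_splitPlus_spiked (ζ β : ℝ) (z : Fin n → ℝ) (G H : Tensor n k) {S : Finset (Fin n)}
    (hS : S ∈ level (Fin n) k) :
    entry (splitPlus ζ (spiked β z G) H) S = noisy β z (√(1 + ζ ^ 2))
      (ContinuousLinearMap.rotation (Real.arctan ζ) (entry G, entry H)).1 S := by
  have : √(1 + ζ ^ 2) ≠ 0 := by positivity
  rw [splitPlus, isLinearMap_entry.map_add, isLinearMap_entry.map_smul, Pi.add_apply,
    entry_spiked β z G hS]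
  simp only [noisy, ContinuousLinearMap.rotation_apply, Real.cos_arctan, Real.sin_arctan,
    Pi.add_apply, Pi.smul_apply, smul_eq_mul]
  field_simp
  ring

theorem entry_splitMinus_spiked {ζ : ℝ} (hζ : ζ ≠ 0) (β : ℝ) (z : Fin n → ℝ) (G H : Tensor n k)
    {S : Finset (Fin n)} (hS : S ∈ level (Fin n) k) :
    entry (splitMinus ζ (spiked β z G) H) S = noisy β z (-(√(1 + ζ ^ 2) / ζ))
      (ContinuousLinearMap.rotation (Real.arctan ζ) (entry G, entry H)).2 S := by
  have : √(1 + ζ ^ 2) ≠ 0 := by positivity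
  rw [splitMinus, isLinearMap_entry.map_sub, isLinearMap_entry.map_smul, Pi.sub_apply,
    entry_spiked β z G hS]
  simp only [noisy, ContinuousLinearMap.rotation_apply, Real.cos_arctan, Real.sin_arctan,
    Pi.add_apply, Pi.smul_apply, smul_eq_mul]
  field_simp
  ring

variable {Ω : Type*} [MeasurableSpace Ω] {P : Measure Ω} [IsProbabilityMeasure P]
  {G H : Ω → Tensor n k} (hG : HasLaw G (symmGaussianLaw n k) P)
  (hH : HasLaw H (symmGaussianLaw n k) P) (hGH : IndepFun G H P)

include hG hH hGH

theorem measure_rotation_entry_mem (θ : ℝ)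
    {E : Set ((Finset (Fin n) → ℝ) × (Finset (Fin n) → ℝ))} (hE : MeasurableSet E)
    (hEk : ∀ x y, (levelProj k x, levelProj k y) ∈ E ↔ (x, y) ∈ E) :
    P {ω | ContinuousLinearMap.rotation θ (entry (G ω), entry (H ω)) ∈ E}
      = ((gaussPi (Finset (Fin n))).prod (gaussPi (Finset (Fin n)))) E := by
  have hlaw := hasLaw_rotation_entry hG hH hGH θ
  have hproj : Measurable (levelProj (n := n) k) := (levelProj k).measurable
  have hinv : Prod.map (levelProj k) (levelProj k) ⁻¹' E = E := Set.ext fun w => hEk w.1 w.2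
  calc P {ω | ContinuousLinearMap.rotation θ (entry (G ω), entry (H ω)) ∈ E}
      = (entryLaw n k).prod (entryLaw n k) E := by
        rw [← hlaw.map_eq, Measure.map_apply_of_aemeasurable hlaw.aemeasurable hE]
        rfl
    _ = ((gaussPi (Finset (Fin n))).prod (gaussPi (Finset (Fin n)))) E := by
        rw [entryLaw, Measure.map_prod_map _ _ hproj hproj,
          Measure.map_apply (hproj.prodMap hproj) hE, hinv]

theorem measure_not_hasGuidedVector_le {c : ℕ} (hk : Even k) (hk0 : 0 < k) (hc : 0 < c)
    (hn : c * k + k ≤ n) {z : Fin n → ℝ} (hz : ∀ i, z i = 1 ∨ z i = -1) {β γ ζ η r : ℝ}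
    (hβ0 : 0 < β) (hβ : β ^ 2 * ((c * k : ℕ) : ℝ) ^ k ≤ 1 / 100) (hγ : 0 < γ) (hζ : ζ ≠ 0)
    (hη : 0 < η) (hr : 0 < r) :
    P {ω | ¬ HasGuidedVector (kikuchi (c * k) (splitPlus ζ (spiked β z (G ω)) (H ω)))
          ((1 - γ) * (kikuchiDegree n k (c * k) : ℝ) * β)
          (β ^ (2 * c) * numParts k (c * k) * η ^ 2 / (2 * r * (1 + 1 / ζ ^ 2) ^ c))
          (guidingState (c * k) (splitMinus ζ (spiked β z (G ω)) (H ω)))}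
      ≤ ENNReal.ofReal (2 * (1 + ζ ^ 2) / (γ ^ 2 * (β ^ 2 * kikuchiDegree n k (c * k)))) +
        ENNReal.ofReal (deviationBound c (logVariance c β (1 + 1 / ζ ^ 2) (n.choose k))
          (logVariance c β (1 + 1 / ζ ^ 2) ((n - c * k).choose k)) / η ^ 2) +
        ENNReal.ofReal (4 * η * Real.exp (logVariance c β (1 + 1 / ζ ^ 2) (n.choose k))) +
        ENNReal.ofReal (1 / r) := by
  set s' := √(1 + ζ ^ 2)
  set s := -(s' / ζ) with hs
  have hs' : s' ^ 2 = 1 + ζ ^ 2 := Real.sq_sqrt (by positivity)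
  have hs2 : s ^ 2 = 1 + 1 / ζ ^ 2 := by
    rw [hs, neg_sq, div_pow, hs']
    field_simp
    ring
  have hd : (0 : ℝ) < kikuchiDegree n k (c * k) := by
    have hkc : k ≤ c * k := Nat.le_mul_of_pos_left k hc
    exact_mod_cast Nat.mul_pos (Nat.choose_pos (by lia)) (Nat.choose_pos (by lia))
  set b := γ * (kikuchiDegree n k (c * k) * β) with hb
  have hb0 : 0 < b := by positivity
  have hlaw := measure_rotation_entry_mem hG hH hGH (Real.arctan ζ)
    (isClosed_exceptionalSet (c := c) z β s' s b η r).measurableSet fun x y =>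
      mem_exceptionalSet_congr
        (fun S hS => (levelProj_apply x S).trans (if_pos (Finset.mem_powersetCard_univ.1 hS)))
        (fun S hS => (levelProj_apply y S).trans (if_pos (Finset.mem_powersetCard_univ.1 hS)))
  have hbound := measure_exceptionalSet_le (s' := s') hk hk0 hc hn hz hβ0.ne'
    (s := s) (by rw [hs2]; exact le_add_of_nonneg_right (by positivity)) hb0 hη hr hβ
  rw [show 2 * s' ^ 2 * kikuchiDegree n k (c * k) / b ^ 2
    = 2 * (1 + ζ ^ 2) / (γ ^ 2 * (β ^ 2 * kikuchiDegree n k (c * k))) by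
      rw [hs', hb]; field_simp, hs2] at hbound
  refine (measure_mono fun ω hω => ?_).trans (hlaw.trans_le hbound)
  by_contra hE
  have hguided := hasGuidedVector_of_notMem_exceptionalSet hk0 (by lia) hz hβ0 hb0 hη hE
  rw [hs2, show kikuchiDegree n k (c * k) * β - b = (1 - γ) * kikuchiDegree n k (c * k) * β by
    rw [hb]; ring] at hguided
  refine hω ?_
  rw [kikuchi_eq_kikuchiOf, guidingState, guidingVector_eq_guidingOf,
    kikuchiOf_congr fun S => entry_splitPlus_spiked ζ β z (G ω) (H ω),
    guidingOf_congr fun S => entry_splitMinus_spiked hζ β z (G ω) (H ω)]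
  exact hguided

end Transfer

section Asymptotics

variable {κ n c ℓ k : ℕ} {A L δ β : ℝ}

theorem pow_le_factorial_mul_choose {m : ℕ} {u : ℝ} (hu : 0 ≤ u)
    (h : u ≤ ((m + 1 - k : ℕ) : ℝ)) : u ^ k ≤ k.factorial * m.choose k :=
  (pow_le_pow_left₀ hu h k).trans (mod_cast (Nat.pow_sub_le_descFactorial m k).trans_eq
    (Nat.descFactorial_eq_factorial_mul_choose m k))

theorem mul_pow_le_of_threshold (hn : 2 * κ ≤ n) (hβ : β ≠ 0)
    (h : A * ((n : ℝ) ^ κ / (β ^ 2 * n.choose (2 * κ))) * L ≤ (ℓ : ℝ) ^ (κ - 1)) :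
    A * L * (n : ℝ) ^ κ ≤ (ℓ : ℝ) ^ (κ - 1) * (β ^ 2 * n.choose (2 * κ)) := by
  have : (0 : ℝ) < n.choose (2 * κ) := mod_cast Nat.choose_pos hn
  rw [← div_le_iff₀ (by positivity)]
  exact (by ring : _ = _).trans_le h

theorem mul_le_sq_mul_pow_mul_pow (hn : 0 < n) (hℓ : 0 < ℓ)
    (h : A * L * (n : ℝ) ^ κ ≤ (ℓ : ℝ) ^ (κ - 1) * (β ^ 2 * n.choose (2 * κ))) :
    A * L ≤ β ^ 2 * (ℓ : ℝ) ^ (κ - 1) * (n : ℝ) ^ κ := by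
  refine le_of_mul_le_mul_right ?_ (by positivity : (0 : ℝ) < (n : ℝ) ^ κ)
  calc A * L * (n : ℝ) ^ κ ≤ (ℓ : ℝ) ^ (κ - 1) * (β ^ 2 * n.choose (2 * κ)) := h
    _ ≤ (ℓ : ℝ) ^ (κ - 1) * (β ^ 2 * (n : ℝ) ^ (2 * κ)) := by
        gcongr
        exact mod_cast Nat.choose_le_pow n (2 * κ)
    _ = _ := by ring

theorem mul_pow_succ_le_of_threshold (hκ : 0 < κ) (hn : 0 < n) (hℓ : 0 < ℓ)
    (hβ : β ^ 2 * (ℓ : ℝ) ^ (2 * κ) ≤ 1 / 100)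
    (h : A * L * (n : ℝ) ^ κ ≤ (ℓ : ℝ) ^ (κ - 1) * (β ^ 2 * n.choose (2 * κ))) :
    A * L * (ℓ : ℝ) ^ (κ + 1) ≤ (n : ℝ) ^ κ / 100 := by
  calc A * L * (ℓ : ℝ) ^ (κ + 1)
      ≤ β ^ 2 * (ℓ : ℝ) ^ (κ - 1) * (n : ℝ) ^ κ * (ℓ : ℝ) ^ (κ + 1) :=
        mul_le_mul_of_nonneg_right (mul_le_sq_mul_pow_mul_pow hn hℓ h) (by positivity)
    _ = (β ^ 2 * (ℓ : ℝ) ^ (2 * κ)) * (n : ℝ) ^ κ := by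
        rw [show 2 * κ = (κ - 1) + (κ + 1) by lia, pow_add]
        ring
    _ ≤ 1 / 100 * (n : ℝ) ^ κ := by gcongr
    _ = (n : ℝ) ^ κ / 100 := by ring

/-- The bound `n ^ (-1 / (κ + 1))` on the ratio `ℓ / n` above the threshold. -/
noncomputable def ratioBound (κ n : ℕ) : ℝ := (n : ℝ) ^ (-(1 / ((κ : ℝ) + 1)))

theorem ratioBound_nonneg (κ n : ℕ) : 0 ≤ ratioBound κ n := Real.rpow_nonneg n.cast_nonneg _

theorem ratioBound_pow_succ (κ n : ℕ) : ratioBound κ n ^ (κ + 1) = (n : ℝ)⁻¹ := by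
  rw [ratioBound, ← Real.rpow_natCast, ← Real.rpow_mul n.cast_nonneg, Nat.cast_succ, neg_mul,
    one_div_mul_cancel (by positivity), Real.rpow_neg_one]

theorem div_le_ratioBound (hn : 0 < n) (hAL : 1 ≤ A * L)
    (h : A * L * (ℓ : ℝ) ^ (κ + 1) ≤ (n : ℝ) ^ κ / 100) : (ℓ : ℝ) / n ≤ ratioBound κ n := by
  have : (0 : ℝ) < n := mod_cast hn
  have hpow : (ℓ : ℝ) ^ (κ + 1) ≤ (n : ℝ) ^ κ :=
    calc (ℓ : ℝ) ^ (κ + 1) ≤ A * L * (ℓ : ℝ) ^ (κ + 1) :=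
          le_mul_of_one_le_left (by positivity) hAL
      _ ≤ (n : ℝ) ^ κ / 100 := h
      _ ≤ (n : ℝ) ^ κ := div_le_self (by positivity) (by norm_num)
  refine le_of_pow_le_pow_left₀ κ.succ_ne_zero (ratioBound_nonneg κ n) ?_
  rw [ratioBound_pow_succ, div_pow, div_le_iff₀ (by positivity)]
  exact hpow.trans_eq (by
    rw [pow_succ]
    field_simp)

theorem one_add_sq_div_le_of_threshold (hA : 0 < A) (hL : 1 ≤ L) (hn : 0 < n) (hκn : 2 * κ ≤ n)
    (hβ : β ≠ 0)
    (h : A * L * (n : ℝ) ^ κ ≤ (ℓ : ℝ) ^ (κ - 1) * (β ^ 2 * n.choose (2 * κ))) :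
    (1 + L ^ 2) / (β ^ 2 * n.choose (2 * κ)) ≤ 2 * L * (ℓ : ℝ) ^ (κ - 1) / (A * (n : ℝ) ^ κ) := by
  have : (0 : ℝ) < n.choose (2 * κ) := mod_cast Nat.choose_pos hκn
  have hL2 : 1 + L ^ 2 ≤ 2 * L ^ 2 := by linarith [one_le_pow₀ hL (n := 2)]
  rw [div_le_div_iff₀ (by positivity) (by positivity)]
  calc (1 + L ^ 2) * (A * (n : ℝ) ^ κ) ≤ 2 * L ^ 2 * (A * (n : ℝ) ^ κ) := by gcongr
    _ = 2 * L * (A * L * (n : ℝ) ^ κ) := by ring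
    _ ≤ 2 * L * ((ℓ : ℝ) ^ (κ - 1) * (β ^ 2 * n.choose (2 * κ))) := by gcongr
    _ = _ := by ring

theorem logVariance_le_of_threshold (hA : 0 < A) (hκ : 0 < κ) (hn : 0 < n) (hc : c ≤ ℓ)
    (h : (1 + L ^ 2) / (β ^ 2 * n.choose (2 * κ))
      ≤ 2 * L * (ℓ : ℝ) ^ (κ - 1) / (A * (n : ℝ) ^ κ))
    (h' : A * L * (ℓ : ℝ) ^ (κ + 1) ≤ (n : ℝ) ^ κ / 100) :
    logVariance c β (1 + L ^ 2) (n.choose (2 * κ)) ≤ 1 / (50 * A ^ 2) := by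
  have : (0 : ℝ) < n := mod_cast hn
  calc logVariance c β (1 + L ^ 2) (n.choose (2 * κ))
      = (c : ℝ) ^ 2 * ((1 + L ^ 2) / (β ^ 2 * n.choose (2 * κ))) := mul_div_assoc _ _ _
    _ ≤ (ℓ : ℝ) ^ 2 * (2 * L * (ℓ : ℝ) ^ (κ - 1) / (A * (n : ℝ) ^ κ)) := by gcongr
    _ = 2 * (A * L * (ℓ : ℝ) ^ (κ + 1)) / (A ^ 2 * (n : ℝ) ^ κ) := by
        rw [show κ + 1 = (κ - 1) + 2 by lia, pow_add]
        field_simp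
    _ ≤ 2 * ((n : ℝ) ^ κ / 100) / (A ^ 2 * (n : ℝ) ^ κ) := by gcongr
    _ = 1 / (50 * A ^ 2) := by
        field_simp
        norm_num

theorem logVariance_div_le_of_threshold (hκ : 0 < κ) (hc0 : 0 < c) (hc : c ≤ ℓ)
    (h : (1 + L ^ 2) / (β ^ 2 * n.choose (2 * κ))
      ≤ 2 * L * (ℓ : ℝ) ^ (κ - 1) / (A * (n : ℝ) ^ κ)) :
    logVariance c β (1 + L ^ 2) (n.choose (2 * κ)) / c ≤ 2 * L / A * ((ℓ : ℝ) / n) ^ κ := by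
  have : (0 : ℝ) < c := mod_cast hc0
  calc logVariance c β (1 + L ^ 2) (n.choose (2 * κ)) / c
      = c * ((1 + L ^ 2) / (β ^ 2 * n.choose (2 * κ))) := by
        rw [logVariance]
        field_simp
    _ ≤ ℓ * (2 * L * (ℓ : ℝ) ^ (κ - 1) / (A * (n : ℝ) ^ κ)) := by gcongr
    _ = 2 * L / A * ((ℓ : ℝ) / n) ^ κ := by
        rw [div_pow, ← pow_sub_one_mul hκ.ne' (ℓ : ℝ)]
        ring

theorem add_le_of_div_le (hk : 0 < k) (hkℓ : k ≤ ℓ) (hn : 0 < n) (h : (ℓ : ℝ) / n ≤ 1 / 4) :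
    ℓ + k ≤ n := by
  have : (0 : ℝ) < n := mod_cast hn
  have h4 : ((4 * ℓ : ℕ) : ℝ) ≤ n := by
    rw [div_le_iff₀ this] at h
    push_cast
    linarith
  have : 4 * ℓ ≤ n := mod_cast h4
  lia

theorem one_sub_mul_pow_le_factorial_mul_choose_sub (hk : 0 < k) (hkℓ : k ≤ ℓ) (hn : 0 < n)
    (hδ : δ ≤ 1 / 4) (h : (ℓ : ℝ) / n ≤ δ) :
    (1 - 2 * k * δ) * (n : ℝ) ^ k ≤ k.factorial * (n - ℓ).choose k := by
  have hn' : (0 : ℝ) < n := mod_cast hn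
  have hkℓ' : (k : ℝ) ≤ ℓ := mod_cast hkℓ
  have hadd := add_le_of_div_le hk hkℓ hn (h.trans hδ)
  have hcast : (1 - 2 * δ) * n ≤ ((n - ℓ + 1 - k : ℕ) : ℝ) := by
    rw [div_le_iff₀ hn'] at h
    rw [Nat.cast_sub (by lia), Nat.cast_add, Nat.cast_sub (by lia), Nat.cast_one]
    linarith
  have hbernoulli := one_add_mul_le_pow (a := -(2 * δ)) (by linarith) k
  calc (1 - 2 * k * δ) * (n : ℝ) ^ k = (1 + k * -(2 * δ)) * (n : ℝ) ^ k := by ring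
    _ ≤ (1 + -(2 * δ)) ^ k * (n : ℝ) ^ k := by gcongr
    _ = ((1 - 2 * δ) * n) ^ k := by rw [mul_pow, sub_eq_add_neg]
    _ ≤ k.factorial * (n - ℓ).choose k :=
        pow_le_factorial_mul_choose (mul_nonneg (by linarith) hn'.le) hcast

theorem choose_le_mul_choose_sub (hk : 0 < k) (hkℓ : k ≤ ℓ) (hn : 0 < n) (hδ : 4 * k * δ ≤ 1)
    (h : (ℓ : ℝ) / n ≤ δ) : (n.choose k : ℝ) ≤ (1 + 4 * k * δ) * (n - ℓ).choose k := by
  have hk' : (1 : ℝ) ≤ k := mod_cast hk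
  have hδ0 : 0 ≤ δ := h.trans' (by positivity)
  have hδ4 : δ ≤ 1 / 4 := by linarith [mul_le_mul_of_nonneg_right hk' hδ0]
  have hkδ : 0 ≤ (k : ℝ) * δ := by positivity
  have hpow : (k.factorial : ℝ) * n.choose k ≤ (n : ℝ) ^ k :=
    mod_cast (Nat.descFactorial_eq_factorial_mul_choose n k).symm.trans_le
      (Nat.descFactorial_le_pow n k)
  have hone : (1 : ℝ) ≤ (1 + 4 * k * δ) * (1 - 2 * k * δ) := by nlinarith
  refine le_of_mul_le_mul_left ?_ (by positivity : (0 : ℝ) < k.factorial)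
  calc (k.factorial : ℝ) * n.choose k ≤ 1 * (n : ℝ) ^ k := hpow.trans_eq (one_mul _).symm
    _ ≤ (1 + 4 * k * δ) * (1 - 2 * k * δ) * (n : ℝ) ^ k := by gcongr
    _ = (1 + 4 * k * δ) * ((1 - 2 * k * δ) * (n : ℝ) ^ k) := by ring
    _ ≤ (1 + 4 * k * δ) * (k.factorial * (n - ℓ).choose k) :=
        mul_le_mul_of_nonneg_left
          (one_sub_mul_pow_le_factorial_mul_choose_sub hk hkℓ hn hδ4 h) (by positivity)
    _ = _ := by ring

theorem logVariance_choose_sub_le {v : ℝ} (hv : 0 ≤ v) (hβ : β ≠ 0) (hk : 0 < k) (hkℓ : k ≤ ℓ)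
    (hℓn : ℓ + k ≤ n) (hδ : 4 * k * δ ≤ 1) (h : (ℓ : ℝ) / n ≤ δ) :
    logVariance c β v ((n - ℓ).choose k)
      ≤ logVariance c β v (n.choose k) * (1 + 4 * k * δ) := by
  have : (0 : ℝ) < n.choose k := mod_cast Nat.choose_pos (by lia)
  have : (0 : ℝ) < (n - ℓ).choose k := mod_cast Nat.choose_pos (by lia)
  rw [logVariance, logVariance, div_mul_eq_mul_div, div_le_div_iff₀ (by positivity) (by positivity)]
  calc (c : ℝ) ^ 2 * v * (β ^ 2 * n.choose k)
      ≤ (c : ℝ) ^ 2 * v * (β ^ 2 * ((1 + 4 * k * δ) * (n - ℓ).choose k)) := by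
        gcongr
        exact choose_le_mul_choose_sub hk hkℓ (by lia) hδ h
    _ = _ := by ring

theorem mul_pow_le_mul_kikuchiDegree (hκ : 0 < κ) (hκℓ : 2 * κ ≤ ℓ) (hn : 0 < n)
    (h : (ℓ : ℝ) / n ≤ 1 / 4) :
    (ℓ : ℝ) ^ κ * (n : ℝ) ^ κ
      ≤ 4 ^ κ * (κ.factorial : ℝ) ^ 2 * kikuchiDegree n (2 * κ) ℓ := by
  have hκℓ' : 2 * (κ : ℝ) ≤ ℓ := mod_cast hκℓ
  have hadd := add_le_of_div_le (mul_pos two_pos hκ) hκℓ hn h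
  have hℓ := pow_le_factorial_mul_choose (m := ℓ) (k := κ) (u := ℓ / 2) (by positivity) (by
    rw [Nat.cast_sub (by lia)]
    push_cast
    linarith)
  have hnℓ := pow_le_factorial_mul_choose (m := n - ℓ) (k := κ) (u := n / 2) (by positivity) (by
    rw [div_le_iff₀ (mod_cast hn)] at h
    rw [Nat.cast_sub (by lia), Nat.cast_add, Nat.cast_sub (by lia), Nat.cast_one]
    linarith)
  calc (ℓ : ℝ) ^ κ * (n : ℝ) ^ κ = 4 ^ κ * (((ℓ : ℝ) / 2) ^ κ * ((n : ℝ) / 2) ^ κ) := by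
        rw [← mul_pow, ← mul_pow, ← mul_pow]
        ring
    _ ≤ 4 ^ κ * ((κ.factorial * ℓ.choose κ) * (κ.factorial * (n - ℓ).choose κ)) := by gcongr
    _ = _ := by
        rw [kikuchiDegree, Nat.mul_div_cancel_left κ two_pos, Nat.cast_mul]
        ring

theorem le_sq_mul_kikuchiDegree (hκ : 0 < κ) (hκℓ : 2 * κ ≤ ℓ) (hn : 0 < n)
    (hρ : (ℓ : ℝ) / n ≤ 1 / 4)
    (h : A * L * (n : ℝ) ^ κ ≤ (ℓ : ℝ) ^ (κ - 1) * (β ^ 2 * n.choose (2 * κ))) :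
    A * L / (4 ^ κ * (κ.factorial : ℝ) ^ 2) ≤ β ^ 2 * kikuchiDegree n (2 * κ) ℓ := by
  have hℓ : (1 : ℝ) ≤ ℓ := mod_cast (by lia : 1 ≤ ℓ)
  rw [div_le_iff₀ (by positivity)]
  calc A * L ≤ β ^ 2 * (ℓ : ℝ) ^ (κ - 1) * (n : ℝ) ^ κ :=
        mul_le_sq_mul_pow_mul_pow hn (by lia) h
    _ ≤ β ^ 2 * ((ℓ : ℝ) ^ κ * (n : ℝ) ^ κ) := by
        rw [mul_assoc]
        gcongr
        exact κ.sub_le 1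
    _ ≤ β ^ 2 * (4 ^ κ * (κ.factorial : ℝ) ^ 2 * kikuchiDegree n (2 * κ) ℓ) :=
        mul_le_mul_of_nonneg_left (mul_pow_le_mul_kikuchiDegree hκ hκℓ hn hρ) (sq_nonneg β)
    _ = _ := by ring

theorem exp_mul_one_add_sub_exp_le (x u : ℝ) :
    Real.exp (x * (1 + u)) - Real.exp x ≤ x * u * Real.exp (x * (1 + u)) := by
  have hsplit : Real.exp x = Real.exp (x * (1 + u)) * Real.exp (-(x * u)) := by
    rw [← Real.exp_add]
    ring_nf
  rw [hsplit]
  nlinarith [Real.add_one_le_exp (-(x * u)), Real.exp_pos (x * (1 + u))]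

theorem deviationBound_le {X x y u : ℝ} (hx : 0 ≤ x) (hxX : x ≤ X) (hxy : x / c ≤ y)
    (hu : 0 ≤ u) (hu1 : u ≤ 1) :
    deviationBound c x (x * (1 + u)) ≤ Real.exp (2 * X) * (X * u + (X + 2) * y) := by
  have hX : 0 ≤ X := hx.trans hxX
  have hy : 0 ≤ y := hxy.trans' (by positivity)
  have hexp : Real.exp x ≤ Real.exp (2 * X) := Real.exp_le_exp.2 (by linarith)
  have hexp' : Real.exp (x * (1 + u)) ≤ Real.exp (2 * X) :=
    Real.exp_le_exp.2 (by nlinarith)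
  calc deviationBound c x (x * (1 + u))
      = (Real.exp (x * (1 + u)) - Real.exp x) + x * (x / c) * Real.exp x
        + x / c * (1 + u) * Real.exp (x * (1 + u)) := by
        rw [deviationBound]
        ring
    _ ≤ x * u * Real.exp (x * (1 + u)) + x * (x / c) * Real.exp x
        + x / c * (1 + u) * Real.exp (x * (1 + u)) := by
        gcongr
        exact exp_mul_one_add_sub_exp_le x u
    _ ≤ X * u * Real.exp (2 * X) + X * y * Real.exp (2 * X)
        + y * (1 + 1) * Real.exp (2 * X) := by gcongr
    _ = Real.exp (2 * X) * (X * u + (X + 2) * y) := by ring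

theorem tendsto_log_natCast : Filter.Tendsto (fun n : ℕ => Real.log n) Filter.atTop Filter.atTop :=
  Real.tendsto_log_atTop.comp tendsto_natCast_atTop_atTop

theorem tendsto_sqrt_sqrt_log :
    Filter.Tendsto (fun n : ℕ => √√(Real.log n)) Filter.atTop Filter.atTop :=
  Real.tendsto_sqrt_atTop.comp (Real.tendsto_sqrt_atTop.comp tendsto_log_natCast)

theorem tendsto_ratioBound (κ : ℕ) : Filter.Tendsto (ratioBound κ) Filter.atTop (nhds 0) :=
  (tendsto_rpow_neg_atTop (by positivity)).comp tendsto_natCast_atTop_atTop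

theorem tendsto_log_sq_mul_ratioBound (κ : ℕ) :
    Filter.Tendsto (fun n : ℕ => Real.log n ^ 2 * ratioBound κ n) Filter.atTop (nhds 0) := by
  have h := (isLittleO_log_rpow_rpow_atTop (s := 1 / ((κ : ℝ) + 1)) 2
    (by positivity)).tendsto_div_nhds_zero
  refine (h.comp tendsto_natCast_atTop_atTop).congr fun n => ?_
  rw [Function.comp_apply, ratioBound, Real.rpow_neg n.cast_nonneg, div_eq_mul_inv, Real.rpow_two]

/-- The bound on the failure probability at the threshold constant `A`; its four terms correspond
to the four events of `exceptionalSet`. -/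
noncomputable def errorBound (κ : ℕ) (γ A : ℝ) (n : ℕ) : ℝ :=
  4 * (4 ^ κ * (κ.factorial : ℝ) ^ 2) / (γ ^ 2 * A) * (Real.log n)⁻¹ +
  Real.exp (2 * (1 / (50 * A ^ 2))) * (1 / (50 * A ^ 2) * (4 * (2 * κ : ℕ))
      + (1 / (50 * A ^ 2) + 2) * (2 / A)) * (Real.log n ^ 2 * ratioBound κ n) +
  4 * Real.exp (1 / (50 * A ^ 2)) * (√√(Real.log n))⁻¹ + (√√(Real.log n))⁻¹

theorem tendsto_errorBound (κ : ℕ) (γ A : ℝ) :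
    Filter.Tendsto (errorBound κ γ A) Filter.atTop (nhds 0) := by
  have hlog := tendsto_inv_atTop_zero.comp tendsto_log_natCast
  have hsqrt := tendsto_inv_atTop_zero.comp tendsto_sqrt_sqrt_log
  have hsum := (((hlog.const_mul (4 * (4 ^ κ * (κ.factorial : ℝ) ^ 2) / (γ ^ 2 * A))).add
    ((tendsto_log_sq_mul_ratioBound κ).const_mul (Real.exp (2 * (1 / (50 * A ^ 2))) *
      (1 / (50 * A ^ 2) * (4 * (2 * κ : ℕ)) + (1 / (50 * A ^ 2) + 2) * (2 / A))))).add
    (hsqrt.const_mul (4 * Real.exp (1 / (50 * A ^ 2))))).add hsqrt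
  simp only [mul_zero, add_zero] at hsum
  exact hsum

end Asymptotics

section Main

variable {κ n c ℓ : ℕ} {A γ β : ℝ}

/-- The lower bounds on `n` under which `errorBound κ γ A n` bounds the failure probability. -/
structure IsLarge (κ : ℕ) (γ A : ℝ) (n : ℕ) : Prop where
  two_mul_le : 2 * κ ≤ n
  one_le_log : 1 ≤ Real.log n
  one_le_mul_log : 1 ≤ A * Real.log n
  mul_ratioBound_le_one : 4 * (2 * κ : ℕ) * ratioBound κ n ≤ 1
  le_sqrt_sqrt_log : γ ≤ √√(Real.log n)

theorem eventually_isLarge (κ : ℕ) (γ : ℝ) (hA : 0 < A) :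
    ∀ᶠ n : ℕ in Filter.atTop, IsLarge κ γ A n := by
  have hratio := (tendsto_ratioBound κ).const_mul (4 * ((2 * κ : ℕ) : ℝ))
  rw [mul_zero] at hratio
  filter_upwards [Filter.eventually_ge_atTop (2 * κ), tendsto_log_natCast.eventually_ge_atTop 1,
    (tendsto_log_natCast.const_mul_atTop hA).eventually_ge_atTop 1,
    hratio.eventually_le_const one_pos, tendsto_sqrt_sqrt_log.eventually_ge_atTop γ]
    with n hκ hlog hAlog hδ hγ
  exact ⟨hκ, hlog, hAlog, hδ, hγ⟩

theorem IsLarge.pos (h : IsLarge κ γ A n) : 0 < n := by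
  by_contra! hn
  have hlog := h.one_le_log
  norm_num [Nat.le_zero.1 hn] at hlog

theorem IsLarge.ratioBound_le (hκ : 0 < κ) (h : IsLarge κ γ A n) : ratioBound κ n ≤ 1 / 4 := by
  have hκ' : (1 : ℝ) ≤ (2 * κ : ℕ) := mod_cast (by lia : 1 ≤ 2 * κ)
  linarith [h.mul_ratioBound_le_one, mul_le_mul_of_nonneg_right hκ' (ratioBound_nonneg κ n)]

theorem eigenvalueError_le {F D L : ℝ} (hγ : 0 < γ) (hA : 0 < A) (hF : 0 < F) (hL : 1 ≤ L)
    (h : A * L / F ≤ D) :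
    2 * (1 + (1 / L) ^ 2) / (γ ^ 2 * D) ≤ 4 * F / (γ ^ 2 * A) * L⁻¹ := by
  have hinv : (1 / L) ^ 2 ≤ 1 := pow_le_one₀ (by positivity) ((div_le_one (by positivity)).2 hL)
  calc 2 * (1 + (1 / L) ^ 2) / (γ ^ 2 * D) ≤ 2 * (1 + 1) / (γ ^ 2 * (A * L / F)) := by gcongr
    _ = 4 * F / (γ ^ 2 * A) * L⁻¹ := by
        field_simp
        norm_num

theorem IsLarge.div_le (h : IsLarge κ γ A n) (hκ : 0 < κ) (hℓ : 0 < ℓ)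
    (hβ : β ^ 2 * (ℓ : ℝ) ^ (2 * κ) ≤ 1 / 100)
    (hthr : A * Real.log n * (n : ℝ) ^ κ ≤ (ℓ : ℝ) ^ (κ - 1) * (β ^ 2 * n.choose (2 * κ))) :
    (ℓ : ℝ) / n ≤ ratioBound κ n :=
  div_le_ratioBound h.pos h.one_le_mul_log
    (mul_pow_succ_le_of_threshold hκ h.pos hℓ hβ hthr)

theorem IsLarge.logVariance_le (h : IsLarge κ γ A n) (hA : 0 < A) (hκ : 0 < κ) (hℓ : 0 < ℓ)
    (hc : c ≤ ℓ) (hβ0 : β ≠ 0) (hβ : β ^ 2 * (ℓ : ℝ) ^ (2 * κ) ≤ 1 / 100)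
    (hthr : A * Real.log n * (n : ℝ) ^ κ ≤ (ℓ : ℝ) ^ (κ - 1) * (β ^ 2 * n.choose (2 * κ))) :
    logVariance c β (1 + Real.log n ^ 2) (n.choose (2 * κ)) ≤ 1 / (50 * A ^ 2) :=
  logVariance_le_of_threshold hA hκ h.pos hc
    (one_add_sq_div_le_of_threshold hA h.one_le_log h.pos h.two_mul_le hβ0 hthr)
    (mul_pow_succ_le_of_threshold hκ h.pos hℓ hβ hthr)

theorem IsLarge.logVariance_div_le (h : IsLarge κ γ A n) (hA : 0 < A) (hκ : 0 < κ) (hℓ : 0 < ℓ)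
    (hc0 : 0 < c) (hc : c ≤ ℓ) (hβ0 : β ≠ 0) (hβ : β ^ 2 * (ℓ : ℝ) ^ (2 * κ) ≤ 1 / 100)
    (hthr : A * Real.log n * (n : ℝ) ^ κ ≤ (ℓ : ℝ) ^ (κ - 1) * (β ^ 2 * n.choose (2 * κ))) :
    logVariance c β (1 + Real.log n ^ 2) (n.choose (2 * κ)) / c
      ≤ 2 * Real.log n / A * ratioBound κ n := by
  have hρ := h.div_le hκ hℓ hβ hthr
  have hL := h.one_le_log
  calc logVariance c β (1 + Real.log n ^ 2) (n.choose (2 * κ)) / c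
      ≤ 2 * Real.log n / A * ((ℓ : ℝ) / n) ^ κ :=
        logVariance_div_le_of_threshold hκ hc0 hc
          (one_add_sq_div_le_of_threshold hA hL h.pos h.two_mul_le hβ0 hthr)
    _ ≤ 2 * Real.log n / A * ratioBound κ n := by
        gcongr
        refine (pow_le_of_le_one (by positivity) (hρ.trans ?_) hκ.ne').trans hρ
        linarith [h.ratioBound_le hκ]

theorem deviationError_le {w : ℝ} (h : IsLarge κ γ A n) (hκ : 0 < κ) (hA : 0 < A) (hc : 0 < c)
    (hcℓ : c ≤ ℓ) (hκℓ : 2 * κ ≤ ℓ) (hβ0 : β ≠ 0) (hβ : β ^ 2 * (ℓ : ℝ) ^ (2 * κ) ≤ 1 / 100)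
    (hthr : A * Real.log n * (n : ℝ) ^ κ ≤ (ℓ : ℝ) ^ (κ - 1) * (β ^ 2 * n.choose (2 * κ)))
    (hw : w ^ 2 ≤ Real.log n) :
    deviationBound c (logVariance c β (1 + Real.log n ^ 2) (n.choose (2 * κ)))
        (logVariance c β (1 + Real.log n ^ 2) ((n - ℓ).choose (2 * κ))) / (1 / w) ^ 2
      ≤ Real.exp (2 * (1 / (50 * A ^ 2))) * (1 / (50 * A ^ 2) * (4 * (2 * κ : ℕ))
          + (1 / (50 * A ^ 2) + 2) * (2 / A)) * (Real.log n ^ 2 * ratioBound κ n) := by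
  have hℓ : 0 < ℓ := hc.trans_le hcℓ
  have hδ := h.mul_ratioBound_le_one
  have hδ0 := ratioBound_nonneg κ n
  have hL := h.one_le_log
  have hxX := h.logVariance_le hA hκ hℓ hcℓ hβ0 hβ hthr
  have hxc := h.logVariance_div_le hA hκ hℓ hc hcℓ hβ0 hβ hthr
  have hρ := h.div_le hκ hℓ hβ hthr
  set L := Real.log n
  set δ := ratioBound κ n
  set X := 1 / (50 * A ^ 2)
  set x := logVariance c β (1 + L ^ 2) (n.choose (2 * κ))
  have : 0 ≤ X := by positivity
  have hx : 0 ≤ x := logVariance_nonneg c β (by positivity) _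
  have hx' : logVariance c β (1 + L ^ 2) ((n - ℓ).choose (2 * κ))
      ≤ x * (1 + 4 * (2 * κ : ℕ) * δ) :=
    logVariance_choose_sub_le (by positivity) hβ0 (by lia) hκℓ
      (add_le_of_div_le (by lia) hκℓ h.pos (hρ.trans (h.ratioBound_le hκ))) hδ hρ
  rw [one_div w, inv_pow, div_inv_eq_mul]
  calc deviationBound c x (logVariance c β (1 + L ^ 2) ((n - ℓ).choose (2 * κ))) * w ^ 2
      ≤ Real.exp (2 * X) * (X * (4 * (2 * κ : ℕ) * δ) + (X + 2) * (2 * L / A * δ)) * L := by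
        refine mul_le_mul ?_ hw (sq_nonneg w) (by positivity)
        exact (deviationBound_mono (logVariance_nonneg c β (by positivity) _) hx').trans
          (deviationBound_le hx hxX hxc (by positivity) hδ)
    _ ≤ Real.exp (2 * X) * (X * (4 * (2 * κ : ℕ) * (L * δ)) + (X + 2) * (2 * L / A * δ)) * L := by
        gcongr
        exact le_mul_of_one_le_left hδ0 hL
    _ = _ := by ring

theorem sqrt_sqrt_pow_four {x : ℝ} (hx : 0 ≤ x) : √√x ^ 4 = x := by
  rw [show 4 = 2 * 2 from rfl, pow_mul, Real.sq_sqrt (Real.sqrt_nonneg _), Real.sq_sqrt hx]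

theorem overlapTarget_le {w m q : ℝ} (hβ : 0 ≤ β) (hm : 0 ≤ m) (hq : 0 ≤ q) (hw : 0 < w)
    (hγ : γ ≤ w) :
    β ^ (2 * c) * (m * (γ / 10) * (1 / q) ^ c * (1 / w ^ 4))
      ≤ β ^ (2 * c) * m * (1 / w) ^ 2 / (2 * w * q ^ c) := by
  calc β ^ (2 * c) * (m * (γ / 10) * (1 / q) ^ c * (1 / w ^ 4))
      = β ^ (2 * c) * m * (1 / q ^ c) * (1 / w ^ 4) * (γ / 10) := by
        rw [one_div_pow]
        ring
    _ ≤ β ^ (2 * c) * m * (1 / q ^ c) * (1 / w ^ 4) * (w / 2) := by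
        gcongr
        linarith
    _ = β ^ (2 * c) * m * (1 / w) ^ 2 / (2 * w * q ^ c) := by field_simp

theorem measure_not_hasGuidedVector_le_errorBound (hκ : 0 < κ) (hγ : 0 < γ) (hA : 0 < A)
    (hlarge : IsLarge κ γ A n) (hc : 0 < c) (hβ0 : 0 < β)
    (hβ : β ^ 2 * ((c * (2 * κ) : ℕ) : ℝ) ^ (2 * κ) ≤ 1 / 100)
    (hthr : A * ((n : ℝ) ^ κ / (β ^ 2 * n.choose (2 * κ))) * Real.log n
      ≤ ((c * (2 * κ) : ℕ) : ℝ) ^ (κ - 1))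
    {z : Fin n → ℝ} (hz : ∀ i, z i = 1 ∨ z i = -1)
    {Ω : Type*} [MeasurableSpace Ω] {P : Measure Ω} [IsProbabilityMeasure P]
    {G H : Ω → Tensor n (2 * κ)} (hG : HasLaw G (symmGaussianLaw n (2 * κ)) P)
    (hH : HasLaw H (symmGaussianLaw n (2 * κ)) P) (hGH : IndepFun G H P) :
    P {ω | ¬ HasGuidedVector
        (kikuchi (c * (2 * κ)) (splitPlus (1 / Real.log n) (spiked β z (G ω)) (H ω)))
        ((1 - γ) * (kikuchiDegree n (2 * κ) (c * (2 * κ)) : ℝ) * β)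
        (β ^ (2 * c) * ((numParts (2 * κ) (c * (2 * κ)) : ℝ) * (γ / 10) *
          (1 / (1 + Real.log n ^ 2)) ^ c * (1 / Real.log n)))
        (guidingState (c * (2 * κ)) (splitMinus (1 / Real.log n) (spiked β z (G ω)) (H ω)))}
      ≤ ENNReal.ofReal (errorBound κ γ A n) := by
  have hL := hlarge.one_le_log
  have hκℓ : 2 * κ ≤ c * (2 * κ) := Nat.le_mul_of_pos_left _ hc
  have hcℓ : c ≤ c * (2 * κ) := Nat.le_mul_of_pos_right _ (by lia)
  have hthr' := mul_pow_le_of_threshold hlarge.two_mul_le hβ0.ne' hthr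
  have hρ := (hlarge.div_le hκ (by lia) hβ hthr').trans (hlarge.ratioBound_le hκ)
  have hxX := hlarge.logVariance_le hA hκ (by lia) hcℓ hβ0.ne' hβ hthr'
  have hw1 : 1 ≤ √√(Real.log n) := by rwa [Real.one_le_sqrt, Real.one_le_sqrt]
  have hw4 : √√(Real.log n) ^ 4 = Real.log n := sqrt_sqrt_pow_four (by positivity)
  have hw2 : √√(Real.log n) ^ 2 ≤ Real.log n :=
    (pow_le_pow_right₀ hw1 (by norm_num)).trans_eq hw4
  have hw0 : 0 < √√(Real.log n) := one_pos.trans_le hw1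
  have hmain := measure_not_hasGuidedVector_le hG hH hGH (even_two_mul κ) (by lia) hc
    (add_le_of_div_le (by lia) hκℓ hlarge.pos hρ) hz hβ0 hβ hγ (ζ := 1 / Real.log n) (by positivity)
    (η := 1 / √√(Real.log n)) (by positivity) hw0
  rw [one_div_pow (Real.log n), one_div_one_div] at hmain
  have htarget := overlapTarget_le (c := c) (m := numParts (2 * κ) (c * (2 * κ)))
    (q := 1 + Real.log n ^ 2) hβ0.le (by positivity) (by positivity) hw0 hlarge.le_sqrt_sqrt_log
  rw [hw4] at htarget
  refine (measure_mono ?_).trans (hmain.trans ?_)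
  · exact fun ω hω h => hω (h.mono htarget)
  have := ratioBound_nonneg κ n
  rw [errorBound, ENNReal.ofReal_add (by positivity) (by positivity),
    ENNReal.ofReal_add (by positivity) (by positivity),
    ENNReal.ofReal_add (by positivity) (by positivity)]
  refine add_le_add (add_le_add (add_le_add ?_ ?_) ?_) ?_ <;> apply ENNReal.ofReal_le_ofReal
  · rw [← one_div_pow]
    exact eigenvalueError_le hγ hA (by positivity) hL
      (le_sq_mul_kikuchiDegree hκ hκℓ hlarge.pos hρ hthr')
  · exact deviationError_le hlarge hκ hA hc hcℓ hκℓ hβ0.ne' hβ hthr' hw2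
  · rw [one_div √√(Real.log n), mul_right_comm]
    gcongr
  · exact (one_div _).le

theorem sq_mul_pow_le_of_le (hβ : 0 < β) (hℓ : 0 < ℓ) (h : β ≤ 0.1 / (ℓ : ℝ) ^ κ) :
    β ^ 2 * (ℓ : ℝ) ^ (2 * κ) ≤ 1 / 100 := by
  rw [le_div_iff₀ (by positivity)] at h
  calc β ^ 2 * (ℓ : ℝ) ^ (2 * κ) = (β * (ℓ : ℝ) ^ κ) ^ 2 := by ring
    _ ≤ 0.1 ^ 2 := pow_le_pow_left₀ (by positivity) h 2
    _ = 1 / 100 := by norm_num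

end Main

end TensorPCA

open TensorPCA in
theorem mainTheorem4_general (k : ℕ) (hk : Even k) (hk0 : 0 < k) (γ : ℝ) (hγ : 0 < γ) (A : ℝ)
    (hA : 0 < A) :
    ∃ err : ℕ → ℝ, Filter.Tendsto err Filter.atTop (nhds 0) ∧
      ∀ (n c ℓ : ℕ), 1 ≤ c → ℓ = c * k →
      ∀ β : ℝ, 0 < β → β ≤ 0.1 / (ℓ : ℝ) ^ (k / 2) →
        A * ((n : ℝ) ^ (k / 2) / (β ^ 2 * (n.choose k : ℝ))) * Real.log n
          ≤ (ℓ : ℝ) ^ ((k - 2) / 2) →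
      ∀ (z : Fin n → ℝ), (∀ i, z i = 1 ∨ z i = -1) →
      ∀ (Ω : Type*) [MeasurableSpace Ω] (P : Measure Ω) [IsProbabilityMeasure P]
        (G H : Ω → Tensor n k),
        HasLaw G (symmGaussianLaw n k) P → HasLaw H (symmGaussianLaw n k) P → IndepFun G H P →
        P {ω | ¬ ∃ v ∈ cutoffEigenspace
              (kikuchi ℓ (splitPlus (1 / Real.log n) (spiked β z (G ω)) (H ω)))
              ((1 - γ) * (kikuchiDegree n k ℓ : ℝ) * β),
            ‖v‖ = 1 ∧
            β ^ (2 * c) *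
                ((numParts k ℓ : ℝ) * (γ / 10) * (1 / (1 + Real.log n ^ 2)) ^ c *
                  (1 / Real.log n))
              ≤ (inner ℝ v
                  (guidingState ℓ
                    (splitMinus (1 / Real.log n) (spiked β z (G ω)) (H ω)))) ^ 2}
          ≤ ENNReal.ofReal (err n) := by
  obtain ⟨κ, rfl⟩ := hk.two_dvd
  have hκ : 0 < κ := by lia
  obtain ⟨N, hN⟩ := Filter.eventually_atTop.1 (eventually_isLarge κ γ hA)
  refine ⟨fun n => if N ≤ n then errorBound κ γ A n else 1, ?_, ?_⟩
  · refine (tendsto_errorBound κ γ A).congr' ?_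
    filter_upwards [Filter.eventually_ge_atTop N] with n hn
    rw [if_pos hn]
  rintro n c ℓ hc rfl β hβ hβle hthr z hz Ω _ P _ G H hG hH hGH
  rw [Nat.mul_div_cancel_left κ two_pos] at hβle hthr
  rw [show (2 * κ - 2) / 2 = κ - 1 by lia] at hthr
  by_cases hn : N ≤ n
  · simp only [if_pos hn]
    exact measure_not_hasGuidedVector_le_errorBound hκ hγ hA (hN n hn) hc hβ
      (sq_mul_pow_le_of_le hβ (by positivity) hβle) hthr hz hG hH hGH
  · simp only [if_neg hn, ENNReal.ofReal_one]
    exact prob_le_one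

/-- The `o(1)` is uniform over `c`, `β`, `ε`, `z`: the function `err` depends on `k` and `γ` only.
The bound on the exceptional event is one for its outer measure. -/
theorem mainTheorem4 (k : ℕ) (hk : Even k) (hk4 : 4 ≤ k) (γ : ℝ) (hγ : 0 < γ) (hγ1 : γ ≠ 1) :
    ∃ err : ℕ → ℝ, Filter.Tendsto err Filter.atTop (nhds 0) ∧
      ∀ (n c ℓ : ℕ), 1 ≤ c → ℓ = c * k →
      ∀ (β ε : ℝ), 0 < β → β ≤ 0.1 / (ℓ : ℝ) ^ (k / 2) → 0 < ε →
        (2 * (1 + ε) / ((1 - γ) ^ 2 * (k.choose (k / 2) : ℝ))) *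
            ((n : ℝ) ^ (k / 2) / (β ^ 2 * (n.choose k : ℝ))) * Real.log n
          ≤ (ℓ : ℝ) ^ ((k - 2) / 2) →
      ∀ (z : Fin n → ℝ), (∀ i, z i = 1 ∨ z i = -1) →
      ∀ (Ω : Type*) [MeasurableSpace Ω] (P : MeasureTheory.Measure Ω)
        [MeasureTheory.IsProbabilityMeasure P] (G H : Ω → TensorPCA.Tensor n k),
        ProbabilityTheory.HasLaw G (TensorPCA.symmGaussianLaw n k) P →
        ProbabilityTheory.HasLaw H (TensorPCA.symmGaussianLaw n k) P →
        ProbabilityTheory.IndepFun G H P →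
        P {ω | ¬ ∃ v ∈ TensorPCA.cutoffEigenspace
              (TensorPCA.kikuchi ℓ
                (TensorPCA.splitPlus (1 / Real.log n) (TensorPCA.spiked β z (G ω)) (H ω)))
              ((1 - γ) * (TensorPCA.kikuchiDegree n k ℓ : ℝ) * β),
            ‖v‖ = 1 ∧
            β ^ (2 * c) *
                ((TensorPCA.numParts k ℓ : ℝ) * (γ / 10) * (1 / (1 + Real.log n ^ 2)) ^ c *
                  (1 / Real.log n))
              ≤ (inner ℝ v
                  (TensorPCA.guidingState ℓ
                    (TensorPCA.splitMinus (1 / Real.log n) (TensorPCA.spiked β z (G ω))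
                      (H ω)))) ^ 2}
          ≤ ENNReal.ofReal (err n) := by
  have hA : 0 < 2 / ((1 - γ) ^ 2 * (k.choose (k / 2) : ℝ)) := by
    have : 1 - γ ≠ 0 := sub_ne_zero.2 hγ1.symm
    have : (0 : ℝ) < k.choose (k / 2) := mod_cast Nat.choose_pos (Nat.div_le_self k 2)
    positivity
  obtain ⟨err, herr, hbound⟩ := mainTheorem4_general k hk (by lia) γ hγ _ hA
  refine ⟨err, herr, fun n c ℓ hc hℓ β ε hβ hβle hε hthr => hbound n c ℓ hc hℓ β hβ hβle ?_⟩
  refine le_trans ?_ hthr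
  have : 0 ≤ Real.log n := Real.log_natCast_nonneg n
  gcongr
  linarith
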